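/- Let $n\ge 2$, $0<\mu<1$. Write $d(x,y)=\left|\frac1{x+i}-\frac1{y+i}\right|$ and let $H_\mu(\overline{\mathbb R})$ be the space of functions $f:\mathbb R\to\mathbb C$ with $|f(x)-f(y)|\le C\,d(x,y)^\mu$, with norm $\|f\|_\mu=\sup_x|f(x)|+\sup_{x\ne y}|f(x)-f(y)|/d(x,y)^\mu$; $H^0_\mu(\overline{\mathbb R})$ is the subspace of functions vanishing at infinity. Let $\Pi^\pm$ be the open upper and lower half-planes. For integers $\kappa_1,\dots,\kappa_n$ let $\Lambda(x)=\mathrm{diag}\left(\left(\frac{x-i}{x+i}\right)^{\kappa_1},\dots,\left(\frac{x-i}{x+i}\right)^{\kappa_n}\right)$. A right factorization $G=G^-\Lambda G^+$ on $\mathbb R$ is one in which $G^\pm$ extend to matrix functions that are analytic in $\Pi^\pm$ and continuous and invertible on $\overline{\Pi^\pm}$ including the point at infinity. Let $G_\varphi$, $\varphi\in\mathbb R$, be a family of $n\times n$ matrix functions on $\mathbb R$ such that: (1) $G_\varphi=R_\varphi F R_\varphi^{-1}$, where each $R_\varphi$ is bounded, locally Hölder continuous and invertible on $\mathbb R$;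 (2) $R_0=I$; (3) $F$ does not depend on $\varphi$ and has entries in $H_\mu(\overline{\mathbb R})$; (4) $F(x)\to I$ as $|x|\to\infty$; (5) $F$ has a right factorization $F=F^-\Lambda F^+$ with factors Hölder continuous on $\overline{\mathbb R}$; (6) $\kappa_1\ge\dots\ge\kappa_n$ and $\kappa_1-\kappa_n\le 1$; (7) $G_{1,\varphi}:=(F^-)^{-1}G_\varphi (F^+)^{-1}=\Lambda+\varepsilon N_\varphi$ on $\mathbb R$ for every $\varphi$, with a scalar $\varepsilon=\varepsilon(\varphi)$ and a matrix function $N_\varphi$ with entries in $H^0_\mu(\overline{\mathbb R})$. Let $S_0[f](x)=\frac{x-i}{\pi i}\,\mathrm{p.v.}\!\int_{-\infty}^{\infty}\frac{f(t)\,dt}{(t-i)(t-x)}$, applied to matrices entrywise, and let $C_\mu$ be its operator norm on $H_\mu(\overline{\mathbb R})$. Put $s=\kappa_1-1$, let $k\ge1$ be the number of $j$ with $\kappa_j=\kappa_1$, and let $\Lambda_0(x)=\mathrm{diag}\left(\frac{x-i}{x+i},\dots,\frac{x-i}{x+i},1,\dots,1\right)$ with $k$ non-constant entries, so that $\Lambda=\left(\frac{x-i}{x+i}\right)^{s}\Lambda_0$.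 Define recursively, for $r\ge1$, $$M_0=\left(\tfrac{x+i}{x-i}\right)^{s}N_\varphi,\qquad N_r^+=\tfrac12\Lambda_0^{-1}\left(M_{r-1}+S_0[M_{r-1}]\right),\qquad N_r^-=\tfrac12\left(M_{r-1}-S_0[M_{r-1}]\right),\qquad M_r=-\sum_{j=1}^{r}N_j^-N_{r+1-j}^+ .$$ Let $\nu$ be any sub-multiplicative norm on real $n\times n$ matrices that is monotone on matrices with non-negative entries, and put $\|N_\varphi\|_\mu=\nu\big((\|(N_\varphi)_{pq}\|_\mu)_{p,q}\big)$ and $A=\|N_\varphi\|_\mu(1+C_\mu)^2$. Suppose that $|\varepsilon(\varphi)|\le 1/A$ for some $\varphi$ (no restriction if $A=0$). Then for this $\varphi$: (a) for every $r\ge1$, $N_r^\pm$ are the boundary values of a solution, bounded, analytic in $\Pi^\pm$ and continuous on $\overline{\Pi^\pm}$ including infinity, of the Riemann boundary value problem $\Lambda_0N_r^++N_r^-=M_{r-1}$ on $\mathbb R$, normalized by $\Lambda_0N_r^+=0$ at $z=i$; (b) both series $$G^-_{1,\varepsilon}(x)=I+\sum_{r=1}^\infty\varepsilon^rN_r^-(x)\Lambda_0(x)^{-1},\qquad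 G^+_{1,\varepsilon}(x)=I+\sum_{r=1}^\infty\varepsilon^rN_r^+(x)$$ converge (unconditionally) for all $x\in\mathbb R$; (c) $G_{1,\varphi}=G^-_{1,\varepsilon}\,\Lambda\,G^+_{1,\varepsilon}$ is a right factorization of $G_{1,\varphi}$. -/

import Mathlib

open Complex Filter Topology Set
open scoped NNReal ENNReal

noncomputable section

namespace WienerHopf

/-! ### Hölder functions on the extended real line -/

/-- The distance `|1/(x+i) - 1/(y+i)|` on the real line compactified by one point at infinity. -/
def extDist (x y : ℝ) : ℝ := ‖1 / ((x : ℂ) + I) - 1 / ((y : ℂ) + I)‖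

/-- `f ∈ H_μ(ℝ̄)`. For `μ > 0` this forces `f` to be bounded and to have one and the same limit at
`+∞` and at `-∞`, and the estimate then also holds when `x` or `y` is the point at infinity. -/
def IsHolder (μ : ℝ) (f : ℝ → ℂ) : Prop :=
  ∃ C : ℝ, ∀ x y : ℝ, ‖f x - f y‖ ≤ C * extDist x y ^ μ

/-- `f ∈ H_μ⁰(ℝ̄)`: Hölder continuous on the extended real line and vanishing at infinity. -/
def IsHolderZero (μ : ℝ) (f : ℝ → ℂ) : Prop :=
  IsHolder μ f ∧ Tendsto f (cocompact ℝ) (𝓝 0)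

/-- The norm of `H_μ(ℝ̄)`: the supremum norm plus the Hölder seminorm
(the pairs with `x = y` contribute `0 / 0 = 0`). -/
def holderNorm (μ : ℝ) (f : ℝ → ℂ) : ℝ :=
  (⨆ x : ℝ, ‖f x‖) + ⨆ p : ℝ × ℝ, ‖f p.1 - f p.2‖ / extDist p.1 p.2 ^ μ

/-- Local Hölder continuity on the open real line. -/
def IsLocallyHolder (f : ℝ → ℂ) : Prop :=
  ∀ x : ℝ, ∃ s ∈ 𝓝 x, ∃ C r : ℝ≥0, 0 < r ∧ HolderOnWith C r f s

/-! ### The corrected singular integral operator -/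

/-- `S₀[f](x) = (x - i)/(π i) · p.v. ∫ f(t) dt / ((t - i)(t - x))`. -/
def S0 (f : ℝ → ℂ) (x : ℝ) : ℂ :=
  ((x : ℂ) - I) / (Real.pi * I) *
    limUnder (𝓝[>] (0 : ℝ)) fun δ : ℝ =>
      ∫ t in {t : ℝ | δ < |t - x|}, f t / (((t : ℂ) - I) * ((t : ℂ) - (x : ℂ)))

/-- `C_μ`, the operator norm of `S₀` on `H_μ(ℝ̄)`: the infimum of the admissible bounds. -/
def S0norm (μ : ℝ) : ℝ≥0∞ :=
  ⨅ (C : ℝ≥0) (_ : ∀ f : ℝ → ℂ, IsHolder μ f →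
    IsHolder μ (S0 f) ∧ holderNorm μ (S0 f) ≤ C * holderNorm μ f), (C : ℝ≥0∞)

/-! ### Matrix functions, norms -/

/-- Square complex matrix functions of a real variable. -/
abbrev MatFun (n : ℕ) := ℝ → Matrix (Fin n) (Fin n) ℂ

/-- A sub-multiplicative norm on real square matrices which is monotone on matrices with
non-negative entries. -/
structure IsMonotoneMatrixNorm {n : ℕ} (ν : Matrix (Fin n) (Fin n) ℝ → ℝ) : Prop where
  eq_zero : ∀ A, ν A = 0 → A = 0
  smul : ∀ (c : ℝ) A, ν (c • A) = |c| * ν A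
  add_le : ∀ A B, ν (A + B) ≤ ν A + ν B
  mul_le : ∀ A B, ν (A * B) ≤ ν A * ν B
  mono : ∀ A B, (∀ p q, 0 ≤ A p q) → (∀ p q, A p q ≤ B p q) → ν A ≤ ν B

/-- The sub-multiplicative norm on matrix functions with entries in `H_μ(ℝ̄)` that comes from the
matrix norm `ν`: the norm `ν` of the matrix of the Hölder norms of the entries. -/
def matHolderNorm {n : ℕ} (ν : Matrix (Fin n) (Fin n) ℝ → ℝ) (μ : ℝ) (B : MatFun n) : ℝ :=
  ν (Matrix.of fun p q => holderNorm μ fun x => B x p q)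

/-- `A = ‖N‖_μ (1 + C_μ)²`. -/
def convConst {n : ℕ} (ν : Matrix (Fin n) (Fin n) ℝ → ℝ) (μ : ℝ) (N : MatFun n) : ℝ≥0∞ :=
  ENNReal.ofReal (matHolderNorm ν μ N) * (1 + S0norm μ) ^ 2

/-! ### Factorization -/

/-- The open upper half-plane. -/
def upper : Set ℂ := {z | 0 < z.im}

/-- The open lower half-plane. -/
def lower : Set ℂ := {z | z.im < 0}

/-- `H` is analytic in the half-plane `U`, continuous up to the real line and the point at infinity
(hence bounded), where its value is `L`, and `G` is its restriction to the real line. -/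
structure IsContinuation {n : ℕ} (U : Set ℂ) (G : MatFun n)
    (H : ℂ → Matrix (Fin n) (Fin n) ℂ) (L : Matrix (Fin n) (Fin n) ℂ) : Prop where
  analytic : ∀ p q, DifferentiableOn ℂ (fun z => H z p q) U
  cont : ∀ p q, ContinuousOn (fun z => H z p q) (closure U)
  at_infty : ∀ p q, Tendsto (fun z => H z p q) (cocompact ℂ ⊓ 𝓟 (closure U)) (𝓝 (L p q))
  eq_real : ∀ x : ℝ, H (x : ℂ) = G x

/-- A factor: it continues analytically to the half-plane `U`, with invertible values on the closed
half-plane including infinity. -/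
def IsFactor {n : ℕ} (U : Set ℂ) (G : MatFun n) : Prop :=
  ∃ H L, IsContinuation U G H L ∧ (∀ z ∈ closure U, IsUnit (H z)) ∧ IsUnit L

/-- `(x - i)/(x + i)`. -/
def cayley (x : ℝ) : ℂ := ((x : ℂ) - I) / ((x : ℂ) + I)

/-- `Λ(x) = diag (((x - i)/(x + i)) ^ κ_j)`. -/
def Lam {n : ℕ} (κ : Fin n → ℤ) : MatFun n := fun x =>
  Matrix.diagonal fun j => cayley x ^ κ j

/-- The right factorization `G = G⁻ Λ G⁺` with partial indices `κ`. -/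
structure IsRightFactorization {n : ℕ} (G Gm : MatFun n) (κ : Fin n → ℤ) (Gp : MatFun n) :
    Prop where
  minus : IsFactor lower Gm
  plus : IsFactor upper Gp
  eq : ∀ x, G x = Gm x * Lam κ x * Gp x

/-! ### The class of matrix functions -/

/-- The family `G φ` belongs to the class `𝒮K_n`, with the data `R φ`, `F` and the right
factorization `F = F⁻ Λ F⁺` with stable partial indices. -/
structure IsSK {n : ℕ} (μ : ℝ) (G R : ℝ → MatFun n) (F Fm : MatFun n) (κ : Fin n → ℤ)
    (Fp : MatFun n) : Prop where
  repr : ∀ φ x, G φ x = R φ x * F x * (R φ x)⁻¹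
  R_bounded : ∀ φ, ∃ B : ℝ, ∀ x p q, ‖R φ x p q‖ ≤ B
  R_holder : ∀ φ p q, IsLocallyHolder fun x => R φ x p q
  R_unit : ∀ φ x, IsUnit (R φ x)
  R_zero : ∀ x, R 0 x = 1
  F_holder : ∀ p q, IsHolder μ fun x => F x p q
  F_infty : Tendsto F (cocompact ℝ) (𝓝 1)
  F_fact : IsRightFactorization F Fm κ Fp
  factors_holder : ∃ r : ℝ, 0 < r ∧ r < 1 ∧
    ∀ p q, IsHolder r (fun x => Fm x p q) ∧ IsHolder r (fun x => Fp x p q)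
  ordered : Antitone κ
  stable : ∀ i j, κ i - κ j ≤ 1

/-- `G₁ = (F⁻)⁻¹ G (F⁺)⁻¹`. -/
def G1 {n : ℕ} (G Fm Fp : MatFun n) : MatFun n := fun x => (Fm x)⁻¹ * G x * (Fp x)⁻¹

/-- For every `φ`, `G₁ = Λ + ε N` with `N` in `H_μ⁰(ℝ̄)`. -/
structure HasDecomposition {n : ℕ} (μ : ℝ) (G : ℝ → MatFun n) (Fm : MatFun n) (κ : Fin n → ℤ)
    (Fp : MatFun n) (ε : ℝ → ℂ) (N : ℝ → MatFun n) : Prop where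
  eq : ∀ φ x, G1 (G φ) Fm Fp x = Lam κ x + ε φ • N φ x
  holder : ∀ φ p q, IsHolderZero μ fun x => N φ x p q

/-! ### The algorithm

Stable indices `κ_1 ≥ … ≥ κ_n` are `s + 1` (`k` times, `1 ≤ k ≤ n`) followed by `s` (`n - k` times),
where `s = κ_1 - 1`; the first `k` rows are those with `κ_p = κ_1`. -/

variable {n : ℕ} [NeZero n]

/-- `Λ₀ = diag ((x - i)/(x + i), …, (x - i)/(x + i), 1, …, 1)`, so that
`Λ = ((x - i)/(x + i)) ^ s Λ₀`. -/
def Lam0 (κ : Fin n → ℤ) : MatFun n := fun x =>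
  Matrix.diagonal fun j => if κ j = κ 0 then cayley x else 1

/-- Minus part of the solution of `Λ₀ N⁺ + N⁻ = M`: the boundary values
`n⁻ = (m - S₀[m]) / 2` of the entries. -/
def solMinus (M : MatFun n) : MatFun n := fun x =>
  Matrix.of fun p q => 1 / 2 * (M x p q - S0 (fun t => M t p q) x)

/-- Plus part of the solution of `Λ₀ N⁺ + N⁻ = M`: the boundary values
`n⁺ = (x + i)/(x - i) (m + S₀[m]) / 2` in the first `k` rows, `n⁺ = (m + S₀[m]) / 2` in the
others. -/
def solPlus (κ : Fin n → ℤ) (M : MatFun n) : MatFun n := fun x =>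
  Matrix.of fun p q => (if κ p = κ 0 then ((x : ℂ) + I) / ((x : ℂ) - I) else 1) *
    (1 / 2 * (M x p q + S0 (fun t => M t p q) x))

/-- `(Np, Nm)` is the bounded solution of the Riemann boundary value problem
`Λ₀ N⁺ + N⁻ = M` for which `Λ₀ N⁺` vanishes at `z = i` (in the first `k` rows `Λ₀` itself vanishes
there). -/
structure IsBoundedSolution (κ : Fin n → ℤ) (M Np Nm : MatFun n) : Prop where
  eq : ∀ x, Lam0 κ x * Np x + Nm x = M x
  plus : ∃ H L, IsContinuation upper Np H L ∧ ∀ p q, κ p ≠ κ 0 → H I p q = 0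
  minus : ∃ H L, IsContinuation lower Nm H L

/-- The right-hand sides `M_r`: `M_0 = ((x + i)/(x - i)) ^ s N` and
`M_r = -(N_1⁻ N_r⁺ + N_2⁻ N_{r-1}⁺ + … + N_r⁻ N_1⁺)` for `r ≥ 1`, where `(N_{j+1}⁺, N_{j+1}⁻)` is the
solution with the right-hand side `M_j`. -/
def rhs (κ : Fin n → ℤ) (N : MatFun n) : ℕ → MatFun n
  | 0 => fun x => (((x : ℂ) + I) / ((x : ℂ) - I)) ^ (κ 0 - 1) • N x
  | r + 1 => fun x =>
      -∑ j : Fin (r + 1), solMinus (rhs κ N j.1) x * solPlus κ (rhs κ N (r - j.1)) x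
  decreasing_by all_goals omega

/-- `N_r⁺`, meaningful for `r ≥ 1`. -/
def coeffPlus (κ : Fin n → ℤ) (N : MatFun n) (r : ℕ) : MatFun n := solPlus κ (rhs κ N (r - 1))

/-- `N_r⁻`, meaningful for `r ≥ 1`. -/
def coeffMinus (κ : Fin n → ℤ) (N : MatFun n) (r : ℕ) : MatFun n := solMinus (rhs κ N (r - 1))

/-- The term of order `r + 1` of the series for `G⁺`: `ε^{r+1} N_{r+1}⁺`. -/
def termPlus (κ : Fin n → ℤ) (ε : ℂ) (N : MatFun n) (r : ℕ) : MatFun n := fun x =>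
  ε ^ (r + 1) • coeffPlus κ N (r + 1) x

/-- The term of order `r + 1` of the series for `G⁻`: `ε^{r+1} N_{r+1}⁻ Λ₀⁻¹`. -/
def termMinus (κ : Fin n → ℤ) (ε : ℂ) (N : MatFun n) (r : ℕ) : MatFun n := fun x =>
  ε ^ (r + 1) • (coeffMinus κ N (r + 1) x * (Lam0 κ x)⁻¹)

/-- `G⁺ = I + ∑_{r ≥ 1} ε^r N_r⁺`. -/
def seriesPlus (κ : Fin n → ℤ) (ε : ℂ) (N : MatFun n) : MatFun n := fun x =>
  1 + ∑' r, termPlus κ ε N r x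

/-- `G⁻ = I + ∑_{r ≥ 1} ε^r N_r⁻ Λ₀⁻¹`. -/
def seriesMinus (κ : Fin n → ℤ) (ε : ℂ) (N : MatFun n) : MatFun n := fun x =>
  1 + ∑' r, termMinus κ ε N r x

end WienerHopf

end

noncomputable section

namespace WienerHopf

open MeasureTheory Metric

/-! ### Normalized arc length -/

/-! The Cayley transform `w = (x - i)/(x + i)` carries the line to the unit circle, infinity to `1`,
`i` to the centre and the lower half-plane to the exterior. Under it `S₀` becomes `2 P₊ - 1`, where
`P₊` projects onto boundary values of functions analytic in the disc and zero at the centre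
(`S0_comp_cay`). With `P₋ = 1 - P₊` the algorithm reads `N_r⁻ = P₋ M_{r-1}`, `Λ₀ N_r⁺ = P₊ M_{r-1}`,
and after removal of a scalar power of `w` the matrix to be factored is `Λ₀ + ε M` with `M = M₀`.

The recursion for `M_r` is quadratic, but it hides two linear ones. As formal power series in `ε`,
solve `Z + ε P₊(M Λ₀⁻¹ Z) = -ε P₊ M` and `O + ε P₋(O Λ₀⁻¹ M) = -ε P₋ M`, and put `Y = 1 + Λ₀⁻¹ Z`,
`U = 1 + O Λ₀⁻¹`. Then `(Λ₀ + ε M) Y = V Λ₀` and `U (Λ₀ + ε M) = Λ₀ Q` with `V - 1` of minus type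
and `Λ₀ (Q - 1)` of plus type, zero at the centre. Hence `U V Λ₀ = Λ₀ Q Y`. Subtracting `Λ₀` leaves
a minus function on the left and a plus function vanishing at the centre on the right, so both are
zero: `U` inverts `V`, `Y` inverts `Q`, and `V Λ₀ Q = Λ₀ + ε M` (`formal_factorization`). Comparing
coefficients recovers the quadratic recursion (`coeff_recursion`), so `V` and `Q` are the two series
of the algorithm.

For convergence the linear recursions suffice. Both projections are contractions in mean square, so
the mean square norms grow at most like `ν(B) ^ r`, where `B` bounds the entries of `M` uniformly.
The commutator of `P₊` with multiplication by a Hölder function is arbitrarily small in the supremum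
norm up to a mean square term (`exists_commutator_bound`), so the supremum norms grow at most like
`ρ ^ r` for every `ρ > ν(B)` (`exists_growth_of_recursion`). Since `S₀[1] = -1`, one has `C_μ ≥ 1`,
and the condition on `ε` gives `|ε| ν(B) ≤ 1/4`. Thus `U`, `V`, `Q`, `Y` all converge uniformly, and
the limits of `U` and `Y` make the factors invertible up to the boundary. -/

/-- Normalized arc length on the circle, in terms of the angle. -/
def arc : Measure ℝ := ENNReal.ofReal (2 * Real.pi)⁻¹ • volume.restrict (Ioc (-Real.pi) Real.pi)

instance : IsProbabilityMeasure arc := by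
  constructor
  have hpi := Real.pi_pos
  rw [arc, Measure.smul_apply, Measure.restrict_apply_univ, Real.volume_Ioc, smul_eq_mul,
    ← ENNReal.ofReal_mul (by positivity)]
  rw [show (2 * Real.pi)⁻¹ * (Real.pi - -Real.pi) = 1 by field_simp; ring]
  exact ENNReal.ofReal_one

lemma integral_arc {E : Type*} [NormedAddCommGroup E] [NormedSpace ℝ E] (h : ℝ → E) :
    ∫ t, h t ∂arc = (2 * Real.pi)⁻¹ • ∫ t in (-Real.pi)..Real.pi, h t := by
  have hpi := Real.pi_pos
  rw [arc, integral_smul_measure, ENNReal.toReal_ofReal (by positivity),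
    intervalIntegral.integral_of_le (by linarith)]

lemma ae_arc_iff {p : ℝ → Prop} :
    (∀ᵐ t ∂arc, p t) ↔ ∀ᵐ t ∂(volume.restrict (Ioc (-Real.pi) Real.pi)), p t := by
  have hpi := Real.pi_pos
  rw [arc, Measure.ae_ennreal_smul_measure_iff]
  simp only [ne_eq, ENNReal.ofReal_eq_zero, not_le]
  positivity

lemma integrable_arc_of_continuous {E : Type*} [NormedAddCommGroup E] {h : ℝ → E} (hh : Continuous h) : Integrable h arc :=
  (hh.integrableOn_Ioc).smul_measure ENNReal.ofReal_ne_top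

lemma integral_arc_mul_left {E : Type*} [NormedAddCommGroup E] [NormedSpace ℝ E]
    (h : Circle → E) (c : Circle) :
    ∫ t, h (c * Circle.exp t) ∂arc = ∫ t, h (Circle.exp t) ∂arc := by
  obtain ⟨a, rfl⟩ := Circle.exp_surjective c
  have hp : Function.Periodic (fun t => h (Circle.exp t)) (2 * Real.pi) := fun t => by
    simp only [Circle.exp_add_two_pi]
  simp only [integral_arc, ← Circle.exp_add]
  rw [intervalIntegral.integral_comp_add_left (fun t => h (Circle.exp t)) a]
  have := hp.intervalIntegral_add_eq (a + -Real.pi) (-Real.pi)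
  rw [show a + -Real.pi + 2 * Real.pi = a + Real.pi by ring,
    show -Real.pi + 2 * Real.pi = Real.pi by ring] at this
  rw [this]

lemma integral_arc_inv {E : Type*} [NormedAddCommGroup E] [NormedSpace ℝ E] (h : Circle → E) :
    ∫ t, h (Circle.exp t)⁻¹ ∂arc = ∫ t, h (Circle.exp t) ∂arc := by
  simp only [integral_arc, ← Circle.exp_neg]
  rw [intervalIntegral.integral_comp_neg (fun t => h (Circle.exp t)), neg_neg]

lemma circleMap_eq_exp (t : ℝ) : circleMap 0 1 t = (Circle.exp t : ℂ) := by
  simp [circleMap, Circle.coe_exp]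

lemma integral_arc_eq_circleAverage (u : ℂ → ℂ) :
    ∫ t, u (Circle.exp t) ∂arc = Real.circleAverage u 0 1 := by
  have hp : Function.Periodic (fun t => u (Circle.exp t)) (2 * Real.pi) := fun t => by
    simp only [Circle.exp_add_two_pi]
  have := hp.intervalIntegral_add_eq (-Real.pi) 0
  rw [show -Real.pi + 2 * Real.pi = Real.pi by ring, zero_add] at this
  rw [integral_arc, Real.circleAverage, this]
  simp only [circleMap_eq_exp]

lemma integral_arc_eq_center {u : ℂ → ℂ} (hu : DiffContOnCl ℂ u (ball 0 1)) :
    ∫ t, u (Circle.exp t) ∂arc = u 0 := by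
  rw [integral_arc_eq_circleAverage]
  exact DiffContOnCl.circleAverage (by simpa using hu)

lemma eq_zero_of_integral_arc_normSq {f : Circle → ℂ} (hf : Continuous f)
    (h : ∫ t, ‖f (Circle.exp t)‖ ^ 2 ∂arc = 0) (w : Circle) : f w = 0 := by
  have hpi := Real.pi_pos
  have hc : Continuous fun t => ‖f (Circle.exp t)‖ ^ 2 := by fun_prop
  have h1 := (integral_eq_zero_iff_of_nonneg (fun t => by positivity)
    (integrable_arc_of_continuous hc)).1 h
  have h2 := ae_arc_iff.1 h1
  have h3 := Measure.eqOn_Icc_of_ae_eq volume (a := -Real.pi) (b := Real.pi) (by linarith)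
    (by rwa [← restrict_Ioc_eq_restrict_Icc]) hc.continuousOn continuous_const.continuousOn
  have h4 := h3 (x := arg w) ⟨(neg_pi_lt_arg _).le, arg_le_pi _⟩
  simp only [Circle.exp_arg] at h4
  exact norm_eq_zero.1 (pow_eq_zero_iff two_ne_zero |>.1 h4)

/-! ### The weakly singular kernel -/

/-- The chord is `2 |sin (t/2)|`, and Jordan's inequality bounds the sine below by a linear
function. -/
lemma norm_exp_sub_one_ge {t : ℝ} (ht : |t| ≤ Real.pi) :
    2 / Real.pi * |t| ≤ ‖(Circle.exp t : ℂ) - 1‖ := by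
  have h1 : |t / 2| ≤ Real.pi / 2 := by rw [abs_div, abs_two]; linarith
  have h2 := Real.mul_abs_le_abs_sin h1
  rw [Circle.coe_exp, mul_comm (t : ℂ), norm_exp_I_mul_ofReal_sub_one, norm_mul, Real.norm_eq_abs,
    Real.norm_eq_abs, abs_two]
  rw [abs_div, abs_two] at h2
  linarith [mul_div_assoc (2 / Real.pi) |t| 2]

lemma ae_arc_ne_one : ∀ᵐ t ∂arc, (Circle.exp t : ℂ) - 1 ≠ 0 := by
  rw [ae_arc_iff, ae_restrict_iff' measurableSet_Ioc]
  have h0 : ∀ᵐ t : ℝ, t ≠ 0 := by simp [ae_iff]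
  filter_upwards [h0] with t ht hm h
  have h1 := norm_exp_sub_one_ge (abs_le.2 ⟨hm.1.le, hm.2⟩)
  rw [h, norm_zero] at h1
  have : 0 < |t| := abs_pos.2 ht
  have := Real.pi_pos
  have : 0 < 2 / Real.pi * |t| := by positivity
  linarith

/-- The exponent is non-positive, so the lower bound for the chord becomes an upper bound by a
multiple of `|t| ^ (l - 1)`, which is integrable because `l > 0`. -/
lemma integrable_kernel {l : ℝ} (hl : 0 < l) (hl1 : l ≤ 1) :
    Integrable (fun t => ‖(Circle.exp t : ℂ) - 1‖ ^ (l - 1)) arc := by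
  have hpi := Real.pi_pos
  have h1 : IntervalIntegrable (fun t : ℝ => t ^ (l - 1)) volume 0 Real.pi :=
    intervalIntegral.intervalIntegrable_rpow' (by linarith)
  have h2 : IntervalIntegrable (fun t : ℝ => |t| ^ (l - 1)) volume 0 Real.pi := by
    refine h1.congr fun t ht => ?_
    rw [uIoc_of_le hpi.le] at ht
    simp only [abs_of_pos ht.1]
  have h3 : IntervalIntegrable (fun t : ℝ => |t| ^ (l - 1)) volume (-Real.pi) 0 := by
    have := h2.comp_sub_left 0
    simp only [zero_sub, abs_neg, sub_zero] at this
    exact this.symm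
  have h4 : IntegrableOn (fun t : ℝ => |t| ^ (l - 1)) (Ioc (-Real.pi) Real.pi) :=
    (intervalIntegrable_iff_integrableOn_Ioc_of_le (by linarith)).1 (h3.trans h2)
  have h5 : Integrable (fun t : ℝ => (2 / Real.pi) ^ (l - 1) * |t| ^ (l - 1)) arc :=
    (h4.smul_measure ENNReal.ofReal_ne_top).const_mul _
  refine h5.mono' ?_ ?_
  · have : Measurable fun t : ℝ => ‖(Circle.exp t : ℂ) - 1‖ :=
      (by fun_prop : Continuous fun t : ℝ => ‖(Circle.exp t : ℂ) - 1‖).measurable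
    exact (this.pow_const _).aestronglyMeasurable
  · rw [ae_arc_iff, ae_restrict_iff' measurableSet_Ioc]
    have h0 : ∀ᵐ t : ℝ, t ≠ 0 := by simp [ae_iff]
    filter_upwards [h0] with t ht hm
    have h1 := norm_exp_sub_one_ge (abs_le.2 ⟨hm.1.le, hm.2⟩)
    have : 0 < |t| := abs_pos.2 ht
    rw [Real.norm_of_nonneg (by positivity), ← Real.mul_rpow (by positivity) (by positivity)]
    exact Real.rpow_le_rpow_of_nonpos (by positivity) h1 (by linarith)

/-! ### Hölder functions on the circle -/

/-- Hölder continuity with some positive exponent. -/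
def IsHol (f : Circle → ℂ) : Prop :=
  ∃ C l : ℝ, 0 ≤ C ∧ 0 < l ∧ l ≤ 1 ∧ ∀ a b : Circle, ‖f a - f b‖ ≤ C * ‖(a : ℂ) - b‖ ^ l

lemma norm_circle_sub_le (a b : Circle) : ‖(a : ℂ) - b‖ ≤ 2 :=
  (norm_sub_le _ _).trans (by rw [Circle.norm_coe, Circle.norm_coe]; norm_num)

lemma norm_circle_sub_rpow_le {l l' : ℝ} (h : 0 < l') (hl : l' ≤ l) (a b : Circle) :
    ‖(a : ℂ) - b‖ ^ l ≤ 2 ^ (l - l') * ‖(a : ℂ) - b‖ ^ l' := by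
  rcases eq_or_lt_of_le (norm_nonneg ((a : ℂ) - b)) with h0 | h0
  · rw [← h0, Real.zero_rpow (by linarith), Real.zero_rpow (by linarith), mul_zero]
  · have : ‖(a : ℂ) - b‖ ^ l = ‖(a : ℂ) - b‖ ^ (l - l') * ‖(a : ℂ) - b‖ ^ l' := by
      rw [← Real.rpow_add h0]; ring_nf
    rw [this]
    exact mul_le_mul_of_nonneg_right (Real.rpow_le_rpow h0.le (norm_circle_sub_le a b)
      (by linarith)) (by positivity)

lemma isHol_of_bound {f : Circle → ℂ} {C l : ℝ} (hl : 0 < l)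
    (h : ∀ a b : Circle, ‖f a - f b‖ ≤ C * ‖(a : ℂ) - b‖ ^ l) : IsHol f := by
  refine ⟨|C| * 2 ^ (l - min l 1), min l 1, by positivity, by positivity, min_le_right _ _,
    fun a b => (h a b).trans ?_⟩
  rw [mul_assoc]
  have := norm_circle_sub_rpow_le (l' := min l 1) (l := l) (by positivity) (min_le_left _ _) a b
  exact (mul_le_mul_of_nonneg_right (le_abs_self C) (by positivity)).trans
    (mul_le_mul_of_nonneg_left this (abs_nonneg C))

/-- Chords have length at most `2`, so an exponent may always be lowered. This brings two functions
to one exponent and makes the Hölder functions of unspecified exponent an algebra. -/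
lemma IsHol.exponent_le {f : Circle → ℂ} (hf : IsHol f) : ∃ l : ℝ, 0 < l ∧ l ≤ 1 ∧
    ∀ l' : ℝ, 0 < l' → l' ≤ l → ∃ C : ℝ, 0 ≤ C ∧ ∀ a b : Circle,
      ‖f a - f b‖ ≤ C * ‖(a : ℂ) - b‖ ^ l' := by
  obtain ⟨C, l, hC, hl, hl1, h⟩ := hf
  refine ⟨l, hl, hl1, fun l' h0 hl' => ⟨C * 2 ^ (l - l'), by positivity, fun a b =>
    (h a b).trans ?_⟩⟩
  rw [mul_assoc]
  exact mul_le_mul_of_nonneg_left (norm_circle_sub_rpow_le h0 hl' a b) hC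

lemma IsHol.common_exponent {f g : Circle → ℂ} (hf : IsHol f) (hg : IsHol g) :
    ∃ C D l : ℝ, 0 ≤ C ∧ 0 ≤ D ∧ 0 < l ∧ l ≤ 1 ∧
      (∀ a b : Circle, ‖f a - f b‖ ≤ C * ‖(a : ℂ) - b‖ ^ l) ∧
      ∀ a b : Circle, ‖g a - g b‖ ≤ D * ‖(a : ℂ) - b‖ ^ l := by
  obtain ⟨l, hl, hl1, h⟩ := hf.exponent_le
  obtain ⟨l', hl', hl1', h'⟩ := hg.exponent_le
  obtain ⟨C, hC, hC'⟩ := h (min l l') (by positivity) (min_le_left _ _)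
  obtain ⟨D, hD, hD'⟩ := h' (min l l') (by positivity) (min_le_right _ _)
  exact ⟨C, D, min l l', hC, hD, by positivity, (min_le_left _ _).trans hl1, hC', hD'⟩

lemma IsHol.continuous {f : Circle → ℂ} (hf : IsHol f) : Continuous f := by
  obtain ⟨C, l, hC, hl, hl1, h⟩ := hf
  rw [continuous_iff_continuousAt]
  intro a
  rw [ContinuousAt, tendsto_iff_norm_sub_tendsto_zero]
  have h1 : Tendsto (fun b : Circle => C * ‖(b : ℂ) - a‖ ^ l) (𝓝 a) (𝓝 (C * 0)) := by
    refine Tendsto.const_mul _ ?_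
    have : Continuous fun b : Circle => ‖(b : ℂ) - a‖ ^ l :=
      (by fun_prop : Continuous fun b : Circle => ‖(b : ℂ) - a‖).rpow_const fun _ => Or.inr hl.le
    have := this.tendsto a
    simpa [Real.zero_rpow hl.ne'] using this
  rw [mul_zero] at h1
  exact squeeze_zero (fun _ => norm_nonneg _) (fun b => h b a) h1

lemma exists_bound_of_continuous {f : Circle → ℂ} (hf : Continuous f) :
    ∃ B : ℝ, 0 ≤ B ∧ ∀ w, ‖f w‖ ≤ B := by
  obtain ⟨B, hB⟩ := isCompact_univ.exists_bound_of_continuousOn hf.continuousOn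
  exact ⟨|B|, abs_nonneg B, fun w => (hB w (mem_univ _)).trans (le_abs_self B)⟩

lemma isHol_const (c : ℂ) : IsHol fun _ => c :=
  ⟨0, 1, le_rfl, one_pos, le_rfl, fun a b => by simp⟩

lemma isHol_coe : IsHol fun w => (w : ℂ) :=
  ⟨1, 1, zero_le_one, one_pos, le_rfl, fun a b => by simp⟩

lemma IsHol.add {f g : Circle → ℂ} (hf : IsHol f) (hg : IsHol g) : IsHol fun w => f w + g w := by
  obtain ⟨C, D, l, hC, hD, hl, hl1, h, h'⟩ := hf.common_exponent hg
  refine ⟨C + D, l, by positivity, hl, hl1, fun a b => ?_⟩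
  rw [add_sub_add_comm, add_mul]
  exact (norm_add_le _ _).trans (add_le_add (h a b) (h' a b))

lemma IsHol.mul {f g : Circle → ℂ} (hf : IsHol f) (hg : IsHol g) : IsHol fun w => f w * g w := by
  obtain ⟨C, D, l, hC, hD, hl, hl1, h, h'⟩ := hf.common_exponent hg
  obtain ⟨B, hB, hB'⟩ := exists_bound_of_continuous hf.continuous
  obtain ⟨B₁, hB₁, hB₁'⟩ := exists_bound_of_continuous hg.continuous
  refine ⟨B * D + C * B₁, l, by positivity, hl, hl1, fun a b => ?_⟩
  rw [show f a * g a - f b * g b = f a * (g a - g b) + (f a - f b) * g b by ring]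
  refine (norm_add_le _ _).trans ?_
  rw [norm_mul, norm_mul, add_mul]
  have h1 : ‖f a‖ * ‖g a - g b‖ ≤ B * (D * ‖(a : ℂ) - b‖ ^ l) :=
    mul_le_mul (hB' a) (h' a b) (norm_nonneg _) hB
  have h2 : ‖f a - f b‖ * ‖g b‖ ≤ C * ‖(a : ℂ) - b‖ ^ l * B₁ :=
    mul_le_mul (h a b) (hB₁' b) (norm_nonneg _) (by positivity)
  linarith

lemma IsHol.const_mul {f : Circle → ℂ} (hf : IsHol f) (c : ℂ) : IsHol fun w => c * f w :=
  (isHol_const c).mul hf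

lemma IsHol.neg {f : Circle → ℂ} (hf : IsHol f) : IsHol fun w => -f w := by
  simpa using hf.const_mul (-1)

lemma IsHol.sub {f g : Circle → ℂ} (hf : IsHol f) (hg : IsHol g) : IsHol fun w => f w - g w := by
  simpa [sub_eq_add_neg] using hf.add hg.neg

lemma isHol_sum {ι : Type*} (s : Finset ι) {f : ι → Circle → ℂ} (h : ∀ i ∈ s, IsHol (f i)) :
    IsHol fun w => ∑ i ∈ s, f i w := by
  classical
  induction s using Finset.induction_on with
  | empty => simpa using isHol_const 0
  | insert a s ha ih =>
    simp only [Finset.sum_insert ha]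
    exact (h a (Finset.mem_insert_self _ _)).add
      (ih fun i hi => h i (Finset.mem_insert_of_mem hi))

lemma norm_inv_sub_inv (a b : Circle) : ‖((a⁻¹ : Circle) : ℂ) - (b⁻¹ : Circle)‖ = ‖(a : ℂ) - b‖ := by
  rw [Circle.coe_inv_eq_conj, Circle.coe_inv_eq_conj, ← map_sub, RCLike.norm_conj]

lemma IsHol.comp_inv {f : Circle → ℂ} (hf : IsHol f) : IsHol fun w => f w⁻¹ := by
  obtain ⟨C, l, hC, hl, hl1, h⟩ := hf
  exact ⟨C, l, hC, hl, hl1, fun a b => by rw [← norm_inv_sub_inv]; exact h _ _⟩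

/-! ### Boundary values of analytic functions -/

/-- Boundary values of a function analytic in the disc and continuous up to the circle. -/
def IsPlus (f : Circle → ℂ) : Prop :=
  ∃ u : ℂ → ℂ, DiffContOnCl ℂ u (ball 0 1) ∧ ∀ w : Circle, u w = f w

/-- Boundary values of an analytic function in the disc that vanishes at the centre. -/
def IsPlusZero (f : Circle → ℂ) : Prop :=
  ∃ u : ℂ → ℂ, DiffContOnCl ℂ u (ball 0 1) ∧ u 0 = 0 ∧ ∀ w : Circle, u w = f w

/-- Boundary values of a function analytic outside of the disc, including infinity. -/
def IsMinus (f : Circle → ℂ) : Prop := IsPlus fun w => f w⁻¹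

/-- The projection onto the boundary values of functions analytic in the disc and vanishing at
the centre. -/
def projPlus (f : Circle → ℂ) (z : Circle) : ℂ :=
  ∫ t, (f (z * Circle.exp t) - f z) / ((Circle.exp t : ℂ) - 1) ∂arc

/-- The complementary projection. -/
def projMinus (f : Circle → ℂ) (z : Circle) : ℂ := f z - projPlus f z

lemma norm_mul_exp_arg (z : ℂ) : (‖z‖ : ℂ) * (Circle.exp (arg z) : ℂ) = z := by
  rw [Circle.coe_exp]; exact norm_mul_exp_arg_mul_I z

lemma continuousAt_exp_arg {z : ℂ} (hz : z ≠ 0) :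
    ContinuousAt (fun z : ℂ => Circle.exp (arg z)) z := by
  have hi : IsInducing (fun w : Circle => (w : ℂ)) := ⟨rfl⟩
  rw [hi.continuousAt_iff]
  have h1 : ContinuousAt (fun z : ℂ => z / (‖z‖ : ℂ)) z := by
    refine ContinuousAt.div continuousAt_id (by fun_prop) (by simpa using hz)
  refine h1.congr ?_
  filter_upwards [isOpen_ne.mem_nhds hz] with y hy
  have h2 := norm_mul_exp_arg y
  have h3 : (‖y‖ : ℂ) ≠ 0 := by simpa using hy
  simp only [Function.comp]
  rw [div_eq_iff h3, mul_comm]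
  exact h2.symm

lemma ofReal_sub_ne_zero {t : ℝ} {z : ℂ} (hz : ‖z‖ < 1) : (Circle.exp t : ℂ) - z ≠ 0 := by
  intro h
  rw [sub_eq_zero] at h
  rw [← h, Circle.norm_coe] at hz
  exact lt_irrefl _ hz

/-- The substitution `τ ↦ τ⁻¹` turns the integrand into `r τ / (1 - r τ)`, which is analytic on the
closed disc and zero at the centre; its mean is the central value. -/
lemma integral_poisson_zero {r : ℝ} (h0 : 0 ≤ r) (h1 : r < 1) :
    ∫ t, (r : ℂ) / ((Circle.exp t : ℂ) - r) ∂arc = 0 := by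
  have hne : ∀ z : ℂ, ‖z‖ ≤ 1 → 1 - r * z ≠ 0 := fun z hz h => by
    have h2 : (1 : ℂ) = r * z := sub_eq_zero.1 h
    have h3 : ‖(r : ℂ) * z‖ < 1 := by
      rw [norm_mul, Complex.norm_real, Real.norm_of_nonneg h0]
      nlinarith [norm_nonneg z]
    rw [← h2, norm_one] at h3
    exact lt_irrefl _ h3
  have hd : DiffContOnCl ℂ (fun z : ℂ => r * z / (1 - r * z)) (ball 0 1) := by
    apply DifferentiableOn.diffContOnCl
    rw [closure_ball _ one_ne_zero]
    intro z hz
    rw [mem_closedBall_zero_iff] at hz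
    have h1 : DifferentiableAt ℂ (fun z : ℂ => (r : ℂ) * z) z := by fun_prop
    exact (h1.fun_div (h1.const_sub 1) (hne z hz)).differentiableWithinAt
  have h2 := integral_arc_eq_center hd
  rw [← integral_arc_inv (fun w : Circle => (r : ℂ) / ((w : ℂ) - r))]
  rw [mul_zero, zero_div] at h2
  rw [← h2]
  congr 1
  ext t
  have h3 := hne (Circle.exp t) (by rw [Circle.norm_coe])
  have h4 := Circle.coe_ne_zero (Circle.exp t)
  rw [Circle.coe_inv]
  have h5 : ((Circle.exp t : ℂ))⁻¹ - r = (1 - r * Circle.exp t) / Circle.exp t := by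
    field_simp
  rw [h5]
  field_simp

lemma continuous_mul_exp {f : Circle → ℂ} (hf : Continuous f) (z : Circle) :
    Continuous fun t : ℝ => f (z * Circle.exp t) := by fun_prop

lemma norm_mul_exp_sub (z : Circle) (t : ℝ) :
    ‖((z * Circle.exp t : Circle) : ℂ) - z‖ = ‖(Circle.exp t : ℂ) - 1‖ := by
  rw [Circle.coe_mul, ← mul_sub_one, norm_mul, Circle.norm_coe, one_mul]

lemma differentiableOn_cauchy {f : Circle → ℂ} (hf : Continuous f) :
    DifferentiableOn ℂ (fun z => ∫ t, f (Circle.exp t) * (z / ((Circle.exp t : ℂ) - z)) ∂arc)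
      (ball 0 1) := by
  intro z₀ hz₀
  rw [mem_ball_zero_iff] at hz₀
  obtain ⟨B, hB, hB'⟩ := exists_bound_of_continuous hf
  -- Half the distance from `z₀` to the circle: every `z` in the ball of this radius keeps distance
  -- at least `r` from the circle, which bounds the derivative of the kernel.
  set r := (1 - ‖z₀‖) / 2 with hr
  have hr0 : 0 < r := by rw [hr]; linarith
  have hball : ∀ z ∈ ball z₀ r, ‖z‖ ≤ 1 - r := fun z hz => by
    have h1 : ‖z - z₀‖ < r := by simpa [dist_eq_norm] using hz
    have h2 := norm_sub_norm_le z z₀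
    linarith
  have hcont : ∀ z : ℂ, ‖z‖ < 1 →
      Continuous fun t : ℝ => f (Circle.exp t) * (z / ((Circle.exp t : ℂ) - z)) := fun z hz => by
    refine Continuous.mul (by fun_prop) (Continuous.div (by fun_prop) (by fun_prop)
      fun t => ofReal_sub_ne_zero hz)
  refine (hasDerivAt_integral_of_dominated_loc_of_deriv_le (μ := arc) (bound := fun _ => B / r ^ 2)
    (F := fun z t => f (Circle.exp t) * (z / ((Circle.exp t : ℂ) - z)))
    (F' := fun z t => f (Circle.exp t) * ((Circle.exp t : ℂ) / ((Circle.exp t : ℂ) - z) ^ 2))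
    (ball_mem_nhds z₀ hr0) ?_ ?_ ?_ ?_ ?_ ?_).2.differentiableAt.differentiableWithinAt
  · filter_upwards [isOpen_ball.mem_nhds (mem_ball_zero_iff.2 hz₀)] with z hz
    exact (hcont z (mem_ball_zero_iff.1 hz)).aestronglyMeasurable
  · exact integrable_arc_of_continuous (hcont z₀ hz₀)
  · refine Continuous.aestronglyMeasurable ?_
    refine Continuous.mul (by fun_prop) (Continuous.div (by fun_prop) (by fun_prop)
      fun t => pow_ne_zero _ (ofReal_sub_ne_zero hz₀))
  · refine Eventually.of_forall fun t z hz => ?_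
    have h1 : r ≤ ‖(Circle.exp t : ℂ) - z‖ := by
      have h2 := norm_sub_norm_le (Circle.exp t : ℂ) z
      rw [Circle.norm_coe] at h2
      linarith [hball z hz]
    rw [norm_mul, norm_div, norm_pow, Circle.norm_coe, div_eq_mul_one_div B]
    refine mul_le_mul (hB' _) ?_ (by positivity) hB
    gcongr
  · exact integrable_const _
  · refine Eventually.of_forall fun t z hz => ?_
    have hz1 : ‖z‖ < 1 := by linarith [hball z hz]
    have h2 := ofReal_sub_ne_zero (t := t) hz1
    have h3 := ((hasDerivAt_id z).div ((hasDerivAt_id z).const_sub (Circle.exp t : ℂ))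
      h2).const_mul (f (Circle.exp t))
    refine h3.congr_deriv ?_
    simp only [id]
    ring

/-- The analytic extension of `projPlus f` to the disc. -/
def extPlus (f : Circle → ℂ) (z : ℂ) : ℂ :=
  ∫ t, (f (Circle.exp (arg z) * Circle.exp t) - f (Circle.exp (arg z))) *
    ((‖z‖ : ℂ) / ((Circle.exp t : ℂ) - (‖z‖ : ℂ))) ∂arc

/-- Inside the disc the subtracted constant contributes nothing by `integral_poisson_zero`, and a
rotation by `arg z` gives the Cauchy integral. The Cauchy form shows analyticity; the polar form
with the subtraction remains meaningful on the circle. -/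
lemma extPlus_eq_cauchy {f : Circle → ℂ} (hf : Continuous f) {z : ℂ} (hz : ‖z‖ < 1) :
    extPlus f z = ∫ t, f (Circle.exp t) * (z / ((Circle.exp t : ℂ) - z)) ∂arc := by
  have h1 := integral_arc_mul_left (fun w : Circle => f w * (z / ((w : ℂ) - z)))
    (Circle.exp (arg z))
  have hr : ‖((‖z‖ : ℝ) : ℂ)‖ < 1 := by simpa using hz
  have hc : Continuous fun t : ℝ => (‖z‖ : ℂ) / ((Circle.exp t : ℂ) - (‖z‖ : ℂ)) :=
    Continuous.div (by fun_prop) (by fun_prop) fun t => ofReal_sub_ne_zero hr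
  rw [← h1, extPlus]
  simp only [sub_mul]
  rw [integral_sub, integral_const_mul, integral_poisson_zero (norm_nonneg z) hz, mul_zero,
    sub_zero]
  · congr 1
    ext t
    congr 1
    have h2 := ofReal_sub_ne_zero (t := t) hr
    have h3 := Circle.coe_ne_zero (Circle.exp (arg z))
    rw [Circle.coe_mul]
    have h4 : (Circle.exp (arg z) : ℂ) * Circle.exp t - z
        = Circle.exp (arg z) * ((Circle.exp t : ℂ) - ‖z‖) := by
      rw [mul_sub, mul_comm _ (‖z‖ : ℂ), norm_mul_exp_arg]
    rw [h4, div_eq_div_iff h2 (mul_ne_zero h3 h2)]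
    linear_combination ((Circle.exp t : ℂ) - ‖z‖) * norm_mul_exp_arg z
  · exact integrable_arc_of_continuous ((continuous_mul_exp hf _).mul hc)
  · exact integrable_arc_of_continuous (continuous_const.mul hc)

/-- Since `1 - r ≤ |τ - r|`, the triangle inequality gives `|τ - 1| ≤ 2 |τ - r|`. The majorant
therefore does not depend on `r`, as dominated convergence up to the circle requires. -/
lemma norm_extPlus_integrand_le {f : Circle → ℂ} {C l : ℝ}
    (h : ∀ a b : Circle, ‖f a - f b‖ ≤ C * ‖(a : ℂ) - b‖ ^ l) (w : Circle) {r : ℝ} (hr : 0 ≤ r)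
    (hr1 : r ≤ 1) {t : ℝ} (ht : (Circle.exp t : ℂ) - 1 ≠ 0) :
    ‖(f (w * Circle.exp t) - f w) * ((r : ℂ) / ((Circle.exp t : ℂ) - r))‖ ≤
      2 * C * ‖(Circle.exp t : ℂ) - 1‖ ^ (l - 1) := by
  have h0 : 0 < ‖(Circle.exp t : ℂ) - 1‖ := norm_pos_iff.2 ht
  have h1 := h (w * Circle.exp t) w
  rw [norm_mul_exp_sub] at h1
  have h2 : ‖(Circle.exp t : ℂ) - 1‖ / 2 ≤ ‖(Circle.exp t : ℂ) - r‖ := by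
    have h3 := norm_sub_le ((Circle.exp t : ℂ) - r) ((1 : ℂ) - r)
    have h4 := norm_sub_norm_le (Circle.exp t : ℂ) r
    have h5 : ‖(1 : ℂ) - r‖ = 1 - r := by
      rw [← ofReal_one, ← ofReal_sub, Complex.norm_real, Real.norm_of_nonneg (by linarith)]
    rw [Circle.norm_coe, Complex.norm_real, Real.norm_of_nonneg hr] at h4
    rw [h5, show (Circle.exp t : ℂ) - r - (1 - r) = Circle.exp t - 1 by ring] at h3
    linarith
  rw [norm_mul, norm_div, Complex.norm_real, Real.norm_of_nonneg hr]
  have h6 : r / ‖(Circle.exp t : ℂ) - r‖ ≤ 1 / (‖(Circle.exp t : ℂ) - 1‖ / 2) := by gcongr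
  calc _ ≤ C * ‖(Circle.exp t : ℂ) - 1‖ ^ l * (1 / (‖(Circle.exp t : ℂ) - 1‖ / 2)) :=
        mul_le_mul h1 h6 (by positivity) ((norm_nonneg _).trans h1)
    _ = _ := by rw [Real.rpow_sub_one h0.ne']; field_simp

lemma extPlus_coe (f : Circle → ℂ) (w : Circle) : extPlus f w = projPlus f w := by
  simp only [extPlus, projPlus, Circle.norm_coe, Circle.exp_arg, ofReal_one, mul_one_div]

lemma diffContOnCl_extPlus {f : Circle → ℂ} (hf : IsHol f) :
    DiffContOnCl ℂ (extPlus f) (ball 0 1) := by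
  have hd : DifferentiableOn ℂ (extPlus f) (ball 0 1) :=
    (differentiableOn_cauchy hf.continuous).congr fun z hz =>
      extPlus_eq_cauchy hf.continuous (mem_ball_zero_iff.1 hz)
  refine ⟨hd, ?_⟩
  rw [closure_ball _ one_ne_zero]
  intro z₀ hz₀
  rw [mem_closedBall_zero_iff] at hz₀
  rcases lt_or_eq_of_le hz₀ with hlt | heq
  · exact (hd.differentiableAt (isOpen_ball.mem_nhds (mem_ball_zero_iff.2 hlt))).continuousAt
      |>.continuousWithinAt
  have hc := hf.continuous
  obtain ⟨C, l, hC, hl, hl1, h⟩ := hf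
  have hz0 : z₀ ≠ 0 := by rw [← norm_pos_iff, heq]; exact one_pos
  refine tendsto_integral_filter_of_dominated_convergence
    (fun t => 2 * C * ‖(Circle.exp t : ℂ) - 1‖ ^ (l - 1)) ?_ ?_
    -- At a boundary point continuity is dominated convergence along the closed disc.
    ((integrable_kernel hl hl1).const_mul _) ?_
  · refine Eventually.of_forall fun z => Measurable.aestronglyMeasurable ?_
    have h1 := ((continuous_mul_exp hc (Circle.exp (arg z))).sub
      (continuous_const (y := f (Circle.exp (arg z))))).measurable
    have h2 : Measurable fun t : ℝ => (Circle.exp t : ℂ) - ‖z‖ :=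
      (by fun_prop : Continuous fun t : ℝ => (Circle.exp t : ℂ) - ‖z‖).measurable
    exact h1.mul (measurable_const.div h2)
  · filter_upwards [self_mem_nhdsWithin] with z hz
    filter_upwards [ae_arc_ne_one] with t ht
    exact norm_extPlus_integrand_le h _ (norm_nonneg z) (mem_closedBall_zero_iff.1 hz) ht
  · filter_upwards [ae_arc_ne_one] with t ht
    refine ContinuousAt.continuousWithinAt ?_
    have h1 := continuousAt_exp_arg hz0
    refine ContinuousAt.mul (ContinuousAt.sub ?_ ?_) (ContinuousAt.div (by fun_prop) (by fun_prop) ?_)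
    · exact hc.continuousAt.comp (h1.mul continuousAt_const)
    · exact hc.continuousAt.comp h1
    · rw [heq, ofReal_one]; exact ht

theorem isPlusZero_projPlus {f : Circle → ℂ} (hf : IsHol f) : IsPlusZero (projPlus f) :=
  ⟨extPlus f, diffContOnCl_extPlus hf, by simp [extPlus], extPlus_coe f⟩

lemma integrable_projPlus {f : Circle → ℂ} (hf : IsHol f) (w : Circle) :
    Integrable (fun t => (f (w * Circle.exp t) - f w) / ((Circle.exp t : ℂ) - 1)) arc := by
  have hc := hf.continuous
  obtain ⟨C, l, hC, hl, hl1, h⟩ := hf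
  refine ((integrable_kernel hl hl1).const_mul (2 * C)).mono' ?_ ?_
  · have h1 := ((continuous_mul_exp hc w).sub (continuous_const (y := f w))).measurable
    have h2 : Measurable fun t : ℝ => (Circle.exp t : ℂ) - 1 :=
      (by fun_prop : Continuous fun t : ℝ => (Circle.exp t : ℂ) - 1).measurable
    exact (h1.div h2).aestronglyMeasurable
  · filter_upwards [ae_arc_ne_one] with t ht
    have h1 := norm_extPlus_integrand_le h w zero_le_one le_rfl ht
    rwa [ofReal_one, mul_one_div] at h1

/-- The difference of the two numerators is bounded both by `2 C |τ - 1| ^ l` and by `2 C |a - b| ^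
l`. Their geometric mean leaves an integrable singularity and a factor `|a - b| ^ (l / 2)`; losing
half the exponent is harmless, as only some positive exponent is claimed. -/
theorem isHol_projPlus {f : Circle → ℂ} (hf : IsHol f) : IsHol (projPlus f) := by
  have hi := integrable_projPlus hf
  obtain ⟨C, l, hC, hl, hl1, h⟩ := hf
  have hl2 : 0 < l / 2 := by positivity
  refine isHol_of_bound (C := ∫ t, 2 * C * ‖(Circle.exp t : ℂ) - 1‖ ^ (l / 2 - 1) ∂arc) hl2
    fun a b => ?_
  rw [projPlus, projPlus, ← integral_sub (hi a) (hi b), ← integral_mul_const]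
  refine norm_integral_le_of_norm_le
    (((integrable_kernel hl2 (by linarith)).const_mul _).mul_const _) ?_
  filter_upwards [ae_arc_ne_one] with t ht
  have h0 : 0 < ‖(Circle.exp t : ℂ) - 1‖ := norm_pos_iff.2 ht
  set x := ‖(Circle.exp t : ℂ) - 1‖ with hx
  set y := ‖(a : ℂ) - b‖ with hy
  have hy0 : 0 ≤ y := norm_nonneg _
  have h1 := h (a * Circle.exp t) a
  have h2 := h (b * Circle.exp t) b
  have h3 := h (a * Circle.exp t) (b * Circle.exp t)
  have h4 := h a b
  rw [norm_mul_exp_sub] at h1 h2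
  rw [Circle.coe_mul, Circle.coe_mul, ← sub_mul, norm_mul, Circle.norm_coe, mul_one] at h3
  rw [← hx] at h1 h2
  rw [← hy] at h3 h4
  set p := f (a * Circle.exp t) - f a - (f (b * Circle.exp t) - f b) with hp
  have h5 : ‖p‖ ≤ 2 * C * x ^ l := by
    refine (norm_sub_le _ _).trans ?_
    linarith
  have h6 : ‖p‖ ≤ 2 * C * y ^ l := by
    rw [hp, show f (a * Circle.exp t) - f a - (f (b * Circle.exp t) - f b)
      = f (a * Circle.exp t) - f (b * Circle.exp t) - (f a - f b) by ring]
    refine (norm_sub_le _ _).trans ?_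
    linarith
  have h7 : ‖p‖ ≤ 2 * C * x ^ (l / 2) * y ^ (l / 2) := by
    refine abs_le_of_sq_le_sq' ?_ (by positivity) |>.2
    have h8 : (x ^ (l / 2)) ^ 2 = x ^ l := by
      rw [← Real.rpow_natCast, ← Real.rpow_mul h0.le]; norm_num
    have h9 : (y ^ (l / 2)) ^ 2 = y ^ l := by
      rw [← Real.rpow_natCast, ← Real.rpow_mul hy0]; norm_num
    rw [mul_pow, mul_pow, h8, h9, sq]
    calc ‖p‖ * ‖p‖ ≤ (2 * C * x ^ l) * (2 * C * y ^ l) :=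
          mul_le_mul h5 h6 (norm_nonneg _) (by positivity)
      _ = _ := by ring
  rw [← sub_div, norm_div, ← hp, ← hx, Real.rpow_sub_one h0.ne', div_le_iff₀ h0]
  calc _ ≤ _ := h7
    _ = _ := by field_simp

/-! ### The algebra of boundary values -/

lemma IsPlusZero.isPlus {f : Circle → ℂ} (hf : IsPlusZero f) : IsPlus f := by
  obtain ⟨u, hu, -, h⟩ := hf
  exact ⟨u, hu, h⟩

lemma isPlus_const (c : ℂ) : IsPlus fun _ => c := ⟨fun _ => c, diffContOnCl_const, fun _ => rfl⟩

lemma isPlus_coe : IsPlus fun w => (w : ℂ) :=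
  ⟨id, differentiable_id.diffContOnCl, fun _ => rfl⟩

lemma DiffContOnCl.mul_ball {u v : ℂ → ℂ} (hu : DiffContOnCl ℂ u (ball 0 1))
    (hv : DiffContOnCl ℂ v (ball 0 1)) : DiffContOnCl ℂ (fun z => u z * v z) (ball 0 1) :=
  ⟨hu.1.mul hv.1, hu.2.mul hv.2⟩

lemma IsPlus.add {f g : Circle → ℂ} (hf : IsPlus f) (hg : IsPlus g) :
    IsPlus fun w => f w + g w := by
  obtain ⟨u, hu, hu'⟩ := hf
  obtain ⟨v, hv, hv'⟩ := hg
  exact ⟨fun z => u z + v z, hu.add hv, fun w => by simp only [hu', hv']⟩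

lemma IsPlus.mul {f g : Circle → ℂ} (hf : IsPlus f) (hg : IsPlus g) :
    IsPlus fun w => f w * g w := by
  obtain ⟨u, hu, hu'⟩ := hf
  obtain ⟨v, hv, hv'⟩ := hg
  exact ⟨fun z => u z * v z, DiffContOnCl.mul_ball hu hv, fun w => by simp only [hu', hv']⟩

lemma IsPlusZero.add {f g : Circle → ℂ} (hf : IsPlusZero f) (hg : IsPlusZero g) :
    IsPlusZero fun w => f w + g w := by
  obtain ⟨u, hu, h0, hu'⟩ := hf
  obtain ⟨v, hv, h0', hv'⟩ := hg
  exact ⟨fun z => u z + v z, hu.add hv, by simp [h0, h0'], fun w => by simp only [hu', hv']⟩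

lemma IsPlusZero.mul {f g : Circle → ℂ} (hf : IsPlusZero f) (hg : IsPlus g) :
    IsPlusZero fun w => f w * g w := by
  obtain ⟨u, hu, h0, hu'⟩ := hf
  obtain ⟨v, hv, hv'⟩ := hg
  exact ⟨fun z => u z * v z, DiffContOnCl.mul_ball hu hv, by simp [h0], fun w => by simp only [hu', hv']⟩

lemma isPlusZero_zero : IsPlusZero fun _ => 0 := ⟨0, diffContOnCl_const, rfl, fun _ => rfl⟩

lemma IsPlusZero.neg {f : Circle → ℂ} (hf : IsPlusZero f) : IsPlusZero fun w => -f w := by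
  simpa using hf.mul (isPlus_const (-1))

lemma IsMinus.add {f g : Circle → ℂ} (hf : IsMinus f) (hg : IsMinus g) :
    IsMinus fun w => f w + g w := IsPlus.add hf hg

lemma IsMinus.mul {f g : Circle → ℂ} (hf : IsMinus f) (hg : IsMinus g) :
    IsMinus fun w => f w * g w := IsPlus.mul hf hg

lemma isMinus_const (c : ℂ) : IsMinus fun _ => c := isPlus_const c

lemma isMinus_inv : IsMinus fun w => (w : ℂ)⁻¹ := by
  simpa [IsMinus] using isPlus_coe

lemma IsMinus.neg {f : Circle → ℂ} (hf : IsMinus f) : IsMinus fun w => -f w := by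
  simpa using hf.mul (isMinus_const (-1))

lemma isPlusZero_sum {ι : Type*} (s : Finset ι) {f : ι → Circle → ℂ}
    (h : ∀ i ∈ s, IsPlusZero (f i)) : IsPlusZero fun w => ∑ i ∈ s, f i w := by
  classical
  induction s using Finset.induction_on with
  | empty => simpa using isPlusZero_zero
  | insert a s ha ih =>
    simp only [Finset.sum_insert ha]
    exact (h a (Finset.mem_insert_self _ _)).add
      (ih fun i hi => h i (Finset.mem_insert_of_mem hi))

lemma isPlus_sum {ι : Type*} (s : Finset ι) {f : ι → Circle → ℂ}
    (h : ∀ i ∈ s, IsPlus (f i)) : IsPlus fun w => ∑ i ∈ s, f i w := by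
  classical
  induction s using Finset.induction_on with
  | empty => simpa using isPlus_const 0
  | insert a s ha ih =>
    simp only [Finset.sum_insert ha]
    exact (h a (Finset.mem_insert_self _ _)).add
      (ih fun i hi => h i (Finset.mem_insert_of_mem hi))

lemma isMinus_sum {ι : Type*} (s : Finset ι) {f : ι → Circle → ℂ}
    (h : ∀ i ∈ s, IsMinus (f i)) : IsMinus fun w => ∑ i ∈ s, f i w := isPlus_sum s h

lemma IsPlus.continuous {f : Circle → ℂ} (hf : IsPlus f) : Continuous f := by
  obtain ⟨u, hu, h⟩ := hf
  have h1 : Continuous fun w : Circle => u w := by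
    have h2 := hu.2
    rw [closure_ball _ one_ne_zero] at h2
    exact h2.comp_continuous (by fun_prop : Continuous fun w : Circle => (w : ℂ))
      fun w => by rw [mem_closedBall_zero_iff, Circle.norm_coe]
  exact h1.congr h

lemma IsMinus.continuous {f : Circle → ℂ} (hf : IsMinus f) : Continuous f := by
  have := (IsPlus.continuous hf).comp continuous_inv
  simpa [Function.comp_def] using this

/-- Dividing by the coordinate. -/
lemma IsPlusZero.inv_mul {f : Circle → ℂ} (hf : IsPlusZero f) :
    IsPlus fun w => (w : ℂ)⁻¹ * f w := by
  obtain ⟨u, hu, h0, h⟩ := hf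
  refine ⟨dslope u 0, ⟨?_, ?_⟩, fun w => ?_⟩
  · exact (differentiableOn_dslope (ball_mem_nhds 0 one_pos)).2 hu.1
  · rw [continuousOn_dslope]
    · exact ⟨hu.2, hu.1.differentiableAt (ball_mem_nhds 0 one_pos)⟩
    · exact mem_of_superset (ball_mem_nhds 0 one_pos) subset_closure
  · rw [dslope_of_ne _ (Circle.coe_ne_zero w), slope_def_field, h0, sub_zero, sub_zero, h,
      div_eq_inv_mul]

/-! ### Orthogonality of plus and minus functions in mean square -/

lemma differentiableOn_conj_conj {u : ℂ → ℂ} (hu : DiffContOnCl ℂ u (ball 0 1)) :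
    DiffContOnCl ℂ (fun z => (starRingEnd ℂ) (u ((starRingEnd ℂ) z))) (ball 0 1) := by
  refine ⟨fun z hz => ?_, ?_⟩
  · have hz' : (starRingEnd ℂ) z ∈ ball (0 : ℂ) 1 := by simpa using hz
    have h1 := hu.1.differentiableAt (isOpen_ball.mem_nhds hz')
    exact (differentiableAt_conj_conj_iff.2 h1).differentiableWithinAt
  · rw [closure_ball _ one_ne_zero]
    have h2 := hu.2
    rw [closure_ball _ one_ne_zero] at h2
    exact continuous_conj.comp_continuousOn (h2.comp continuous_conj.continuousOn
      fun z hz => by simpa using hz)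

lemma IsMinus.conj {f : Circle → ℂ} (hf : IsMinus f) : IsPlus fun w => (starRingEnd ℂ) (f w) := by
  obtain ⟨u, hu, h⟩ := hf
  refine ⟨_, differentiableOn_conj_conj hu, fun w => ?_⟩
  have h1 := h w⁻¹
  simp only [inv_inv, Circle.coe_inv_eq_conj] at h1
  simp only [h1]

/-- On the circle the conjugate of a minus function is a plus function, so the product is analytic
in the disc and vanishes at the centre, where its mean is read off. -/
lemma integral_mul_conj_eq_zero {f g : Circle → ℂ} (hf : IsPlusZero f) (hg : IsMinus g) :
    ∫ t, f (Circle.exp t) * (starRingEnd ℂ) (g (Circle.exp t)) ∂arc = 0 := by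
  obtain ⟨u, hu, h0, h⟩ := hf.mul hg.conj
  have := integral_arc_eq_center hu
  rw [h0] at this
  simpa only [h] using this

lemma integral_normSq_add {f g : Circle → ℂ} (hf : IsPlusZero f) (hg : IsMinus g) :
    ∫ t, ‖f (Circle.exp t) + g (Circle.exp t)‖ ^ 2 ∂arc =
      ∫ t, ‖f (Circle.exp t)‖ ^ 2 ∂arc + ∫ t, ‖g (Circle.exp t)‖ ^ 2 ∂arc := by
  have hfc := hf.isPlus.continuous
  have hgc := hg.continuous
  have h0 := congrArg Complex.re (integral_mul_conj_eq_zero hf hg)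
  have hi : Integrable (fun t => f (Circle.exp t) * (starRingEnd ℂ) (g (Circle.exp t))) arc :=
    integrable_arc_of_continuous (by
      have := continuous_conj.comp (hgc.comp Circle.exp.continuous)
      exact (by fun_prop : Continuous fun t : ℝ => f (Circle.exp t)).mul this)
  have h1 : ∫ t, (f (Circle.exp t) * (starRingEnd ℂ) (g (Circle.exp t))).re ∂arc = 0 := by
    have := integral_re hi
    simp only [RCLike.re_to_complex] at this
    rw [this, h0, zero_re]
  have hc1 : Continuous fun t : ℝ => ‖f (Circle.exp t)‖ ^ 2 := by fun_prop
  have hc2 : Continuous fun t : ℝ => ‖g (Circle.exp t)‖ ^ 2 := by fun_prop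
  have h2 : ∀ t : ℝ, ‖f (Circle.exp t) + g (Circle.exp t)‖ ^ 2 = ‖f (Circle.exp t)‖ ^ 2 +
      ‖g (Circle.exp t)‖ ^ 2 + 2 * (f (Circle.exp t) * (starRingEnd ℂ) (g (Circle.exp t))).re :=
    fun t => by rw [← normSq_eq_norm_sq, normSq_add, normSq_eq_norm_sq, normSq_eq_norm_sq]
  simp only [h2]
  have hi' : Integrable (fun t =>
      2 * (f (Circle.exp t) * (starRingEnd ℂ) (g (Circle.exp t))).re) arc := hi.re.const_mul 2
  have hi12 : Integrable (fun t : ℝ => ‖f (Circle.exp t)‖ ^ 2 + ‖g (Circle.exp t)‖ ^ 2) arc :=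
    integrable_arc_of_continuous (hc1.add hc2)
  rw [integral_add hi12 hi', integral_add (integrable_arc_of_continuous hc1) (integrable_arc_of_continuous hc2),
    integral_const_mul, h1, mul_zero, add_zero]

/-- Liouville's theorem by orthogonality: Pythagoras for `f + (-f) = 0` gives `2 ‖f‖² = 0`. All
uniqueness statements below rest on this. -/
theorem eq_zero_of_isPlusZero_of_isMinus {f : Circle → ℂ} (hf : IsPlusZero f) (hg : IsMinus f)
    (w : Circle) : f w = 0 := by
  refine eq_zero_of_integral_arc_normSq hg.continuous ?_ w
  have h1 := integral_normSq_add hf hg.neg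
  simp only [add_neg_cancel, norm_zero, norm_neg] at h1
  norm_num at h1
  have h2 : 0 ≤ ∫ t, ‖f (Circle.exp t)‖ ^ 2 ∂arc := integral_nonneg fun t => by positivity
  linarith

/-! ### Properties of the projections -/

/-- Reflection `w ↦ w⁻¹` exchanges positive and negative frequencies: the reflected `projMinus f` is
the plus projection of the reflected `f`, plus the mean of `f`. The computation is `1/(τ⁻¹ - 1) =
-(1 + 1/(τ - 1))`, and the extra `1` produces the mean. -/
theorem isMinus_projMinus {f : Circle → ℂ} (hf : IsHol f) : IsMinus (projMinus f) := by
  have h1 := (isPlusZero_projPlus hf.comp_inv).isPlus.add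
    (isPlus_const (∫ t, f (Circle.exp t) ∂arc))
  unfold IsMinus
  convert h1 using 2 with w
  have hi := integrable_projPlus hf.comp_inv w
  have h2 := integral_arc_inv (fun s : Circle => (f (w⁻¹ * s) - f w⁻¹) / ((s : ℂ) - 1))
  have h3 := integral_arc_mul_left (fun s : Circle => f s⁻¹) w
  have h4 := integral_arc_inv (fun s : Circle => f s)
  have hc : Continuous fun t : ℝ => f (w * Circle.exp t)⁻¹ := by
    have := hf.continuous; fun_prop
  have hi2 := integrable_arc_of_continuous hc
  have h5 : ∫ t, (f (w⁻¹ * (Circle.exp t)⁻¹) - f w⁻¹) /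
      (((Circle.exp t)⁻¹ : Circle) - 1 : ℂ) ∂arc = ∫ t, -((f (w * Circle.exp t)⁻¹ - f w⁻¹) /
        ((Circle.exp t : ℂ) - 1) + (f (w * Circle.exp t)⁻¹ - f w⁻¹)) ∂arc := by
    refine integral_congr_ae ?_
    filter_upwards [ae_arc_ne_one] with t ht
    have h6 := Circle.coe_ne_zero (Circle.exp t)
    have h7 : ((Circle.exp t : ℂ))⁻¹ - 1 = -(Circle.exp t - 1) / Circle.exp t := by
      field_simp
      ring
    rw [mul_inv, Circle.coe_inv, h7]
    generalize f (w⁻¹ * (Circle.exp t)⁻¹) = a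
    generalize f w⁻¹ = b
    generalize (Circle.exp t : ℂ) = e at *
    field_simp
    ring
  have hi3 : Integrable (fun t : ℝ => f (w * Circle.exp t)⁻¹ - f w⁻¹) arc :=
    hi2.sub (integrable_const _)
  rw [projMinus, projPlus, projPlus, ← h2, h5, integral_neg, integral_add hi hi3, integral_sub hi2 (integrable_const _), h3, h4, integral_const,
    probReal_univ, one_smul]
  ring

/-- The difference of the two plus parts equals minus the difference of the minus parts, so it is of
both types and vanishes. -/
lemma projPlus_eq_of_decomposition {f g h : Circle → ℂ} (hf : IsHol f) (hg : IsPlusZero g)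
    (hh : IsMinus h) (hfgh : ∀ w, g w + h w = f w) (w : Circle) :
    projPlus f w = g w ∧ projMinus f w = h w := by
  have h1 := eq_zero_of_isPlusZero_of_isMinus (f := fun w => projPlus f w + -g w)
    ((isPlusZero_projPlus hf).add hg.neg) (by
      have := hh.add (isMinus_projMinus hf).neg
      convert this using 2 with w
      rw [projMinus, ← hfgh]
      ring) w
  have h2 : projPlus f w = g w := by linear_combination h1
  refine ⟨h2, ?_⟩
  rw [projMinus, h2, ← hfgh]
  ring

lemma projPlus_of_isPlusZero {f : Circle → ℂ} (hf : IsHol f) (h : IsPlusZero f) (w : Circle) :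
    projPlus f w = f w :=
  (projPlus_eq_of_decomposition hf h (isMinus_const 0) (fun _ => add_zero _) w).1

lemma projPlus_of_isMinus {f : Circle → ℂ} (hf : IsHol f) (h : IsMinus f) (w : Circle) :
    projPlus f w = 0 :=
  (projPlus_eq_of_decomposition hf isPlusZero_zero h (fun _ => zero_add _) w).1

lemma isHol_projMinus {f : Circle → ℂ} (hf : IsHol f) : IsHol (projMinus f) :=
  hf.sub (isHol_projPlus hf)

/-! ### Mean square norms -/

/-- The mean square norm on the circle. -/
def meanSq (f : Circle → ℂ) : ℝ := (eLpNorm (fun t => f (Circle.exp t)) 2 arc).toReal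

lemma meanSq_nonneg (f : Circle → ℂ) : 0 ≤ meanSq f := ENNReal.toReal_nonneg

lemma memLp_arc {f : Circle → ℂ} (hf : Continuous f) (p : ℝ≥0∞) :
    MemLp (fun t => f (Circle.exp t)) p arc := by
  obtain ⟨B, -, hB⟩ := exists_bound_of_continuous hf
  exact MemLp.of_bound (hf.comp Circle.exp.continuous).aestronglyMeasurable B
    (Eventually.of_forall fun t => hB _)

lemma meanSq_sq {f : Circle → ℂ} (hf : Continuous f) :
    meanSq f ^ 2 = ∫ t, ‖f (Circle.exp t)‖ ^ 2 ∂arc := by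
  have h0 : 0 ≤ ∫ t, ‖f (Circle.exp t)‖ ^ 2 ∂arc := integral_nonneg fun t => by positivity
  have h1 := (memLp_arc hf 2).eLpNorm_eq_integral_rpow_norm two_ne_zero ENNReal.ofNat_ne_top
  rw [meanSq, h1, ENNReal.toReal_ofReal (by positivity)]
  simp only [ENNReal.toReal_ofNat, Real.rpow_ofNat]
  rw [← Real.rpow_natCast, ← Real.rpow_mul h0]
  norm_num

lemma meanSq_add_sq {f g : Circle → ℂ} (hf : IsPlusZero f) (hg : IsMinus g) :
    meanSq (fun w => f w + g w) ^ 2 = meanSq f ^ 2 + meanSq g ^ 2 := by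
  have hc : Continuous fun w => f w + g w := hf.isPlus.continuous.add hg.continuous
  rw [meanSq_sq hc, meanSq_sq hf.isPlus.continuous,
    meanSq_sq hg.continuous, integral_normSq_add hf hg]

/-- Pythagoras makes both projections contractions in mean square, with constant exactly `1`; this
constant fixes the rate of growth of the iterates. -/
lemma meanSq_proj_sq {f : Circle → ℂ} (hf : IsHol f) :
    meanSq f ^ 2 = meanSq (projPlus f) ^ 2 + meanSq (projMinus f) ^ 2 := by
  rw [← meanSq_add_sq (isPlusZero_projPlus hf) (isMinus_projMinus hf)]
  simp only [projMinus, add_sub_cancel]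

lemma meanSq_projPlus_le {f : Circle → ℂ} (hf : IsHol f) : meanSq (projPlus f) ≤ meanSq f := by
  refine abs_le_of_sq_le_sq' ?_ (meanSq_nonneg _) |>.2
  nlinarith [meanSq_proj_sq hf]

lemma meanSq_projMinus_le {f : Circle → ℂ} (hf : IsHol f) : meanSq (projMinus f) ≤ meanSq f := by
  refine abs_le_of_sq_le_sq' ?_ (meanSq_nonneg _) |>.2
  nlinarith [meanSq_proj_sq hf]

lemma meanSq_neg (f : Circle → ℂ) : meanSq (fun w => -f w) = meanSq f := by
  rw [meanSq, meanSq]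
  congr 1
  exact eLpNorm_neg (f := fun t => f (Circle.exp t)) (p := 2) (μ := arc)

lemma meanSq_sum_mul_le {ι : Type*} (s : Finset ι) {m f : ι → Circle → ℂ} {B : ι → ℝ}
    (hm : ∀ i, Continuous (m i)) (hf : ∀ i, Continuous (f i)) (hB : ∀ i w, ‖m i w‖ ≤ B i) :
    meanSq (fun w => ∑ i ∈ s, m i w * f i w) ≤ ∑ i ∈ s, B i * meanSq (f i) := by
  have h1 : ∀ i, eLpNorm (fun t => m i (Circle.exp t) * f i (Circle.exp t)) 2 arc ≤
      ENNReal.ofReal (B i) * eLpNorm (fun t => f i (Circle.exp t)) 2 arc := fun i =>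
    eLpNorm_le_mul_eLpNorm_of_ae_le_mul (Eventually.of_forall fun t => by
      rw [norm_mul]; exact mul_le_mul_of_nonneg_right (hB i _) (norm_nonneg _)) 2
  have h2 := eLpNorm_sum_le (μ := arc) (p := 2) (s := s)
    (f := fun i t => m i (Circle.exp t) * f i (Circle.exp t))
    (fun i _ => (((hm i).mul (hf i)).comp Circle.exp.continuous).aestronglyMeasurable) (by norm_num)
  have h3 : (∑ i ∈ s, fun t => m i (Circle.exp t) * f i (Circle.exp t)) =
      fun t => ∑ i ∈ s, m i (Circle.exp t) * f i (Circle.exp t) := by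
    ext t; simp
  rw [h3] at h2
  have h4 : ∀ i, ENNReal.ofReal (B i) * eLpNorm (fun t => f i (Circle.exp t)) 2 arc ≠ ⊤ :=
    fun i => ENNReal.mul_ne_top ENNReal.ofReal_ne_top (memLp_arc (hf i) 2).eLpNorm_ne_top
  have h5 := ENNReal.toReal_mono (ENNReal.sum_ne_top.2 fun i _ => h4 i)
    (h2.trans (Finset.sum_le_sum fun i _ => h1 i))
  rw [ENNReal.toReal_sum fun i _ => h4 i] at h5
  refine h5.trans_eq (Finset.sum_congr rfl fun i _ => ?_)
  rw [ENNReal.toReal_mul, ENNReal.toReal_ofReal ((norm_nonneg _).trans (hB i 1)), meanSq]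

lemma integral_norm_le_meanSq {f : Circle → ℂ} (hf : Continuous f) (w : Circle) :
    ∫ t, ‖f (w * Circle.exp t)‖ ∂arc ≤ meanSq f := by
  rw [integral_arc_mul_left (fun s => ‖f s‖) w]
  set c := ∫ t, ‖f (Circle.exp t)‖ ∂arc with hc
  refine abs_le_of_sq_le_sq' ?_ (meanSq_nonneg _) |>.2
  rw [meanSq_sq hf]
  have hc1 : Continuous fun t : ℝ => ‖f (Circle.exp t)‖ ^ 2 := by fun_prop
  have hc2 : Continuous fun t : ℝ => 2 * c * ‖f (Circle.exp t)‖ := by fun_prop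
  have hc12 : Integrable (fun t : ℝ => ‖f (Circle.exp t)‖ ^ 2 - 2 * c * ‖f (Circle.exp t)‖) arc :=
    integrable_arc_of_continuous (hc1.sub hc2)
  -- The variance of `‖f‖` is non-negative, and `c` is its mean because the measure has total mass
  -- `1`.
  have h1 : 0 ≤ ∫ t, (‖f (Circle.exp t)‖ ^ 2 - 2 * c * ‖f (Circle.exp t)‖ + c ^ 2) ∂arc :=
    integral_nonneg fun t => by
      have := sq_nonneg (‖f (Circle.exp t)‖ - c)
      simp only [Pi.zero_apply]
      nlinarith
  rw [integral_add hc12 (integrable_const _), integral_sub (integrable_arc_of_continuous hc1)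
    (integrable_arc_of_continuous hc2), integral_const_mul, ← hc] at h1
  simp at h1
  nlinarith

/-! ### The commutator of the projection and a multiplication operator -/

/-- An integrable kernel is a kernel bounded above plus one of small integral, by dominated
convergence as the level of truncation grows. -/
lemma exists_truncation {k : ℝ → ℝ} (hk : Integrable k arc) {d : ℝ} (hd : 0 < d) :
    ∃ K : ℝ, 0 ≤ K ∧ ∫ t, (k t - min (k t) K) ∂arc ≤ d := by
  have h1 : Tendsto (fun K : ℕ => ∫ t, (k t - min (k t) K) ∂arc) atTop (𝓝 (∫ _t, (0 : ℝ) ∂arc)) := by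
    refine tendsto_integral_of_dominated_convergence (fun t => |k t|) (fun K => ?_) hk.abs
      (fun K => Eventually.of_forall fun t => ?_) (Eventually.of_forall fun t => ?_)
    · exact hk.aestronglyMeasurable.sub (hk.aestronglyMeasurable.inf aestronglyMeasurable_const)
    · have hK : (0 : ℝ) ≤ K := Nat.cast_nonneg K
      rw [Real.norm_eq_abs, abs_of_nonneg (sub_nonneg.2 (min_le_left _ _))]
      rcases le_total (k t) K with h | h
      · rw [min_eq_left h, sub_self]; exact abs_nonneg _
      · rw [min_eq_right h]; linarith [le_abs_self (k t)]
    · refine tendsto_const_nhds.congr' ?_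
      obtain ⟨K₀, hK₀⟩ := exists_nat_ge (k t)
      filter_upwards [eventually_ge_atTop K₀] with K hK
      rw [min_eq_left (hK₀.trans (Nat.cast_le.2 hK)), sub_self]
  rw [integral_zero] at h1
  obtain ⟨K, hK⟩ := (h1.eventually (eventually_le_nhds hd)).exists
  exact ⟨K, Nat.cast_nonneg K, hK⟩

/-- The commutator has the kernel `(m (wτ) - m w)/(τ - 1)`, only weakly singular because `m` is
Hölder. Truncating its majorant, the part of small integral acts on the supremum of `f` with norm
`d`, and the bounded part acts on the mean of `‖f‖`, hence on its mean square norm. -/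
theorem exists_commutator_bound {m : Circle → ℂ} (hm : IsHol m) {d : ℝ} (hd : 0 < d) :
    ∃ C : ℝ, 0 ≤ C ∧ ∀ f : Circle → ℂ, IsHol f → ∀ S : ℝ, (∀ w, ‖f w‖ ≤ S) → ∀ w,
      ‖projPlus (fun w => m w * f w) w - m w * projPlus f w‖ ≤ d * S + C * meanSq f := by
  have hm' := hm
  obtain ⟨C, l, hC, hl, hl1, h⟩ := hm'
  have hk := (integrable_kernel hl hl1).const_mul C
  obtain ⟨K, hK, hK'⟩ := exists_truncation hk hd
  refine ⟨K, hK, fun f hf S hS w => ?_⟩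
  have hS0 : 0 ≤ S := (norm_nonneg _).trans (hS 1)
  set k : ℝ → ℝ := fun t => C * ‖(Circle.exp t : ℂ) - 1‖ ^ (l - 1) with hk_def
  have hfc := hf.continuous
  have hi1 : Integrable (fun t => (k t - min (k t) K) * S) arc :=
    (hk.sub (hk.inf (integrable_const K))).mul_const S
  have hi2 : Integrable (fun t => K * ‖f (w * Circle.exp t)‖) arc :=
    integrable_arc_of_continuous (by fun_prop)
  have h1 : projPlus (fun w => m w * f w) w - m w * projPlus f w =
      ∫ t, (m (w * Circle.exp t) - m w) / ((Circle.exp t : ℂ) - 1) * f (w * Circle.exp t) ∂arc := by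
    rw [projPlus, projPlus, ← integral_const_mul, ← integral_sub
      (integrable_projPlus (hm.mul hf) w) ((integrable_projPlus hf w).const_mul _)]
    congr 1
    ext t
    ring
  rw [h1]
  calc _ ≤ ∫ t, ((k t - min (k t) K) * S + K * ‖f (w * Circle.exp t)‖) ∂arc := by
        refine norm_integral_le_of_norm_le (hi1.add hi2) ?_
        filter_upwards [ae_arc_ne_one] with t ht
        have h0 : 0 < ‖(Circle.exp t : ℂ) - 1‖ := norm_pos_iff.2 ht
        have h2 := h (w * Circle.exp t) w
        rw [norm_mul_exp_sub] at h2
        have h3 : ‖(m (w * Circle.exp t) - m w) / ((Circle.exp t : ℂ) - 1)‖ ≤ k t := by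
          rw [norm_div, div_le_iff₀ h0, hk_def]
          simp only
          rw [Real.rpow_sub_one h0.ne', mul_assoc, div_mul_cancel₀ _ h0.ne']
          exact h2
        have h4 : min (k t) K ≤ K := min_le_right _ _
        have h5 : min (k t) K ≤ k t := min_le_left _ _
        have h6 := hS (w * Circle.exp t)
        rw [norm_mul]
        calc _ ≤ k t * ‖f (w * Circle.exp t)‖ := mul_le_mul_of_nonneg_right h3 (norm_nonneg _)
          _ = (k t - min (k t) K) * ‖f (w * Circle.exp t)‖
              + min (k t) K * ‖f (w * Circle.exp t)‖ := by ring
          _ ≤ _ := add_le_add (mul_le_mul_of_nonneg_left h6 (by linarith))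
              (mul_le_mul_of_nonneg_right h4 (norm_nonneg _))
    _ = (∫ t, (k t - min (k t) K) ∂arc) * S + K * ∫ t, ‖f (w * Circle.exp t)‖ ∂arc := by
        rw [integral_add hi1 hi2, integral_mul_const, integral_const_mul]
    _ ≤ _ := add_le_add (mul_le_mul_of_nonneg_right hK' hS0)
        (mul_le_mul_of_nonneg_left (integral_norm_le_meanSq hfc w) hK)

/-! ### Monotone matrix norms -/

variable {n : ℕ}

namespace IsMonotoneMatrixNorm

variable {ν : Matrix (Fin n) (Fin n) ℝ → ℝ}

lemma map_zero (hν : IsMonotoneMatrixNorm ν) : ν 0 = 0 := by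
  have := hν.smul 0 0
  simpa using this

lemma nonneg (hν : IsMonotoneMatrixNorm ν) (A : Matrix (Fin n) (Fin n) ℝ) : 0 ≤ ν A := by
  have h1 := hν.add_le A ((-1 : ℝ) • A)
  rw [hν.smul, neg_smul, one_smul, add_neg_cancel, hν.map_zero] at h1
  norm_num at h1
  linarith

/-- Transposition reverses products, but the two real norms commute. This serves the recursion in
which the fixed matrix multiplies from the right. -/
lemma transpose (hν : IsMonotoneMatrixNorm ν) : IsMonotoneMatrixNorm fun A => ν A.transpose where
  eq_zero A h := Matrix.transpose_eq_zero.1 (hν.eq_zero _ h)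
  smul c A := by rw [Matrix.transpose_smul, hν.smul]
  add_le A B := by rw [Matrix.transpose_add]; exact hν.add_le _ _
  mul_le A B := by
    rw [Matrix.transpose_mul, mul_comm]
    exact hν.mul_le _ _
  mono A B h h' := hν.mono _ _ (fun p q => h q p) fun p q => h' q p

/-- Entries of a non-negative matrix are bounded by its norm. -/
lemma exists_entry_le (hν : IsMonotoneMatrixNorm ν) :
    ∃ c : ℝ, 0 ≤ c ∧ ∀ A : Matrix (Fin n) (Fin n) ℝ, (∀ p q, 0 ≤ A p q) →
      ∀ p q, A p q ≤ c * ν A := by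
  have h0 : ∀ p q, 0 < ν (Matrix.single p q 1) := fun p q => by
    refine lt_of_le_of_ne (hν.nonneg _) fun h => ?_
    have h1 := congrFun (congrFun (hν.eq_zero _ h.symm) p) q
    simp at h1
  refine ⟨∑ p, ∑ q, (ν (Matrix.single p q 1))⁻¹, Finset.sum_nonneg fun p _ =>
    Finset.sum_nonneg fun q _ => (inv_pos.2 (h0 p q)).le, fun A hA p q => ?_⟩
  have h1 : A p q * ν (Matrix.single p q 1) ≤ ν A := by
    have h2 := hν.mono (A p q • Matrix.single p q 1) A (fun i j => ?_) fun i j => ?_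
    · rwa [hν.smul, abs_of_nonneg (hA p q)] at h2
    · by_cases h : p = i ∧ q = j
      · simp [h, hA]
      · simp [h]
    · by_cases h : p = i ∧ q = j
      · obtain ⟨rfl, rfl⟩ := h
        simp
      · simp [h, hA]
  have h2 : (ν (Matrix.single p q 1))⁻¹ ≤ ∑ p, ∑ q, (ν (Matrix.single p q 1))⁻¹ := by
    have h3 := Finset.single_le_sum (f := fun q => (ν (Matrix.single p q 1))⁻¹)
      (fun q _ => (inv_pos.2 (h0 p q)).le) (Finset.mem_univ q)
    have h4 := Finset.single_le_sum (f := fun p => ∑ q, (ν (Matrix.single p q 1))⁻¹)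
      (fun p _ => Finset.sum_nonneg fun q _ => (inv_pos.2 (h0 p q)).le) (Finset.mem_univ p)
    exact h3.trans h4
  calc A p q = (ν (Matrix.single p q 1))⁻¹ * (A p q * ν (Matrix.single p q 1)) := by
        field_simp [(h0 p q).ne']
    _ ≤ _ := mul_le_mul h2 h1 (mul_nonneg (hA p q) (h0 p q).le)
        ((inv_pos.2 (h0 p q)).le.trans h2)

/-- Two coupled matrix recursions, the first of which is a contraction in a weaker norm. -/
lemma exists_growth (hν : IsMonotoneMatrixNorm ν) {B E : Matrix (Fin n) (Fin n) ℝ}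
    {L S : ℕ → Matrix (Fin n) (Fin n) ℝ} (hL0 : ∀ r p q, 0 ≤ L r p q) (hS0 : ∀ r p q, 0 ≤ S r p q)
    (hL : ∀ r p q, L (r + 1) p q ≤ (B * L r) p q)
    (hS : ∀ d : ℝ, 0 < d → ∃ C : ℝ, 0 ≤ C ∧ ∀ r p q, S (r + 1) p q ≤
      ((B + d • E) * S r + C • (E * L r)) p q)
    {ρ : ℝ} (hρ : ν B < ρ) :
    ∃ c : ℝ, 0 ≤ c ∧ ∀ r p q, S r p q ≤ c * ρ ^ r := by
  obtain ⟨c₀, hc₀, hc₀'⟩ := hν.exists_entry_le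
  have hE0 := hν.nonneg E
  have hB0 := hν.nonneg B
  -- The perturbation `d * ν E` uses at most half of the gap between `ν B` and `ρ`; the `+ 1` covers
  -- `ν E = 0`.
  set d := (ρ - ν B) / (2 * (ν E + 1)) with hd_def
  have hd : 0 < d := div_pos (by linarith) (by linarith)
  have hdE : ν B + d * ν E < ρ := by
    have : d * (2 * (ν E + 1)) = ρ - ν B := by
      rw [hd_def]; exact div_mul_cancel₀ _ (by linarith)
    nlinarith
  obtain ⟨C, hC, hS⟩ := hS d hd
  -- The weight for which `ν (S r) + Γ * ν (L r)` grows by a factor of at most `ρ`: the coupling `C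
  -- * ν E` is exactly the slack `Γ * (ρ - ν B)` in the recursion for `L`.
  set Γ := C * ν E / (ρ - ν B) with hΓ_def
  have hΓ : 0 ≤ Γ := div_nonneg (by positivity) (by linarith)
  have hΓ' : Γ * (ρ - ν B) = C * ν E := div_mul_cancel₀ _ (by linarith)
  have hstep : ∀ r, ν (S (r + 1)) + Γ * ν (L (r + 1)) ≤ ρ * (ν (S r) + Γ * ν (L r)) := fun r => by
    have h1 : ν (L (r + 1)) ≤ ν B * ν (L r) :=
      (hν.mono _ _ (hL0 _) (hL r)).trans (hν.mul_le _ _)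
    have h2 : ν (S (r + 1)) ≤ (ν B + d * ν E) * ν (S r) + C * (ν E * ν (L r)) := by
      refine (hν.mono _ _ (hS0 _) (hS r)).trans ((hν.add_le _ _).trans (add_le_add ?_ ?_))
      · refine (hν.mul_le _ _).trans (mul_le_mul_of_nonneg_right ?_ (hν.nonneg _))
        refine (hν.add_le _ _).trans_eq ?_
        rw [hν.smul, abs_of_pos hd]
      · rw [hν.smul, abs_of_nonneg hC]
        exact mul_le_mul_of_nonneg_left (hν.mul_le _ _) hC
    have h3 : (ν B + d * ν E) * ν (S r) ≤ ρ * ν (S r) :=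
      mul_le_mul_of_nonneg_right hdE.le (hν.nonneg _)
    have h4 := mul_le_mul_of_nonneg_left h1 hΓ
    have h5 : C * (ν E * ν (L r)) = Γ * (ρ - ν B) * ν (L r) := by rw [hΓ']; ring
    linarith
  have hind : ∀ r, ν (S r) + Γ * ν (L r) ≤ (ν (S 0) + Γ * ν (L 0)) * ρ ^ r := fun r => by
    induction r with
    | zero => simp
    | succ r ih =>
      refine (hstep r).trans ((mul_le_mul_of_nonneg_left ih (by linarith)).trans_eq ?_)
      ring
  refine ⟨c₀ * (ν (S 0) + Γ * ν (L 0)), mul_nonneg hc₀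
    (add_nonneg (hν.nonneg _) (mul_nonneg hΓ (hν.nonneg _))), fun r p q => ?_⟩
  refine (hc₀' _ (hS0 r) p q).trans ?_
  rw [mul_assoc]
  refine mul_le_mul_of_nonneg_left ?_ hc₀
  have := mul_nonneg hΓ (hν.nonneg (L r))
  linarith [hind r]

end IsMonotoneMatrixNorm

/-! ### Growth of iterated projections -/

/-- A projection with the commutator estimate that governs the growth of its iterated products
with multiplication operators; `Q` describes its range. -/
structure IsBoundedProj (P : (Circle → ℂ) → Circle → ℂ) (Q : (Circle → ℂ) → Prop) : Prop where
  sum : ∀ (f : Fin n → Circle → ℂ), (∀ i, IsHol (f i)) →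
    ∀ w, P (fun w => ∑ i, f i w) w = ∑ i, P (f i) w
  meanSq_le : ∀ f, IsHol f → meanSq (P f) ≤ meanSq f
  bound : ∀ m, IsHol m → ∀ B : ℝ, (∀ w, ‖m w‖ ≤ B) → ∀ d : ℝ, 0 < d → ∃ C : ℝ, 0 ≤ C ∧
    ∀ f, IsHol f → Q f → ∀ S : ℝ, (∀ w, ‖f w‖ ≤ S) →
      ∀ w, ‖P (fun w => m w * f w) w‖ ≤ (B + d) * S + C * meanSq f

lemma proj_sum {ι : Type*} (s : Finset ι) (f : ι → Circle → ℂ) (hf : ∀ i, IsHol (f i))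
    (w : Circle) :
    projPlus (fun w => ∑ i ∈ s, f i w) w = ∑ i ∈ s, projPlus (f i) w ∧
      projMinus (fun w => ∑ i ∈ s, f i w) w = ∑ i ∈ s, projMinus (f i) w := by
  refine projPlus_eq_of_decomposition (g := fun w => ∑ i ∈ s, projPlus (f i) w)
    (h := fun w => ∑ i ∈ s, projMinus (f i) w) (isHol_sum s fun i _ => hf i)
    (isPlusZero_sum s fun i _ => isPlusZero_projPlus (hf i))
    (isMinus_sum s fun i _ => isMinus_projMinus (hf i)) (fun w => ?_) w
  rw [← Finset.sum_add_distrib]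
  exact Finset.sum_congr rfl fun i _ => by rw [projMinus, add_sub_cancel]

/-- For `f` in the range, `P₊ f = f`, so `P₊ (m f)` is `m f` plus the commutator; the leading
constant is `sup |m|` and not a norm of the singular integral. -/
theorem isBoundedProj_projPlus : IsBoundedProj (n := n) projPlus IsPlusZero where
  sum f hf w := (proj_sum Finset.univ f hf w).1
  meanSq_le _ hf := meanSq_projPlus_le hf
  bound m hm B hB d hd := by
    obtain ⟨C, hC, h⟩ := exists_commutator_bound hm hd
    refine ⟨C, hC, fun f hf hQ S hS w => ?_⟩
    have h1 := h f hf S hS w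
    rw [projPlus_of_isPlusZero hf hQ] at h1
    have h2 : ‖m w * f w‖ ≤ B * S := by
      rw [norm_mul]
      exact mul_le_mul (hB w) (hS w) (norm_nonneg _) ((norm_nonneg _).trans (hB w))
    have h3 := norm_le_norm_add_norm_sub' (projPlus (fun w => m w * f w) w) (m w * f w)
    linarith

/-- Here `P₊ f = 0`, so `P₊ (m f)` is itself the commutator and `P₋ (m f) = m f - P₊ (m f)`. -/
theorem isBoundedProj_projMinus : IsBoundedProj (n := n) projMinus IsMinus where
  sum f hf w := (proj_sum Finset.univ f hf w).2
  meanSq_le _ hf := meanSq_projMinus_le hf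
  bound m hm B hB d hd := by
    obtain ⟨C, hC, h⟩ := exists_commutator_bound hm hd
    refine ⟨C, hC, fun f hf hQ S hS w => ?_⟩
    have h1 := h f hf S hS w
    rw [projPlus_of_isMinus hf hQ, mul_zero, sub_zero] at h1
    have h2 : ‖m w * f w‖ ≤ B * S := by
      rw [norm_mul]
      exact mul_le_mul (hB w) (hS w) (norm_nonneg _) ((norm_nonneg _).trans (hB w))
    have h3 := norm_sub_le (m w * f w) (projPlus (fun w => m w * f w) w)
    rw [projMinus]
    linarith

/-- Matrix functions on the circle. -/
abbrev CircMat (n : ℕ) := Circle → Matrix (Fin n) (Fin n) ℂ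

/-- The mean square norms `L` of the entries obey a recursion with matrix `B`, because `P` is a
contraction there. The suprema `S` obey it with `B + d E` and a term in `L`, because every `Z r`
lies in the range of `P`. `exists_growth` combines the two. -/
theorem exists_growth_of_recursion {P : (Circle → ℂ) → Circle → ℂ} {Q : (Circle → ℂ) → Prop}
    (hP : IsBoundedProj (n := n) P Q) {ν : Matrix (Fin n) (Fin n) ℝ → ℝ}
    (hν : IsMonotoneMatrixNorm ν) {A : CircMat n} (hA : ∀ p q, IsHol fun w => A w p q)
    {B : Matrix (Fin n) (Fin n) ℝ} (hB : ∀ w p q, ‖A w p q‖ ≤ B p q) {Z : ℕ → CircMat n}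
    (hZ : ∀ r p q, IsHol fun w => Z r w p q) (hQ : ∀ r p q, Q fun w => Z r w p q)
    (hrec : ∀ r w p q, Z (r + 1) w p q = -P (fun w => (A w * Z r w) p q) w)
    {ρ : ℝ} (hρ : ν B < ρ) :
    ∃ c : ℝ, 0 ≤ c ∧ ∀ r w p q, ‖Z r w p q‖ ≤ c * ρ ^ r := by
  obtain ⟨E, hE⟩ : ∃ E : Matrix (Fin n) (Fin n) ℝ, ∀ p q, E p q = 1 :=
    -- The all-ones matrix turns the scalar errors `d` and `C`, added in each entry, into matrix
    -- products.
    ⟨Matrix.of fun _ _ => 1, fun _ _ => rfl⟩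
  obtain ⟨S, hS⟩ : ∃ S : ℕ → Matrix (Fin n) (Fin n) ℝ, ∀ r p q, S r p q = ⨆ w, ‖Z r w p q‖ :=
    ⟨fun r => Matrix.of fun p q => ⨆ w, ‖Z r w p q‖, fun _ _ _ => rfl⟩
  obtain ⟨L, hL⟩ : ∃ L : ℕ → Matrix (Fin n) (Fin n) ℝ,
      ∀ r p q, L r p q = meanSq fun w => Z r w p q :=
    ⟨fun r => Matrix.of fun p q => meanSq fun w => Z r w p q, fun _ _ _ => rfl⟩
  have hle : ∀ r w p q, ‖Z r w p q‖ ≤ S r p q := fun r w p q => by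
    obtain ⟨b, -, hb⟩ := exists_bound_of_continuous (hZ r p q).continuous
    rw [hS]
    exact le_ciSup (f := fun w => ‖Z r w p q‖) ⟨b, by rintro _ ⟨w, rfl⟩; exact hb w⟩ w
  have hAZ : ∀ r p q l, IsHol fun w => A w p l * Z r w l q := fun r p q l =>
    (hA p l).mul (hZ r l q)
  have hAZs : ∀ r p q, IsHol fun w => ∑ l, A w p l * Z r w l q := fun r p q =>
    isHol_sum _ fun l _ => hAZ r p q l
  simp only [Matrix.mul_apply] at hrec
  have hLrec : ∀ r p q, L (r + 1) p q ≤ (B * L r) p q := fun r p q => by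
    have h1 : L (r + 1) p q = meanSq (P fun w => ∑ l, A w p l * Z r w l q) := by
      simp only [hL, hrec]
      exact meanSq_neg _
    simp only [h1, Matrix.mul_apply, hL]
    exact (hP.meanSq_le _ (hAZs r p q)).trans (meanSq_sum_mul_le _ (fun l => (hA p l).continuous)
      (fun l => (hZ r l q).continuous) fun l w => hB w p l)
  have hL0 : ∀ r p q, 0 ≤ L r p q := fun r p q => by rw [hL]; exact meanSq_nonneg _
  have hS0 : ∀ r p q, 0 ≤ S r p q := fun r p q => (norm_nonneg _).trans (hle r 1 p q)
  have hSrec : ∀ d : ℝ, 0 < d → ∃ C : ℝ, 0 ≤ C ∧ ∀ r p q, S (r + 1) p q ≤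
      ((B + d • E) * S r + C • (E * L r)) p q := fun d hd => by
    choose C hC0 hC using fun p l => hP.bound _ (hA p l) (B p l) (fun w => hB w p l) d hd
    refine ⟨∑ p, ∑ l, C p l, Finset.sum_nonneg fun p _ => Finset.sum_nonneg fun l _ => hC0 p l,
      fun r p q => ?_⟩
    have hCle : ∀ p l, C p l ≤ ∑ p, ∑ l, C p l := fun p l =>
      (Finset.single_le_sum (f := fun l => C p l) (fun l _ => hC0 p l) (Finset.mem_univ l)).trans
        (Finset.single_le_sum (f := fun p => ∑ l, C p l)
          (fun p _ => Finset.sum_nonneg fun l _ => hC0 p l) (Finset.mem_univ p))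
    rw [hS]
    refine ciSup_le fun w => ?_
    rw [hrec, norm_neg, hP.sum _ (hAZ r p q)]
    refine (norm_sum_le _ _).trans ?_
    simp only [Matrix.add_apply, Matrix.mul_apply, Matrix.smul_apply, smul_eq_mul, hE,
      mul_one, one_mul]
    rw [Finset.mul_sum, ← Finset.sum_add_distrib]
    refine Finset.sum_le_sum fun l _ => (hC p l _ (hZ r l q) (hQ r l q) _
      (fun w => hle r w l q) w).trans (add_le_add le_rfl ?_)
    rw [← hL]
    exact mul_le_mul_of_nonneg_right (hCle p l) (hL0 r l q)
  obtain ⟨c, hc, h⟩ := hν.exists_growth hL0 hS0 hLrec hSrec hρ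
  exact ⟨c, hc, fun r w p q => (hle r w p q).trans (h r p q)⟩

/-! ### Entrywise properties of matrix functions on the circle -/

/-- All entries have the property `Q`. -/
def Entrywise (Q : (Circle → ℂ) → Prop) (M : CircMat n) : Prop := ∀ p q, Q fun w => M w p q

/-- The plus projection, entrywise. -/
def projPlusMat (M : CircMat n) : CircMat n := fun w =>
  Matrix.of fun p q => projPlus (fun w => M w p q) w

/-- The minus projection, entrywise. -/
def projMinusMat (M : CircMat n) : CircMat n := fun w =>
  Matrix.of fun p q => projMinus (fun w => M w p q) w

lemma projMinusMat_eq (M : CircMat n) : projMinusMat M = M - projPlusMat M := rfl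

lemma entrywise_mul {Q Q₁ Q₂ : (Circle → ℂ) → Prop}
    (hmul : ∀ f g : Circle → ℂ, Q₁ f → Q₂ g → Q fun w => f w * g w)
    (hsum : ∀ f : Fin n → Circle → ℂ, (∀ i, Q (f i)) → Q fun w => ∑ i, f i w)
    {M N : CircMat n} (hM : Entrywise Q₁ M) (hN : Entrywise Q₂ N) : Entrywise Q (M * N) :=
  fun p q => by
    simp only [Pi.mul_apply, Matrix.mul_apply]
    exact hsum _ fun i => hmul _ _ (hM p i) (hN i q)

lemma Entrywise.mul_isHol {M N : CircMat n} (hM : Entrywise IsHol M) (hN : Entrywise IsHol N) :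
    Entrywise IsHol (M * N) :=
  entrywise_mul (fun _ _ => IsHol.mul) (fun _ hf => isHol_sum _ fun i _ => hf i) hM hN

lemma Entrywise.mul_isMinus {M N : CircMat n} (hM : Entrywise IsMinus M)
    (hN : Entrywise IsMinus N) : Entrywise IsMinus (M * N) :=
  entrywise_mul (fun _ _ => IsMinus.mul) (fun _ hf => isMinus_sum _ fun i _ => hf i) hM hN

lemma Entrywise.mul_isPlusZero {M N : CircMat n} (hM : Entrywise IsPlusZero M)
    (hN : Entrywise IsPlus N) : Entrywise IsPlusZero (M * N) :=
  entrywise_mul (fun _ _ => IsPlusZero.mul) (fun _ hf => isPlusZero_sum _ fun i _ => hf i) hM hN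

lemma Entrywise.isHol_projPlusMat {M : CircMat n} (hM : Entrywise IsHol M) :
    Entrywise IsHol (projPlusMat M) := fun p q => isHol_projPlus (hM p q)

lemma Entrywise.isHol_projMinusMat {M : CircMat n} (hM : Entrywise IsHol M) :
    Entrywise IsHol (projMinusMat M) := fun p q => isHol_projMinus (hM p q)

lemma Entrywise.isPlusZero_projPlusMat {M : CircMat n} (hM : Entrywise IsHol M) :
    Entrywise IsPlusZero (projPlusMat M) := fun p q => isPlusZero_projPlus (hM p q)

lemma Entrywise.isMinus_projMinusMat {M : CircMat n} (hM : Entrywise IsHol M) :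
    Entrywise IsMinus (projMinusMat M) := fun p q => isMinus_projMinus (hM p q)

/-! ### The two linear recursions -/

section Recursion

variable (a : Fin n → Prop) [DecidablePred a]

/-- The diagonal matrix with the coordinate `w` at the places where `a` holds, and `1` elsewhere. -/
def circDiag : CircMat n := fun w => Matrix.diagonal fun j => if a j then (w : ℂ) else 1

/-- The inverse of `circDiag`. -/
def circDiagInv : CircMat n := fun w => Matrix.diagonal fun j => if a j then (w : ℂ)⁻¹ else 1

lemma circDiag_mul_inv : circDiag a * circDiagInv a = 1 := by
  ext w : 1
  simp only [circDiag, circDiagInv, Pi.mul_apply, Pi.one_apply, Matrix.diagonal_mul_diagonal]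
  rw [← Matrix.diagonal_one]
  congr 1
  ext j
  split_ifs <;> simp

lemma circDiagInv_mul : circDiagInv a * circDiag a = 1 := by
  ext w : 1
  simp only [circDiag, circDiagInv, Pi.mul_apply, Pi.one_apply, Matrix.diagonal_mul_diagonal]
  rw [← Matrix.diagonal_one]
  congr 1
  ext j
  split_ifs <;> simp

lemma isHol_circDiagInv : Entrywise IsHol (circDiagInv a) := fun p q => by
  by_cases hpq : p = q
  · subst hpq
    simp only [circDiagInv, Matrix.diagonal_apply_eq]
    split_ifs
    · simpa using isHol_coe.comp_inv
    · exact isHol_const 1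
  · simp only [circDiagInv, Matrix.diagonal_apply_ne _ hpq]
    exact isHol_const 0

lemma isMinus_circDiagInv : Entrywise IsMinus (circDiagInv a) := fun p q => by
  by_cases hpq : p = q
  · subst hpq
    simp only [circDiagInv, Matrix.diagonal_apply_eq]
    split_ifs
    · exact isMinus_inv
    · exact isMinus_const 1
  · simp only [circDiagInv, Matrix.diagonal_apply_ne _ hpq]
    exact isMinus_const 0

lemma isPlus_circDiagInv_mul {M : CircMat n} (hM : Entrywise IsPlusZero M) :
    Entrywise IsPlus (circDiagInv a * M) := fun p q => by
  simp only [circDiagInv, Pi.mul_apply, Matrix.diagonal_mul]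
  split_ifs
  · exact (hM p q).inv_mul
  · simpa using (hM p q).isPlus

variable (M : CircMat n)

/-- The coefficients of the solution `Z` of `Z + ε P₊(M Λ₀⁻¹ Z) = -ε P₊ M`. -/
def plusIter : ℕ → CircMat n
  | 0 => -projPlusMat M
  | r + 1 => -projPlusMat (M * circDiagInv a * plusIter r)

/-- The coefficients of the solution `O` of `O + ε P₋(O Λ₀⁻¹ M) = -ε P₋ M`. -/
def minusIter : ℕ → CircMat n
  | 0 => -projMinusMat M
  | r + 1 => -projMinusMat (minusIter r * (circDiagInv a * M))

/-- The coefficients of `ε M (1 + Λ₀⁻¹ Z) + Z`. -/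
def minusCoeff : ℕ → CircMat n
  | 0 => M + plusIter a M 0
  | r + 1 => M * circDiagInv a * plusIter a M r + plusIter a M (r + 1)

/-- The coefficients of `ε (1 + O Λ₀⁻¹) M + O`. -/
def plusCoeff : ℕ → CircMat n
  | 0 => M + minusIter a M 0
  | r + 1 => minusIter a M r * (circDiagInv a * M) + minusIter a M (r + 1)

variable {M} (hM : Entrywise IsHol M)
include hM

/-! ### Regularity and type of the coefficients -/

lemma isHol_plusIter (r : ℕ) : Entrywise IsHol (plusIter a M r) := by
  induction r with
  | zero => exact fun p q => (hM.isHol_projPlusMat p q).neg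
  | succ r ih =>
    exact fun p q => (((hM.mul_isHol (isHol_circDiagInv a)).mul_isHol ih).isHol_projPlusMat p q).neg

lemma isHol_minusIter (r : ℕ) : Entrywise IsHol (minusIter a M r) := by
  induction r with
  | zero => exact fun p q => (hM.isHol_projMinusMat p q).neg
  | succ r ih =>
    exact fun p q =>
      ((ih.mul_isHol ((isHol_circDiagInv a).mul_isHol hM)).isHol_projMinusMat p q).neg

lemma isPlusZero_plusIter (r : ℕ) : Entrywise IsPlusZero (plusIter a M r) := by
  cases r with
  | zero => exact fun p q => (hM.isPlusZero_projPlusMat p q).neg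
  | succ r =>
    exact fun p q => (((hM.mul_isHol (isHol_circDiagInv a)).mul_isHol
      (isHol_plusIter a hM r)).isPlusZero_projPlusMat p q).neg

lemma isMinus_minusIter (r : ℕ) : Entrywise IsMinus (minusIter a M r) := by
  cases r with
  | zero => exact fun p q => (hM.isMinus_projMinusMat p q).neg
  | succ r =>
    exact fun p q => (((isHol_minusIter a hM r).mul_isHol
      ((isHol_circDiagInv a).mul_isHol hM)).isMinus_projMinusMat p q).neg

/-- The recursion makes each coefficient `F - P₊ F = P₋ F`, with `F = M` or `F = M Λ₀⁻¹ Z_r`. -/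
lemma isMinus_minusCoeff (r : ℕ) : Entrywise IsMinus (minusCoeff a M r) := by
  cases r with
  | zero =>
    have h := hM.isMinus_projMinusMat
    rwa [projMinusMat_eq, sub_eq_add_neg] at h
  | succ r =>
    have h := ((hM.mul_isHol (isHol_circDiagInv a)).mul_isHol
      (isHol_plusIter a hM r)).isMinus_projMinusMat
    rwa [projMinusMat_eq, sub_eq_add_neg] at h

/-- Mirror image: each coefficient is `F - P₋ F = P₊ F`. -/
lemma isPlusZero_plusCoeff (r : ℕ) : Entrywise IsPlusZero (plusCoeff a M r) := by
  cases r with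
  | zero =>
    have h := hM.isPlusZero_projPlusMat
    rw [← sub_sub_cancel M (projPlusMat M), ← projMinusMat_eq, sub_eq_add_neg] at h
    exact h
  | succ r =>
    have h := ((isHol_minusIter a hM r).mul_isHol
      ((isHol_circDiagInv a).mul_isHol hM)).isPlusZero_projPlusMat
    rw [← sub_sub_cancel (minusIter a M r * (circDiagInv a * M)) (projPlusMat _),
      ← projMinusMat_eq, sub_eq_add_neg] at h
    exact h

lemma isHol_minusCoeff (r : ℕ) : Entrywise IsHol (minusCoeff a M r) := by
  cases r with
  | zero => exact fun p q => (hM p q).add (isHol_plusIter a hM 0 p q)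
  | succ r =>
    exact fun p q => (((hM.mul_isHol (isHol_circDiagInv a)).mul_isHol
      (isHol_plusIter a hM r)) p q).add (isHol_plusIter a hM (r + 1) p q)

lemma isHol_plusCoeff (r : ℕ) : Entrywise IsHol (plusCoeff a M r) := by
  cases r with
  | zero => exact fun p q => (hM p q).add (isHol_minusIter a hM 0 p q)
  | succ r =>
    exact fun p q => (((isHol_minusIter a hM r).mul_isHol
      ((isHol_circDiagInv a).mul_isHol hM)) p q).add (isHol_minusIter a hM (r + 1) p q)

end Recursion

/-! ### Formal factorization -/

open PowerSeries in
lemma coeff_entrywise_mul {Q Q₁ Q₂ : (Circle → ℂ) → Prop}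
    (hmul : ∀ M N : CircMat n, Entrywise Q₁ M → Entrywise Q₂ N → Entrywise Q (M * N))
    (hsum : ∀ (s : Finset (ℕ × ℕ)) (f : ℕ × ℕ → Circle → ℂ), (∀ i ∈ s, Q (f i)) →
      Q fun w => ∑ i ∈ s, f i w)
    {f g : PowerSeries (CircMat n)} (hf : ∀ r, Entrywise Q₁ (coeff r f))
    (hg : ∀ r, Entrywise Q₂ (coeff r g)) (r : ℕ) : Entrywise Q (coeff r (f * g)) := fun p q => by
  rw [coeff_mul]
  simp only [Finset.sum_apply, Matrix.sum_apply]
  exact hsum _ _ fun i _ => hmul _ _ (hf i.1) (hg i.2) p q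

/-- Matrix-valued power series do not commute, so a one-sided inverse has to be upgraded by
invertibility known from elsewhere. -/
lemma mul_eq_one_of_isUnit_left {R : Type*} [Monoid R] {u v : R} (hu : IsUnit u) (h : u * v = 1) :
    v * u = 1 := by
  obtain ⟨u, rfl⟩ := hu
  have hv : v = ↑u⁻¹ := Units.eq_inv_of_mul_eq_one_left h
  rw [hv, Units.inv_mul]

section Formal

open PowerSeries

/-- The power series `∑ X^(r+1) f_r`. -/
def shiftSeries (f : ℕ → CircMat n) : PowerSeries (CircMat n) := X * PowerSeries.mk f

lemma coeff_zero_shiftSeries (f : ℕ → CircMat n) : coeff 0 (shiftSeries f) = 0 := by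
  simp [shiftSeries]

lemma constantCoeff_shiftSeries (f : ℕ → CircMat n) : constantCoeff (shiftSeries f) = 0 := by
  simp [shiftSeries]

lemma coeff_succ_shiftSeries (f : ℕ → CircMat n) (r : ℕ) :
    coeff (r + 1) (shiftSeries f) = f r := by
  rw [shiftSeries, coeff_succ_X_mul, coeff_mk]

lemma entrywise_shiftSeries {Q : (Circle → ℂ) → Prop} (h0 : Q fun _ => 0) {f : ℕ → CircMat n}
    (hf : ∀ r, Entrywise Q (f r)) (r : ℕ) : Entrywise Q (coeff r (shiftSeries f)) := by
  cases r with
  | zero => rw [coeff_zero_shiftSeries]; exact fun _ _ => h0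
  | succ r => rw [coeff_succ_shiftSeries]; exact hf r

lemma C_mul_shiftSeries (A : CircMat n) (f : ℕ → CircMat n) :
    C A * shiftSeries f = shiftSeries fun r => A * f r := by
  ext r : 1
  rw [coeff_C_mul]
  cases r with
  | zero => rw [coeff_zero_shiftSeries, coeff_zero_shiftSeries, mul_zero]
  | succ r => rw [coeff_succ_shiftSeries, coeff_succ_shiftSeries]

lemma shiftSeries_mul_C (A : CircMat n) (f : ℕ → CircMat n) :
    shiftSeries f * C A = shiftSeries fun r => f r * A := by
  ext r : 1
  rw [coeff_mul_C]
  cases r with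
  | zero => rw [coeff_zero_shiftSeries, coeff_zero_shiftSeries, zero_mul]
  | succ r => rw [coeff_succ_shiftSeries, coeff_succ_shiftSeries]

variable (a : Fin n → Prop) [DecidablePred a] (M : CircMat n)

lemma minusCoeff_series : shiftSeries (minusCoeff a M) =
    shiftSeries (plusIter a M) + X * (C M * (1 + shiftSeries fun r =>
      circDiagInv a * plusIter a M r)) := by
  ext r : 1
  cases r with
  | zero => simp [constantCoeff_shiftSeries]
  | succ r =>
    rw [map_add, coeff_succ_X_mul, coeff_C_mul, coeff_succ_shiftSeries, coeff_succ_shiftSeries]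
    cases r with
    | zero => simp [constantCoeff_shiftSeries, minusCoeff, add_comm]
    | succ r =>
      rw [map_add, coeff_succ_shiftSeries, coeff_one, if_neg (Nat.succ_ne_zero r), zero_add,
        minusCoeff, mul_assoc, add_comm]

lemma plusCoeff_series : shiftSeries (plusCoeff a M) =
    shiftSeries (minusIter a M) + X * ((1 + shiftSeries fun r =>
      minusIter a M r * circDiagInv a) * C M) := by
  ext r : 1
  cases r with
  | zero => simp [constantCoeff_shiftSeries]
  | succ r =>
    rw [map_add, coeff_succ_X_mul, coeff_mul_C, coeff_succ_shiftSeries, coeff_succ_shiftSeries]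
    cases r with
    | zero => simp [constantCoeff_shiftSeries, plusCoeff, add_comm]
    | succ r =>
      rw [map_add, coeff_succ_shiftSeries, coeff_one, if_neg (Nat.succ_ne_zero r), zero_add,
        plusCoeff, mul_assoc, add_comm]

/-- The inverse of the minus factor, as a formal power series. -/
def seriesU : PowerSeries (CircMat n) := 1 + shiftSeries fun r => minusIter a M r * circDiagInv a

/-- The minus factor, as a formal power series. -/
def seriesV : PowerSeries (CircMat n) := 1 + shiftSeries fun r => minusCoeff a M r * circDiagInv a

/-- The plus factor, as a formal power series. -/
def seriesQ : PowerSeries (CircMat n) := 1 + shiftSeries fun r => circDiagInv a * plusCoeff a M r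

/-- The inverse of the plus factor, as a formal power series. -/
def seriesY : PowerSeries (CircMat n) := 1 + shiftSeries fun r => circDiagInv a * plusIter a M r

lemma seriesV_mul : seriesV a M * C (circDiag a) =
    C (circDiag a) + shiftSeries (minusCoeff a M) := by
  rw [seriesV, add_mul, one_mul, shiftSeries_mul_C]
  simp only [mul_assoc, circDiagInv_mul, mul_one]

lemma seriesU_mul : seriesU a M * C (circDiag a) =
    C (circDiag a) + shiftSeries (minusIter a M) := by
  rw [seriesU, add_mul, one_mul, shiftSeries_mul_C]
  simp only [mul_assoc, circDiagInv_mul, mul_one]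

lemma mul_seriesQ : C (circDiag a) * seriesQ a M =
    C (circDiag a) + shiftSeries (plusCoeff a M) := by
  rw [seriesQ, mul_add, mul_one, C_mul_shiftSeries]
  simp only [← mul_assoc, circDiag_mul_inv, one_mul]

lemma mul_seriesY : C (circDiag a) * seriesY a M =
    C (circDiag a) + shiftSeries (plusIter a M) := by
  rw [seriesY, mul_add, mul_one, C_mul_shiftSeries]
  simp only [← mul_assoc, circDiag_mul_inv, one_mul]

/-- The linear equation for `Z` in multiplicative form: applying the symbol to `Y` leaves only minus
terms besides `Λ₀`. The companion `seriesU_mul_symbol` does the same from the left. -/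
lemma symbol_mul_seriesY : (C (circDiag a) + X * C M) * seriesY a M =
    seriesV a M * C (circDiag a) := by
  rw [add_mul, mul_seriesY, seriesV_mul, minusCoeff_series, mul_assoc, add_assoc]
  rfl

lemma seriesU_mul_symbol : seriesU a M * (C (circDiag a) + X * C M) =
    C (circDiag a) * seriesQ a M := by
  rw [mul_add, seriesU_mul, mul_seriesQ, plusCoeff_series, ← mul_assoc,
    (commute_X (seriesU a M)).eq, mul_assoc, add_assoc]
  rfl

lemma C_circDiag_mul_inv : (C (circDiag a) : PowerSeries (CircMat n)) * C (circDiagInv a) = 1 := by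
  rw [← map_mul, circDiag_mul_inv, map_one]

lemma C_circDiagInv_mul : (C (circDiagInv a) : PowerSeries (CircMat n)) * C (circDiag a) = 1 := by
  rw [← map_mul, circDiagInv_mul, map_one]

variable {M} (hM : Entrywise IsHol M)
include hM

/-- Inserting the symbol between `U` and `Y` gives `U V Λ₀ = Λ₀ Q Y`. Beyond `Λ₀`, each coefficient
is of minus type by the left side and of plus type with a zero at the centre by the right side,
hence zero. -/
lemma seriesU_mul_seriesV_mul :
    seriesU a M * (seriesV a M * C (circDiag a)) = C (circDiag a) := by
  have h1 : seriesU a M * (seriesV a M * C (circDiag a)) =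
      C (circDiag a) * seriesQ a M * seriesY a M := by
    rw [← symbol_mul_seriesY, ← seriesU_mul_symbol, mul_assoc]
  have hm : seriesU a M * (seriesV a M * C (circDiag a)) = C (circDiag a) +
      (shiftSeries (minusIter a M) + seriesU a M * shiftSeries (minusCoeff a M)) := by
    rw [seriesV_mul, mul_add, seriesU_mul, add_assoc]
  have hp : C (circDiag a) * seriesQ a M * seriesY a M = C (circDiag a) +
      (shiftSeries (plusIter a M) + shiftSeries (plusCoeff a M) * seriesY a M) := by
    rw [mul_seriesQ, add_mul, mul_seriesY, add_assoc]
  have h2 : shiftSeries (minusIter a M) + seriesU a M * shiftSeries (minusCoeff a M) =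
      shiftSeries (plusIter a M) + shiftSeries (plusCoeff a M) * seriesY a M := by
    rw [hm, hp] at h1
    exact add_left_cancel h1
  have hU : ∀ r, Entrywise IsMinus (coeff r (seriesU a M)) := fun r p q => by
    have h3 := entrywise_shiftSeries (isMinus_const 0) (fun r =>
      (isMinus_minusIter a hM r).mul_isMinus (isMinus_circDiagInv a)) r p q
    have h4 : IsMinus fun w => (coeff r (1 : PowerSeries (CircMat n))) w p q := by
      rw [coeff_one]
      split_ifs
      · exact isMinus_const ((1 : Matrix (Fin n) (Fin n) ℂ) p q)
      · exact isMinus_const 0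
    rw [seriesU, map_add]
    exact h4.add h3
  have hY : ∀ r, Entrywise IsPlus (coeff r (seriesY a M)) := fun r p q => by
    have h3 := entrywise_shiftSeries (isPlus_const 0) (fun r =>
      isPlus_circDiagInv_mul a (isPlusZero_plusIter a hM r)) r p q
    have h4 : IsPlus fun w => (coeff r (1 : PowerSeries (CircMat n))) w p q := by
      rw [coeff_one]
      split_ifs
      · exact isPlus_const ((1 : Matrix (Fin n) (Fin n) ℂ) p q)
      · exact isPlus_const 0
    rw [seriesY, map_add]
    exact h4.add h3
  rw [hm]
  suffices h : shiftSeries (minusIter a M) + seriesU a M * shiftSeries (minusCoeff a M) = 0 by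
    rw [h, add_zero]
  ext r w p q
  refine eq_zero_of_isPlusZero_of_isMinus (f := fun w => coeff r (shiftSeries (minusIter a M) +
    seriesU a M * shiftSeries (minusCoeff a M)) w p q) ?_ ?_ w
  · rw [h2]
    have h3 := entrywise_shiftSeries isPlusZero_zero (isPlusZero_plusIter a hM) r p q
    have h4 := coeff_entrywise_mul (fun _ _ => Entrywise.mul_isPlusZero)
      (fun s f hf => isPlusZero_sum s hf)
      (entrywise_shiftSeries isPlusZero_zero (isPlusZero_plusCoeff a hM)) hY r p q
    rw [map_add]
    exact h3.add h4
  · have h3 := entrywise_shiftSeries (isMinus_const 0) (isMinus_minusIter a hM) r p q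
    have h4 := coeff_entrywise_mul (fun _ _ => Entrywise.mul_isMinus)
      (fun s f hf => isMinus_sum s hf) hU
      (entrywise_shiftSeries (isMinus_const 0) (isMinus_minusCoeff a hM)) r p q
    rw [map_add]
    exact h3.add h4

lemma seriesU_mul_seriesV : seriesU a M * seriesV a M = 1 := by
  have h := congrArg (· * C (circDiagInv a)) (seriesU_mul_seriesV_mul a hM)
  simpa only [mul_assoc, C_circDiag_mul_inv, mul_one] using h

/-- The constant coefficient of `U` is `1`, so `U` is a unit among formal power series and its right
inverse is two-sided. -/
lemma seriesV_mul_seriesU : seriesV a M * seriesU a M = 1 := by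
  have hu : IsUnit (seriesU a M) := by
    rw [isUnit_iff_constantCoeff]
    have h : constantCoeff (seriesU a M) = 1 := by
      rw [← coeff_zero_eq_constantCoeff_apply, seriesU, map_add, coeff_zero_shiftSeries, add_zero,
        coeff_zero_one]
    rw [h]
    exact isUnit_one
  exact mul_eq_one_of_isUnit_left hu (seriesU_mul_seriesV a hM)

lemma seriesQ_mul_seriesY : seriesQ a M * seriesY a M = 1 := by
  have h1 : C (circDiag a) * (seriesQ a M * seriesY a M) = C (circDiag a) := by
    rw [← mul_assoc, ← seriesU_mul_symbol, mul_assoc, symbol_mul_seriesY,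
      seriesU_mul_seriesV_mul a hM]
  have h := congrArg (C (circDiagInv a) * ·) h1
  simpa only [← mul_assoc, C_circDiagInv_mul, one_mul] using h

theorem formal_factorization : seriesV a M * C (circDiag a) * seriesQ a M =
    C (circDiag a) + X * C M := by
  rw [mul_assoc, ← seriesU_mul_symbol, ← mul_assoc, seriesV_mul_seriesU a hM, one_mul]

/-- The coefficients of the factors satisfy the recursion of boundary value problems. -/
theorem coeff_recursion (r : ℕ) : minusCoeff a M r + plusCoeff a M r =
    (if r = 0 then M else 0) - ∑ i ∈ Finset.range r,
      minusCoeff a M i * (circDiagInv a * plusCoeff a M (r - 1 - i)) := by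
  have h := congrArg (coeff (r + 1)) (formal_factorization a hM)
  have h1 : seriesV a M * C (circDiag a) * seriesQ a M = C (circDiag a) +
      shiftSeries (plusCoeff a M) + shiftSeries (minusCoeff a M) * seriesQ a M := by
    rw [seriesV_mul, add_mul, mul_seriesQ]
  have h2 : shiftSeries (minusCoeff a M) * seriesQ a M = X * (PowerSeries.mk (minusCoeff a M) +
      PowerSeries.mk (minusCoeff a M) * shiftSeries fun r => circDiagInv a * plusCoeff a M r) := by
    rw [shiftSeries, seriesQ, mul_assoc, mul_add, mul_one]
  rw [h1, h2, map_add, map_add, map_add, coeff_succ_X_mul, coeff_succ_X_mul, coeff_succ_shiftSeries,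
    coeff_C, if_neg (Nat.succ_ne_zero r), zero_add, zero_add, map_add, coeff_mk, coeff_C] at h
  rw [eq_sub_iff_add_eq, ← h, add_comm (minusCoeff a M r), add_assoc]
  congr 2
  cases r with
  | zero => simp [constantCoeff_shiftSeries]
  | succ r =>
    -- The last term of the Cauchy product meets the vanishing constant coefficient of the shifted
    -- series, so the sum stops at `r`.
    rw [coeff_mul, Finset.Nat.sum_antidiagonal_eq_sum_range_succ_mk, Finset.sum_range_succ _ (r + 1)]
    simp only [Nat.sub_self, coeff_zero_shiftSeries, mul_zero, add_zero, coeff_mk]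
    refine Finset.sum_congr rfl fun i hi => ?_
    rw [Finset.mem_range] at hi
    rw [show r + 1 - i = (r - i) + 1 by omega, coeff_succ_shiftSeries, Nat.add_sub_cancel]

end Formal

/-! ### Sums of series of boundary values -/

/-- The maximum principle carries each bound from the circle to the disc, so the extensions converge
uniformly on the closed disc. -/
lemma isPlus_tsum {f : ℕ → Circle → ℂ} (hf : ∀ r, IsPlus (f r)) {b : ℕ → ℝ} (hb : Summable b)
    (h : ∀ r w, ‖f r w‖ ≤ b r) : IsPlus fun w => ∑' r, f r w := by
  choose u hu hu' using hf
  have hle : ∀ r, ∀ z ∈ closure (ball (0 : ℂ) 1), ‖u r z‖ ≤ b r := fun r z hz => by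
    refine norm_le_of_forall_mem_frontier_norm_le isBounded_ball (hu r) (fun y hy => ?_) hz
    rw [frontier_ball _ one_ne_zero, mem_sphere_zero_iff_norm] at hy
    have h1 := hu' r ⟨y, mem_sphere_zero_iff_norm.2 hy⟩
    exact (congrArg norm h1).trans_le (h r _)
  refine ⟨fun z => ∑' r, u r z, ⟨?_, ?_⟩, fun w => by simp only [hu']⟩
  · exact differentiableOn_tsum_of_summable_norm hb (fun r => (hu r).1) isOpen_ball
      fun r z hz => hle r z (subset_closure hz)
  · exact continuousOn_tsum (fun r => (hu r).2) hb hle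

/-! ### Geometric bounds -/

/-- The entries grow at most like `ρ ^ r`. -/
def GeomBound (ρ : ℝ) (f : ℕ → CircMat n) : Prop :=
  ∃ c : ℝ, 0 ≤ c ∧ ∀ r w p q, ‖f r w p q‖ ≤ c * ρ ^ r

lemma norm_ite_inv_mul (P : Prop) [Decidable P] (w : Circle) (z : ℂ) :
    ‖(if P then (w : ℂ)⁻¹ else 1) * z‖ = ‖z‖ := by
  split_ifs
  · rw [norm_mul, norm_inv, Circle.norm_coe, inv_one, one_mul]
  · rw [one_mul]

section Bounds

variable (a : Fin n → Prop) [DecidablePred a]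

lemma norm_circDiagInv_mul (M : CircMat n) (w : Circle) (p q : Fin n) :
    ‖(circDiagInv a * M) w p q‖ = ‖M w p q‖ := by
  simp only [circDiagInv, Pi.mul_apply, Matrix.diagonal_mul, norm_ite_inv_mul]

lemma norm_mul_circDiagInv (M : CircMat n) (w : Circle) (p q : Fin n) :
    ‖(M * circDiagInv a) w p q‖ = ‖M w p q‖ := by
  simp only [circDiagInv, Pi.mul_apply, Matrix.mul_diagonal]
  rw [mul_comm, norm_ite_inv_mul]

lemma GeomBound.circDiagInv_mul {ρ : ℝ} {f : ℕ → CircMat n} (hf : GeomBound ρ f) :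
    GeomBound ρ fun r => circDiagInv a * f r := by
  obtain ⟨c, hc, h⟩ := id hf
  exact ⟨c, hc, fun r w p q => by rw [norm_circDiagInv_mul]; exact h r w p q⟩

lemma GeomBound.mul_circDiagInv {ρ : ℝ} {f : ℕ → CircMat n} (hf : GeomBound ρ f) :
    GeomBound ρ fun r => f r * circDiagInv a := by
  obtain ⟨c, hc, h⟩ := id hf
  exact ⟨c, hc, fun r w p q => by rw [norm_mul_circDiagInv]; exact h r w p q⟩

/-- A sequence that differs from `f (r + 1)` by a bounded linear expression in `f r` has the same
rate; the index shift costs the division by `ρ`. -/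
lemma GeomBound.of_succ {ρ : ℝ} (hρ : 0 < ρ) {f g : ℕ → CircMat n} (hf : GeomBound ρ f) {K b₀ : ℝ}
    (h0 : ∀ w p q, ‖g 0 w p q‖ ≤ b₀)
    (h : ∀ b : ℝ, 0 ≤ b → ∀ r w, (∀ p q, ‖f r w p q‖ ≤ b) →
      ∀ p q, ‖g (r + 1) w p q - f (r + 1) w p q‖ ≤ K * b) : GeomBound ρ g := by
  obtain ⟨c, hc, hf⟩ := hf
  refine ⟨|b₀| + |K| * c / ρ + c, by positivity, fun r w p q => ?_⟩
  cases r with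
  | zero =>
    rw [pow_zero, mul_one]
    have : 0 ≤ |K| * c / ρ := by positivity
    linarith [h0 w p q, le_abs_self b₀]
  | succ r =>
    have hr : 0 ≤ ρ ^ r := by positivity
    have h1 := h (c * ρ ^ r) (by positivity) r w (fun p q => hf r w p q) p q
    have h2 := norm_le_norm_add_norm_sub' (g (r + 1) w p q) (f (r + 1) w p q)
    have h3 := hf (r + 1) w p q
    have h4 : K * (c * ρ ^ r) ≤ |K| * c / ρ * ρ ^ (r + 1) := by
      rw [pow_succ, show |K| * c / ρ * (ρ ^ r * ρ) = |K| * (c * ρ ^ r) by field_simp]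
      exact mul_le_mul_of_nonneg_right (le_abs_self K) (by positivity)
    have h5 : 0 ≤ |b₀| * ρ ^ (r + 1) := by positivity
    linarith

/-! ### Growth rates of the four coefficient sequences -/

variable {ν : Matrix (Fin n) (Fin n) ℝ → ℝ} (hν : IsMonotoneMatrixNorm ν) {M : CircMat n}
  (hM : Entrywise IsHol M) {B : Matrix (Fin n) (Fin n) ℝ} (hB : ∀ w p q, ‖M w p q‖ ≤ B p q)
  {ρ : ℝ} (hρ : ν B < ρ)
include hν hM hB hρ

lemma geomBound_plusIter : GeomBound ρ (plusIter a M) :=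
  exists_growth_of_recursion isBoundedProj_projPlus hν (A := M * circDiagInv a)
    (hM.mul_isHol (isHol_circDiagInv a)) (fun w p q => by rw [norm_mul_circDiagInv]; exact hB w p q)
    (isHol_plusIter a hM) (isPlusZero_plusIter a hM) (fun _ _ _ _ => rfl) hρ

/-- Transposing puts the fixed factor on the left, so the general recursion applies with the norm `A
↦ ν Aᵀ`. -/
lemma geomBound_minusIter : GeomBound ρ (minusIter a M) := by
  have hA : Entrywise IsHol (circDiagInv a * M) := (isHol_circDiagInv a).mul_isHol hM
  obtain ⟨c, hc, h⟩ := exists_growth_of_recursion isBoundedProj_projMinus hν.transpose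
    (A := fun w => ((circDiagInv a * M) w).transpose) (B := B.transpose)
    (fun p q => hA q p) (fun w p q => by
      rw [Matrix.transpose_apply, norm_circDiagInv_mul]; exact hB w q p)
    (Z := fun r w => (minusIter a M r w).transpose)
    (fun r p q => isHol_minusIter a hM r q p) (fun r p q => isMinus_minusIter a hM r q p)
    (fun r w p q => by
      simp only [← Matrix.transpose_mul]
      rfl) (ρ := ρ) (by simpa using hρ)
  exact ⟨c, hc, fun r w p q => h r w q p⟩

lemma geomBound_minusCoeff : GeomBound ρ (minusCoeff a M) := by
  have hf := geomBound_plusIter a hν hM hB hρ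
  have hρ0 : 0 < ρ := (hν.nonneg B).trans_lt hρ
  have hB0 : ∀ p q, 0 ≤ B p q := fun p q => (norm_nonneg _).trans (hB 1 p q)
  obtain ⟨c, hc, h⟩ := id hf
  have hsum : ∀ p q, B p q ≤ ∑ p, ∑ q, B p q := fun p q =>
    (Finset.single_le_sum (f := fun q => B p q) (fun q _ => hB0 p q) (Finset.mem_univ q)).trans
      (Finset.single_le_sum (f := fun p => ∑ q, B p q)
        (fun p _ => Finset.sum_nonneg fun q _ => hB0 p q) (Finset.mem_univ p))
  refine GeomBound.of_succ hρ0 hf (K := ∑ p, ∑ q, B p q) (b₀ := ∑ p, ∑ q, B p q + c)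
    (fun w p q => ?_) fun b hb r w hb' p q => ?_
  · refine (norm_add_le _ _).trans (add_le_add ((hB w p q).trans (hsum p q)) ?_)
    simpa using h 0 w p q
  · have h1 : minusCoeff a M (r + 1) w p q - plusIter a M (r + 1) w p q =
        ∑ l, (M * circDiagInv a) w p l * plusIter a M r w l q := by
      rw [minusCoeff, Pi.add_apply, Matrix.add_apply, add_sub_cancel_right, Pi.mul_apply,
        Matrix.mul_apply]
    rw [h1]
    refine (norm_sum_le _ _).trans ?_
    have h2 : ∀ l, ‖(M * circDiagInv a) w p l * plusIter a M r w l q‖ ≤ B p l * b := fun l => by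
      rw [norm_mul, norm_mul_circDiagInv]
      exact mul_le_mul (hB w p l) (hb' l q) (norm_nonneg _) (hB0 p l)
    refine (Finset.sum_le_sum fun l _ => h2 l).trans ?_
    rw [← Finset.sum_mul]
    exact mul_le_mul_of_nonneg_right (Finset.single_le_sum (f := fun p => ∑ q, B p q)
        (fun p _ => Finset.sum_nonneg fun q _ => hB0 p q) (Finset.mem_univ p)) hb

lemma geomBound_plusCoeff : GeomBound ρ (plusCoeff a M) := by
  have hf := geomBound_minusIter a hν hM hB hρ
  have hρ0 : 0 < ρ := (hν.nonneg B).trans_lt hρ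
  have hB0 : ∀ p q, 0 ≤ B p q := fun p q => (norm_nonneg _).trans (hB 1 p q)
  obtain ⟨c, hc, h⟩ := id hf
  have hsum : ∀ p q, B p q ≤ ∑ p, ∑ q, B p q := fun p q =>
    (Finset.single_le_sum (f := fun q => B p q) (fun q _ => hB0 p q) (Finset.mem_univ q)).trans
      (Finset.single_le_sum (f := fun p => ∑ q, B p q)
        (fun p _ => Finset.sum_nonneg fun q _ => hB0 p q) (Finset.mem_univ p))
  refine GeomBound.of_succ hρ0 hf (K := n * ∑ p, ∑ q, B p q) (b₀ := ∑ p, ∑ q, B p q + c)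
    (fun w p q => ?_) fun b hb r w hb' p q => ?_
  · refine (norm_add_le _ _).trans (add_le_add ((hB w p q).trans (hsum p q)) ?_)
    simpa using h 0 w p q
  · have h1 : plusCoeff a M (r + 1) w p q - minusIter a M (r + 1) w p q =
        ∑ l, minusIter a M r w p l * (circDiagInv a * M) w l q := by
      rw [plusCoeff, Pi.add_apply, Matrix.add_apply, add_sub_cancel_right, Pi.mul_apply,
        Matrix.mul_apply]
    rw [h1]
    refine (norm_sum_le _ _).trans ?_
    have h2 : ∀ l, ‖minusIter a M r w p l * (circDiagInv a * M) w l q‖ ≤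
        (∑ p, ∑ q, B p q) * b := fun l => by
      rw [norm_mul, norm_circDiagInv_mul, mul_comm]
      exact mul_le_mul ((hB w l q).trans (hsum l q)) (hb' p l) (norm_nonneg _)
        ((hB0 p q).trans (hsum p q))
    refine (Finset.sum_le_sum fun l _ => h2 l).trans_eq ?_
    simp [mul_assoc]

end Bounds

/-! ### Evaluation of formal power series -/

section Evaluation

open PowerSeries

/-- Absolute convergence at `ε`, entrywise and uniformly on the circle. -/
def AbsConv (ε : ℂ) (f : PowerSeries (CircMat n)) : Prop :=
  ∀ p q, ∃ b : ℕ → ℝ, Summable b ∧ ∀ r w, ‖ε ^ r * coeff r f w p q‖ ≤ b r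

/-- The sum of a formal power series at `ε`. -/
def evalSeries (ε : ℂ) (f : PowerSeries (CircMat n)) : CircMat n := fun w =>
  Matrix.of fun p q => ∑' r, ε ^ r * coeff r f w p q

variable {ε : ℂ} {f g : PowerSeries (CircMat n)}

lemma AbsConv.summable_norm (hf : AbsConv ε f) (w : Circle) (p q : Fin n) :
    Summable fun r => ‖ε ^ r * coeff r f w p q‖ := by
  obtain ⟨b, hb, h⟩ := hf p q
  exact hb.of_nonneg_of_le (fun r => norm_nonneg _) fun r => h r w

lemma absConv_one_add_shiftSeries {ρ : ℝ} (hρ : 0 < ρ) (hε : ‖ε‖ * ρ < 1) {F : ℕ → CircMat n}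
    (hF : GeomBound ρ F) : AbsConv ε (1 + shiftSeries F) := by
  obtain ⟨c, hc, h⟩ := hF
  -- The `1` covers the constant coefficient, and `c / ρ` compensates for the shift of the index by
  -- one.
  refine fun p q => ⟨fun r => (1 + c / ρ) * (‖ε‖ * ρ) ^ r,
    (summable_geometric_of_lt_one (by positivity) hε).mul_left _, fun r w => ?_⟩
  cases r with
  | zero =>
    change _ ≤ (1 + c / ρ) * (‖ε‖ * ρ) ^ 0
    rw [map_add, coeff_zero_shiftSeries, add_zero, coeff_zero_one, pow_zero, pow_zero, one_mul,
      mul_one, Pi.one_apply, Matrix.one_apply]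
    have : 0 ≤ c / ρ := by positivity
    split_ifs
    · rw [norm_one]; linarith
    · rw [norm_zero]; linarith
  | succ r =>
    change _ ≤ (1 + c / ρ) * (‖ε‖ * ρ) ^ (r + 1)
    rw [map_add, coeff_succ_shiftSeries, coeff_one, if_neg (Nat.succ_ne_zero r), zero_add,
      norm_mul, norm_pow, mul_pow, pow_succ ρ]
    have h1 := mul_le_mul_of_nonneg_left (h r w p q) (by positivity : 0 ≤ ‖ε‖ ^ (r + 1))
    have h2 : 0 ≤ ‖ε‖ ^ (r + 1) * (ρ ^ r * ρ) := by positivity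
    have h3 : c / ρ * (‖ε‖ ^ (r + 1) * (ρ ^ r * ρ)) = ‖ε‖ ^ (r + 1) * (c * ρ ^ r) := by field_simp
    rw [add_mul, h3]
    linarith

lemma hasSum_evalSeries_C (A : CircMat n) (w : Circle) (p q : Fin n) :
    HasSum (fun r => ε ^ r * coeff r (C A : PowerSeries (CircMat n)) w p q) (A w p q) := by
  have h := hasSum_single (f := fun r => ε ^ r * coeff r (C A : PowerSeries (CircMat n)) w p q) 0
    fun r hr => by simp [coeff_C, hr]
  simpa using h

lemma summable_norm_C (A : CircMat n) (w : Circle) (p q : Fin n) :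
    Summable fun r => ‖ε ^ r * coeff r (C A : PowerSeries (CircMat n)) w p q‖ :=
  (hasSum_evalSeries_C A w p q).summable.norm

lemma evalSeries_C (A : CircMat n) : evalSeries ε (C A : PowerSeries (CircMat n)) = A := by
  ext w p q
  exact (hasSum_evalSeries_C A w p q).tsum_eq

lemma evalSeries_one : evalSeries ε (1 : PowerSeries (CircMat n)) = 1 := by
  rw [← map_one C, evalSeries_C]

lemma evalSeries_C_add_X_mul_C (A A' : CircMat n) :
    evalSeries ε (C A + X * C A' : PowerSeries (CircMat n)) = A + ε • A' := by
  ext w p q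
  have h : HasSum (fun r => ε ^ r * coeff r (X * C A' : PowerSeries (CircMat n)) w p q)
      (ε * A' w p q) := by
    have h := hasSum_single
      (f := fun r => ε ^ r * coeff r (X * C A' : PowerSeries (CircMat n)) w p q) 1
      fun r hr => by
        cases r with
        | zero => simp
        | succ r =>
          have : r ≠ 0 := by omega
          rw [coeff_succ_X_mul, coeff_C, if_neg this, Pi.zero_apply, Matrix.zero_apply, mul_zero]
    rwa [pow_one, show 1 = 0 + 1 from rfl, coeff_succ_X_mul, coeff_zero_C] at h
  have h2 := ((hasSum_evalSeries_C (ε := ε) A w p q).add h).tsum_eq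
  simp only [← mul_add] at h2
  exact h2

lemma coeff_mul_entry (ε : ℂ) (f g : PowerSeries (CircMat n)) (r : ℕ) (w : Circle) (p q : Fin n) :
    ε ^ r * coeff r (f * g) w p q = ∑ l, ∑ i ∈ Finset.HasAntidiagonal.antidiagonal r,
      (ε ^ i.1 * coeff i.1 f w p l) * (ε ^ i.2 * coeff i.2 g w l q) := by
  rw [coeff_mul, Finset.sum_comm, Finset.sum_apply, Matrix.sum_apply, Finset.mul_sum]
  refine Finset.sum_congr rfl fun i hi => ?_
  rw [Pi.mul_apply, Matrix.mul_apply, Finset.mul_sum]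
  refine Finset.sum_congr rfl fun l _ => ?_
  rw [← Finset.HasAntidiagonal.mem_antidiagonal.1 hi, pow_add]
  ring

lemma summable_norm_mul_entry
    (hf : ∀ w p q, Summable fun r => ‖ε ^ r * coeff r f w p q‖)
    (hg : ∀ w p q, Summable fun r => ‖ε ^ r * coeff r g w p q‖) (w : Circle) (p q : Fin n) :
    Summable fun r => ‖ε ^ r * coeff r (f * g) w p q‖ := by
  simp only [coeff_mul_entry]
  exact (summable_sum fun l _ => (summable_norm_sum_mul_antidiagonal_of_summable_norm
    (hf w p l) (hg w l q)).of_norm).norm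

lemma evalSeries_mul
    (hf : ∀ w p q, Summable fun r => ‖ε ^ r * coeff r f w p q‖)
    (hg : ∀ w p q, Summable fun r => ‖ε ^ r * coeff r g w p q‖) :
    evalSeries ε (f * g) = evalSeries ε f * evalSeries ε g := by
  ext w p q
  simp only [evalSeries, Matrix.of_apply, Pi.mul_apply, Matrix.mul_apply, coeff_mul_entry]
  rw [Summable.tsum_finsetSum fun l _ => (summable_norm_sum_mul_antidiagonal_of_summable_norm
    (hf w p l) (hg w l q)).of_norm]
  refine Finset.sum_congr rfl fun l _ => ?_
  exact (tsum_mul_tsum_eq_tsum_sum_antidiagonal_of_summable_norm (hf w p l) (hg w l q)).symm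

lemma isPlus_evalSeries (hf : AbsConv ε f) (h : ∀ r, Entrywise IsPlus (coeff r f)) :
    Entrywise IsPlus (evalSeries ε f) := fun p q => by
  obtain ⟨b, hb, hb'⟩ := hf p q
  exact isPlus_tsum (fun r => (isPlus_const (ε ^ r)).mul (h r p q)) hb hb'

lemma isMinus_evalSeries (hf : AbsConv ε f) (h : ∀ r, Entrywise IsMinus (coeff r f)) :
    Entrywise IsMinus (evalSeries ε f) := fun p q => by
  obtain ⟨b, hb, hb'⟩ := hf p q
  exact isPlus_tsum (fun r => (isPlus_const (ε ^ r)).mul (h r p q)) hb fun r w => hb' r w⁻¹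

lemma entrywise_one_add_shiftSeries {Q : (Circle → ℂ) → Prop} (h0 : ∀ c : ℂ, Q fun _ => c)
    (hadd : ∀ f g : Circle → ℂ, Q f → Q g → Q fun w => f w + g w) {F : ℕ → CircMat n}
    (hF : ∀ r, Entrywise Q (F r)) (r : ℕ) : Entrywise Q (coeff r (1 + shiftSeries F)) :=
  fun p q => by
    have h1 : Q fun w => (coeff r (1 : PowerSeries (CircMat n))) w p q := by
      rw [coeff_one]
      split_ifs
      · exact h0 ((1 : Matrix (Fin n) (Fin n) ℂ) p q)
      · exact h0 0
    rw [map_add]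
    exact hadd _ _ h1 (entrywise_shiftSeries (h0 0) hF r p q)

lemma evalSeries_one_add_shiftSeries {F : ℕ → CircMat n} (hF : AbsConv ε (1 + shiftSeries F))
    (w : Circle) (p q : Fin n) :
    (Summable fun r => ε ^ (r + 1) * F r w p q) ∧ evalSeries ε (1 + shiftSeries F) w p q =
      (1 : Matrix (Fin n) (Fin n) ℂ) p q + ∑' r, ε ^ (r + 1) * F r w p q := by
  obtain ⟨G, hG⟩ : ∃ G : ℕ → ℂ, ∀ r, G r = ε ^ r * (coeff r (1 + shiftSeries F) : CircMat n) w p q :=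
    ⟨_, fun _ => rfl⟩
  have h1 : Summable G := by
    have := (hF.summable_norm w p q).of_norm
    exact this.congr fun r => (hG r).symm
  have h0 : G 0 = (1 : Matrix (Fin n) (Fin n) ℂ) p q := by
    rw [hG, map_add, coeff_zero_shiftSeries, add_zero, coeff_zero_one, pow_zero, one_mul,
      Pi.one_apply]
  have h2 : ∀ r, ε ^ (r + 1) * F r w p q = G (r + 1) := fun r => by
    rw [hG, map_add, coeff_succ_shiftSeries, coeff_one, if_neg (Nat.succ_ne_zero r), zero_add]
  have h3 : evalSeries ε (1 + shiftSeries F) w p q = ∑' r, G r := tsum_congr fun r => (hG r).symm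
  simp only [h2]
  exact ⟨(summable_nat_add_iff (f := G) 1).2 h1, by rw [h3, h1.tsum_eq_zero_add, h0]⟩

end Evaluation

/-! ### Factorization on the circle -/

/-- The growth lemmas need a rate strictly above `ν B`; the strict inequality leaves room for one.
-/
lemma exists_rate {ν : Matrix (Fin n) (Fin n) ℝ → ℝ} (hν : IsMonotoneMatrixNorm ν)
    {B : Matrix (Fin n) (Fin n) ℝ} {ε : ℂ} (hε : ‖ε‖ * ν B < 1) :
    ∃ ρ : ℝ, ν B < ρ ∧ 0 < ρ ∧ ‖ε‖ * ρ < 1 := by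
  have h0 := hν.nonneg B
  have h1 : Tendsto (fun ρ : ℝ => ‖ε‖ * ρ) (𝓝[>] (ν B)) (𝓝 (‖ε‖ * ν B)) :=
    (continuous_const.mul continuous_id).continuousWithinAt
  obtain ⟨ρ, h2, h3⟩ := ((h1.eventually (gt_mem_nhds hε)).and self_mem_nhdsWithin).exists
  exact ⟨ρ, h3, h0.trans_lt h3, h2⟩

section Factorization

variable (a : Fin n → Prop) [DecidablePred a] {ν : Matrix (Fin n) (Fin n) ℝ → ℝ}
  (hν : IsMonotoneMatrixNorm ν) {M : CircMat n}
  (hM : Entrywise IsHol M) {B : Matrix (Fin n) (Fin n) ℝ} (hB : ∀ w p q, ‖M w p q‖ ≤ B p q)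
  {ε : ℂ} (hε : ‖ε‖ * ν B < 1)
include hν hM hB hε

lemma absConv_series : AbsConv ε (seriesU a M) ∧ AbsConv ε (seriesV a M) ∧
    AbsConv ε (seriesQ a M) ∧ AbsConv ε (seriesY a M) := by
  obtain ⟨ρ, h1, h2, h3⟩ := exists_rate hν hε
  exact ⟨absConv_one_add_shiftSeries h2 h3 ((geomBound_minusIter a hν hM hB h1).mul_circDiagInv a),
    absConv_one_add_shiftSeries h2 h3 ((geomBound_minusCoeff a hν hM hB h1).mul_circDiagInv a),
    absConv_one_add_shiftSeries h2 h3 ((geomBound_plusCoeff a hν hM hB h1).circDiagInv_mul a),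
    absConv_one_add_shiftSeries h2 h3 ((geomBound_plusIter a hν hM hB h1).circDiagInv_mul a)⟩

theorem minus_factor : Entrywise IsMinus (evalSeries ε (seriesV a M)) ∧
    ∃ U : CircMat n, Entrywise IsMinus U ∧ evalSeries ε (seriesV a M) * U = 1 := by
  obtain ⟨hU, hV, -, -⟩ := absConv_series a hν hM hB hε
  refine ⟨isMinus_evalSeries hV (entrywise_one_add_shiftSeries isMinus_const (fun _ _ => IsMinus.add)
      fun r => (isMinus_minusCoeff a hM r).mul_isMinus (isMinus_circDiagInv a)),
    evalSeries ε (seriesU a M), isMinus_evalSeries hU (entrywise_one_add_shiftSeries isMinus_const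
      (fun _ _ => IsMinus.add)
      fun r => (isMinus_minusIter a hM r).mul_isMinus (isMinus_circDiagInv a)), ?_⟩
  rw [← evalSeries_mul hV.summable_norm hU.summable_norm, seriesV_mul_seriesU a hM, evalSeries_one]

theorem plus_factor : Entrywise IsPlus (evalSeries ε (seriesQ a M)) ∧
    ∃ Y : CircMat n, Entrywise IsPlus Y ∧ evalSeries ε (seriesQ a M) * Y = 1 := by
  obtain ⟨-, -, hQ, hY⟩ := absConv_series a hν hM hB hε
  refine ⟨isPlus_evalSeries hQ (entrywise_one_add_shiftSeries isPlus_const (fun _ _ => IsPlus.add)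
      fun r => isPlus_circDiagInv_mul a (isPlusZero_plusCoeff a hM r)),
    evalSeries ε (seriesY a M), isPlus_evalSeries hY (entrywise_one_add_shiftSeries isPlus_const
      (fun _ _ => IsPlus.add)
      fun r => isPlus_circDiagInv_mul a (isPlusZero_plusIter a hM r)), ?_⟩
  rw [← evalSeries_mul hQ.summable_norm hY.summable_norm, seriesQ_mul_seriesY a hM, evalSeries_one]

/-- Absolute convergence allows Cauchy products to be evaluated factor by factor, so the formal
identity holds at `ε`. -/
theorem circle_factorization :
    evalSeries ε (seriesV a M) * circDiag a * evalSeries ε (seriesQ a M) = circDiag a + ε • M := by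
  obtain ⟨-, hV, hQ, -⟩ := absConv_series a hν hM hB hε
  rw [← evalSeries_C_add_X_mul_C, ← formal_factorization a hM, evalSeries_mul
    (summable_norm_mul_entry hV.summable_norm (summable_norm_C _)) hQ.summable_norm,
    evalSeries_mul hV.summable_norm (summable_norm_C _), evalSeries_C]

end Factorization

/-! ### The real line and the circle -/

/-- The Cayley transform as a map to the circle. -/
def cay (x : ℝ) : Circle := -Circle.exp (2 * Real.arctan x)

lemma ofReal_add_I_ne_zero (x : ℝ) : (x : ℂ) + I ≠ 0 := fun h => by
  simpa using congrArg Complex.im h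

lemma ofReal_sub_I_ne_zero (x : ℝ) : (x : ℂ) - I ≠ 0 := fun h => by
  simpa using congrArg Complex.im h

lemma coe_cay (x : ℝ) : (cay x : ℂ) = cayley x := by
  have h1 : ((1 : ℂ) + x ^ 2) ≠ 0 := by
    have : (1 : ℝ) + x ^ 2 ≠ 0 := by positivity
    exact_mod_cast this
  have h2 : (Real.cos (Real.arctan x) : ℂ) ^ 2 = 1 / (1 + x ^ 2) := by
    rw [← ofReal_pow, Real.cos_sq_arctan]
    push_cast
    rfl
  have h3 : (Real.sin (Real.arctan x) : ℂ) = x * Real.cos (Real.arctan x) := by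
    have h4 := Real.tan_mul_cos (Real.cos_arctan_pos x).ne'
    rw [Real.tan_arctan] at h4
    rw [← h4, ofReal_mul]
  rw [cay, Circle.coe_neg, two_mul, Circle.exp_add, Circle.coe_mul, Circle.coe_exp,
    Complex.exp_mul_I, ← ofReal_cos, ← ofReal_sin, h3, cayley, eq_div_iff (ofReal_add_I_ne_zero x)]
  have h5 : -(((Real.cos (Real.arctan x) : ℂ) + x * Real.cos (Real.arctan x) * I) *
      ((Real.cos (Real.arctan x) : ℂ) + x * Real.cos (Real.arctan x) * I)) * (x + I) =
      -((Real.cos (Real.arctan x) : ℂ) ^ 2 * ((1 + x * I) ^ 2 * (x + I))) := by ring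
  have h6 : ((1 : ℂ) + x * I) ^ 2 * (x + I) = -((1 + (x : ℂ) ^ 2) * (x - I)) := by
    linear_combination (2 * (x : ℂ) + x ^ 3 + x ^ 2 * I) * I_sq
  rw [h5, h2, h6, mul_neg, neg_neg, one_div, inv_mul_cancel_left₀ h1]

lemma cay_sub_cay (x y : ℝ) :
    (cay x : ℂ) - cay y = 2 * I * (x - y) / ((x + I) * (y + I)) := by
  have := ofReal_add_I_ne_zero x
  have := ofReal_add_I_ne_zero y
  rw [coe_cay, coe_cay, cayley, cayley]
  field_simp
  ring

/-- This identifies Hölder continuity on the extended line with Hölder continuity along chords of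
the circle. -/
lemma extDist_eq (x y : ℝ) : extDist x y = ‖(cay x : ℂ) - cay y‖ / 2 := by
  have h1 := ofReal_add_I_ne_zero x
  have h2 := ofReal_add_I_ne_zero y
  have h3 : 1 / ((x : ℂ) + I) - 1 / ((y : ℂ) + I) = ((cay x : ℂ) - cay y) * (-(1 / (2 * I))) := by
    rw [cay_sub_cay]
    field_simp
    ring
  rw [extDist, h3, norm_mul, norm_neg, norm_div, norm_mul, norm_I, norm_one, Complex.norm_ofNat]
  ring

/-- Reflection of the line is inversion on the circle; statements about the lower half-plane are
obtained from the upper one through this. -/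
lemma cay_neg (x : ℝ) : cay (-x) = (cay x)⁻¹ := by
  rw [cay, cay, Real.arctan_neg, mul_neg, Circle.exp_neg, inv_neg]

/-- The inverse Cayley transform. -/
def uncay (w : Circle) : ℝ := Real.tan (arg ((-w : Circle) : ℂ) / 2)

lemma uncay_cay (x : ℝ) : uncay (cay x) = x := by
  have h1 := Real.neg_pi_div_two_lt_arctan x
  have h2 := Real.arctan_lt_pi_div_two x
  rw [uncay, cay, neg_neg, Circle.arg_exp (by linarith) (by linarith),
    mul_div_cancel_left₀ _ two_ne_zero, Real.tan_arctan]

lemma cay_uncay {w : Circle} (hw : w ≠ 1) : cay (uncay w) = w := by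
  have h1 := neg_pi_lt_arg ((-w : Circle) : ℂ)
  have h2 := arg_le_pi ((-w : Circle) : ℂ)
  have h3 : arg ((-w : Circle) : ℂ) ≠ Real.pi := fun h => hw (by
    have h4 := Circle.exp_arg (-w)
    have h5 : Circle.exp Real.pi = -1 := by
      ext; rw [Circle.coe_exp, exp_pi_mul_I, Circle.coe_neg, Circle.coe_one]
    rw [h, h5] at h4
    exact (neg_injective h4).symm)
  have h4 := lt_of_le_of_ne h2 h3
  rw [cay, uncay, Real.arctan_tan (by linarith) (by linarith), mul_div_cancel₀ _ two_ne_zero,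
    Circle.exp_arg, neg_neg]

lemma cay_ne_one (x : ℝ) : cay x ≠ 1 := fun h => by
  have h1 := coe_cay x
  have h2 := ofReal_add_I_ne_zero x
  rw [h, Circle.coe_one, cayley, eq_div_iff h2, one_mul] at h1
  have h3 := congrArg Complex.im h1
  norm_num at h3

lemma tendsto_cay_atTop : Tendsto (fun x => (cay x : ℂ)) atTop (𝓝 1) := by
  have h1 : Tendsto (fun x => 2 * Real.arctan x) atTop (𝓝 (2 * (Real.pi / 2))) :=
    (Real.tendsto_arctan_atTop.mono_right nhdsWithin_le_nhds).const_mul 2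
  rw [mul_div_cancel₀ _ two_ne_zero] at h1
  have h2 : Continuous fun t : ℝ => -(Circle.exp t : ℂ) := by fun_prop
  have h3 := (h2.tendsto Real.pi).comp h1
  rw [Circle.coe_exp, exp_pi_mul_I, neg_neg] at h3
  exact h3

/-- The extension of a function on the line to the circle, with the value `0` at infinity. -/
def toCircle (f : ℝ → ℂ) (w : Circle) : ℂ := by
  classical exact if w = 1 then 0 else f (uncay w)

lemma toCircle_cay (f : ℝ → ℂ) (x : ℝ) : toCircle f (cay x) = f x := by
  rw [toCircle, if_neg (cay_ne_one x), uncay_cay]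

lemma toCircle_one (f : ℝ → ℂ) : toCircle f 1 = 0 := by
  rw [toCircle, if_pos rfl]

lemma isHol_toCircle {μ : ℝ} (hμ : 0 < μ) {f : ℝ → ℂ} (hf : IsHolderZero μ f) :
    IsHol (toCircle f) := by
  obtain ⟨⟨C, hC⟩, h0⟩ := hf
  -- The Hölder estimate between `x` and infinity, by letting the second point tend to infinity;
  -- decay of `f` makes `0` the right value at `1`.
  have key : ∀ x : ℝ, ‖f x‖ ≤ C * (‖(cay x : ℂ) - 1‖ / 2) ^ μ := fun x => by
    have h1 : Tendsto (fun y => ‖f x - f y‖) atTop (𝓝 ‖f x - 0‖) :=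
      ((h0.mono_left atTop_le_cocompact).const_sub (f x)).norm
    rw [sub_zero] at h1
    have h2 : Tendsto (fun y => C * extDist x y ^ μ) atTop (𝓝 (C * (‖(cay x : ℂ) - 1‖ / 2) ^ μ)) := by
      simp only [extDist_eq]
      refine Tendsto.const_mul _ (Tendsto.rpow_const ?_ (Or.inr hμ.le))
      exact ((tendsto_cay_atTop.const_sub _).norm).div_const 2
    exact le_of_tendsto_of_tendsto' h1 h2 fun y => hC x y
  have key2 : ∀ a b : Circle, ‖toCircle f a - toCircle f b‖ ≤ C * (‖(a : ℂ) - b‖ / 2) ^ μ := by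
    intro a b
    by_cases ha : a = 1 <;> by_cases hb : b = 1
    · rw [ha, hb, sub_self, sub_self, norm_zero, zero_div, Real.zero_rpow hμ.ne', mul_zero]
    · rw [ha, toCircle_one, ← cay_uncay hb, toCircle_cay, zero_sub, norm_neg, norm_sub_rev]
      exact key _
    · rw [hb, toCircle_one, ← cay_uncay ha, toCircle_cay, sub_zero]
      exact key _
    · rw [← cay_uncay ha, ← cay_uncay hb, toCircle_cay, toCircle_cay, ← extDist_eq]
      exact hC _ _
  refine isHol_of_bound (C := C / 2 ^ μ) hμ fun a b => (key2 a b).trans_eq ?_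
  rw [Real.div_rpow (norm_nonneg _) zero_le_two]
  ring

/-! ### Change of variables -/

lemma integrable_arc_mul_left {h : Circle → ℂ} (hi : Integrable (fun t => h (Circle.exp t)) arc)
    (c : Circle) : Integrable (fun t => h (c * Circle.exp t)) arc := by
  have hpi := Real.pi_pos
  have hne : ENNReal.ofReal (2 * Real.pi)⁻¹ ≠ 0 := by
    simp only [ne_eq, ENNReal.ofReal_eq_zero, not_le]
    positivity
  rw [arc, integrable_smul_measure hne ENNReal.ofReal_ne_top] at hi ⊢
  have hp : Function.Periodic (fun t => h (Circle.exp t)) (2 * Real.pi) := fun t => by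
    simp only [Circle.exp_add_two_pi]
  obtain ⟨a, rfl⟩ := Circle.exp_surjective c
  have h1 : IntervalIntegrable (fun t => h (Circle.exp t)) volume (-Real.pi)
      (-Real.pi + 2 * Real.pi) := by
    rw [intervalIntegrable_iff_integrableOn_Ioc_of_le (by linarith)]
    rwa [show -Real.pi + 2 * Real.pi = Real.pi by ring]
  have h2 := (hp.intervalIntegrable (by positivity) h1 (a + -Real.pi) (a + Real.pi)).comp_add_left a
  simp only [add_sub_cancel_left] at h2
  rw [intervalIntegrable_iff_integrableOn_Ioc_of_le (by linarith)] at h2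
  simp only [Circle.exp_add] at h2
  exact h2

lemma image_two_arctan : (fun x => 2 * Real.arctan x) '' univ = Ioo (-Real.pi) Real.pi := by
  ext y
  simp only [image_univ, mem_range, mem_Ioo]
  constructor
  · rintro ⟨x, rfl⟩
    have h1 := Real.neg_pi_div_two_lt_arctan x
    have h2 := Real.arctan_lt_pi_div_two x
    constructor <;> linarith
  · rintro ⟨h1, h2⟩
    exact ⟨Real.tan (y / 2), by rw [Real.arctan_tan (by linarith) (by linarith)]; ring⟩

lemma hasDerivAt_two_arctan (x : ℝ) :
    HasDerivAt (fun x => 2 * Real.arctan x) (2 * (1 + x ^ 2)⁻¹) x :=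
  (Real.hasDerivAt_arctan' x).const_mul 2

lemma injOn_two_arctan : InjOn (fun x => 2 * Real.arctan x) univ := fun _ _ _ _ h =>
  Real.arctan_injective (mul_left_cancel₀ two_ne_zero h)

/-- The angle is `2 arctan x`, with derivative `2 / (1 + x²)`; the sign in `cay` is absorbed by
rotation invariance. -/
lemma integral_arc_eq_integral_real (h : Circle → ℂ) :
    ∫ t, h (Circle.exp t) ∂arc = (Real.pi : ℂ)⁻¹ * ∫ x : ℝ, ((1 + x ^ 2)⁻¹ : ℝ) * h (cay x) := by
  have hpi := Real.pi_pos
  rw [← integral_arc_mul_left h (-1), integral_arc, intervalIntegral.integral_of_le (by linarith),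
    integral_Ioc_eq_integral_Ioo, ← image_two_arctan, integral_image_eq_integral_abs_deriv_smul
      MeasurableSet.univ (fun x _ => (hasDerivAt_two_arctan x).hasDerivWithinAt) injOn_two_arctan,
    setIntegral_univ]
  have h1 : ∀ x : ℝ, |2 * (1 + x ^ 2)⁻¹| • h (-1 * Circle.exp (2 * Real.arctan x)) =
      2 * (((1 + x ^ 2)⁻¹ : ℝ) * h (cay x)) := fun x => by
    rw [abs_of_nonneg (by positivity), real_smul, neg_one_mul, cay]
    push_cast
    ring
  simp only [h1]
  rw [integral_const_mul, real_smul]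
  push_cast
  field_simp

lemma integrable_real_of_integrable_arc {h : Circle → ℂ}
    (hi : Integrable (fun t => h (Circle.exp t)) arc) :
    Integrable fun x : ℝ => ((1 + x ^ 2)⁻¹ : ℝ) * h (cay x) := by
  have hpi := Real.pi_pos
  have hne : ENNReal.ofReal (2 * Real.pi)⁻¹ ≠ 0 := by
    simp only [ne_eq, ENNReal.ofReal_eq_zero, not_le]
    positivity
  have h1 := integrable_arc_mul_left hi (-1)
  rw [arc, integrable_smul_measure hne ENNReal.ofReal_ne_top] at h1
  have h2 : IntegrableOn (fun t => h (-1 * Circle.exp t)) (Ioo (-Real.pi) Real.pi) :=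
    IntegrableOn.mono_set h1 Ioo_subset_Ioc_self
  rw [← image_two_arctan, integrableOn_image_iff_integrableOn_abs_deriv_smul
    MeasurableSet.univ (fun x _ => (hasDerivAt_two_arctan x).hasDerivWithinAt) injOn_two_arctan,
    integrableOn_univ] at h2
  refine (h2.const_mul (1 / 2)).congr (Eventually.of_forall fun x => ?_)
  simp only
  rw [abs_of_nonneg (by positivity), real_smul, neg_one_mul, cay]
  push_cast
  ring

/-! ### The singular integral on the line -/

lemma measurableSet_lt_abs_sub (δ x : ℝ) : MeasurableSet {t : ℝ | δ < |t - x|} :=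
  measurableSet_lt measurable_const (by fun_prop)

lemma tendsto_integral_lt_abs_sub {g : ℝ → ℂ} (hg : Integrable g) (x : ℝ) :
    Tendsto (fun δ : ℝ => ∫ t in {t : ℝ | δ < |t - x|}, g t) (𝓝[>] 0) (𝓝 (∫ t, g t)) := by
  simp only [← integral_indicator (measurableSet_lt_abs_sub _ x)]
  refine tendsto_integral_filter_of_dominated_convergence (fun t => ‖g t‖)
    (Eventually.of_forall fun δ =>
      (hg.indicator (measurableSet_lt_abs_sub δ x)).aestronglyMeasurable)
    (Eventually.of_forall fun δ => Eventually.of_forall fun t => norm_indicator_le_norm_self _ _)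
    hg.norm ?_
  have h1 : ∀ᵐ t : ℝ, t ≠ x := by
    rw [ae_iff]
    simp
  filter_upwards [h1] with t ht
  refine tendsto_const_nhds.congr' ?_
  have h2 : 0 < |t - x| := abs_pos.mpr (sub_ne_zero.mpr ht)
  filter_upwards [nhdsWithin_le_nhds (Iio_mem_nhds h2)] with δ hδ
  rw [indicator_of_mem (by exact hδ)]

/-! ### The principal value of the bare kernel -/

lemma normSq_ofReal_sub_I (t : ℝ) : ‖(t : ℂ) - I‖ ^ 2 = 1 + t ^ 2 := by
  rw [Complex.sq_norm, Complex.normSq_apply]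
  simp
  ring

lemma normSq_ofReal_add_I (t : ℝ) : ‖(t : ℂ) + I‖ ^ 2 = 1 + t ^ 2 := by
  rw [Complex.sq_norm, Complex.normSq_apply]
  simp
  ring

lemma norm_one_div_mul_le (a b : ℂ) :
    ‖1 / (a * b)‖ ≤ 1 / 2 * ((‖a‖ ^ 2)⁻¹ + (‖b‖ ^ 2)⁻¹) := by
  rw [norm_div, norm_one, norm_mul, one_div, mul_inv, ← inv_pow, ← inv_pow]
  nlinarith [sq_nonneg (‖a‖⁻¹ - ‖b‖⁻¹)]

lemma integrable_inv_one_add_sub_sq (x : ℝ) : Integrable fun u : ℝ => (1 + (u - x) ^ 2)⁻¹ :=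
  integrable_inv_one_add_sq.comp_sub_right x

lemma integrable_one_div_sq_sub_sq (x : ℝ) :
    Integrable fun u : ℝ => 1 / ((((u - x : ℝ) : ℂ) + I) * (((u + x : ℝ) : ℂ) - I)) := by
  have h1 := (integrable_inv_one_add_sub_sq x).add (integrable_inv_one_add_sub_sq (-x))
  refine (h1.const_mul (1 / 2)).mono' ?_ (Eventually.of_forall fun u => ?_)
  · refine Measurable.aestronglyMeasurable ?_
    fun_prop
  · refine (norm_one_div_mul_le _ _).trans_eq ?_
    rw [normSq_ofReal_add_I, normSq_ofReal_sub_I, Pi.add_apply, sub_neg_eq_add]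

/-- Real primitives in place of a complex logarithm, so no branch has to be chosen; `s` is `I` or
`-I`. -/
lemma hasDerivAt_log_arctan (s : ℂ) (hs : s ^ 2 = -1) (x u : ℝ) :
    HasDerivAt (fun u : ℝ => ((1 / 2 * Real.log (1 + (u - x) ^ 2) : ℝ) : ℂ) -
      s * (Real.arctan (u - x) : ℝ)) (1 / (((u - x : ℝ) : ℂ) + s)) u := by
  have h0 : (1 + (u - x) ^ 2) ≠ 0 := by positivity
  have h1 : HasDerivAt (fun u : ℝ => u - x) 1 u := (hasDerivAt_id u).sub_const x
  have h2 := (((h1.pow 2).const_add 1).log h0).const_mul (1 / 2)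
  have h3 := h1.arctan
  have h4 := h2.ofReal_comp.sub (h3.ofReal_comp.const_mul s)
  refine h4.congr_deriv ?_
  have h5 : (1 : ℂ) + ((u - x : ℝ) : ℂ) ^ 2 ≠ 0 := by exact_mod_cast h0
  have h6 : (((u - x : ℝ) : ℂ) + s) ≠ 0 := fun h => h5 (by
    linear_combination h * (((u - x : ℝ) : ℂ) - s) + hs)
  simp only [Pi.pow_apply]
  push_cast at h5 h6 ⊢
  field_simp
  linear_combination -hs

/-- In the variable `v = 1/u` the quotient of the arguments is continuous at `0` with value `1`;
this treats both ends of the line at once. -/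
lemma tendsto_log_sub_log (x : ℝ) {l : Filter ℝ} (hl : Tendsto (fun u : ℝ => u⁻¹) l (𝓝[≠] 0)) :
    Tendsto (fun u : ℝ => Real.log (1 + (u - x) ^ 2) - Real.log (1 + (u - -x) ^ 2)) l (𝓝 0) := by
  have h1 : ContinuousAt (fun v : ℝ => Real.log ((v ^ 2 + (1 - x * v) ^ 2) /
      (v ^ 2 + (1 + x * v) ^ 2))) 0 := by
    refine ContinuousAt.log (ContinuousAt.div (by fun_prop) (by fun_prop) (by norm_num))
      (by norm_num)
  have h2 := h1.tendsto.comp (hl.mono_right nhdsWithin_le_nhds)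
  norm_num at h2
  refine h2.congr' ?_
  filter_upwards [hl self_mem_nhdsWithin] with u hu
  have hu : u ≠ 0 := fun h => hu (by simp [h])
  have h3 : (0 : ℝ) < 1 + (u - x) ^ 2 := by positivity
  have h4 : (0 : ℝ) < 1 + (u - -x) ^ 2 := by positivity
  rw [← Real.log_div h3.ne' h4.ne']
  simp only [Function.comp]
  congr 1
  have h5 : (u ^ 2)⁻¹ + (1 + x * u⁻¹) ^ 2 ≠ 0 := by positivity
  field_simp
  ring

lemma tendsto_inv_atTop_nhdsNE : Tendsto (fun u : ℝ => u⁻¹) atTop (𝓝[≠] 0) :=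
  tendsto_nhdsWithin_iff.mpr ⟨tendsto_inv_atTop_zero,
    (eventually_gt_atTop 0).mono fun _ hu => inv_ne_zero hu.ne'⟩

lemma tendsto_inv_atBot_nhdsNE : Tendsto (fun u : ℝ => u⁻¹) atBot (𝓝[≠] 0) :=
  tendsto_nhdsWithin_iff.mpr ⟨tendsto_inv_atBot_zero,
    (eventually_lt_atBot 0).mono fun _ hu => inv_ne_zero hu.ne⟩

/-- Partial fractions, with the factor `1 / (2 (x - i))`. At both ends the logarithms cancel and
only the arctangents contribute. -/
lemma integral_one_div_sq_sub_sq (x : ℝ) :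
    ∫ u : ℝ, 1 / ((((u - x : ℝ) : ℂ) + I) * (((u + x : ℝ) : ℂ) - I)) =
      -(Real.pi * I) / ((x : ℂ) - I) := by
  have ha := ofReal_sub_I_ne_zero x
  set Φ : ℝ → ℂ := fun u => 1 / (2 * ((x : ℂ) - I)) *
    ((((1 / 2 * Real.log (1 + (u - x) ^ 2) : ℝ) : ℂ) - I * (Real.arctan (u - x) : ℝ)) -
      (((1 / 2 * Real.log (1 + (u - -x) ^ 2) : ℝ) : ℂ) - -I * (Real.arctan (u - -x) : ℝ))) with hΦ
  have hd : ∀ u, HasDerivAt Φ (1 / ((((u - x : ℝ) : ℂ) + I) * (((u + x : ℝ) : ℂ) - I))) u :=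
    fun u => by
    have h1 := ((hasDerivAt_log_arctan I I_sq x u).sub
      (hasDerivAt_log_arctan (-I) (by rw [neg_sq, I_sq]) (-x) u)).const_mul
        (1 / (2 * ((x : ℂ) - I)))
    refine h1.congr_deriv ?_
    have h2 := ofReal_add_I_ne_zero (u - x)
    have h3 := ofReal_sub_I_ne_zero (u + x)
    rw [sub_neg_eq_add, ← sub_eq_add_neg]
    field_simp
    push_cast
    ring
  have hlim : ∀ (l : Filter ℝ) (c : ℝ), Tendsto (fun u : ℝ => u⁻¹) l (𝓝[≠] 0) →
      (∀ y : ℝ, Tendsto (fun u => Real.arctan (u - y)) l (𝓝 c)) →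
      Tendsto Φ l (𝓝 (1 / (2 * ((x : ℂ) - I)) * (-(2 * c * I)))) := by
    intro l c hl hc
    have h1 := continuous_ofReal.continuousAt.tendsto.comp ((tendsto_log_sub_log x hl).const_mul (1 / 2))
    have h2 := continuous_ofReal.continuousAt.tendsto.comp ((hc x).add (hc (-x)))
    have h3 := (h1.sub (h2.const_mul I)).const_mul (1 / (2 * ((x : ℂ) - I)))
    refine (h3.congr fun u => ?_).trans_eq ?_
    · simp only [hΦ, Function.comp]
      push_cast
      ring
    · congr 1
      push_cast
      ring
  rw [integral_of_hasDerivAt_of_tendsto hd (integrable_one_div_sq_sub_sq x)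
    (hlim atBot (-(Real.pi / 2)) tendsto_inv_atBot_nhdsNE fun y =>
      (Real.tendsto_arctan_atBot.mono_right nhdsWithin_le_nhds).comp
        (tendsto_atBot_add_const_right _ (-y) tendsto_id))
    (hlim atTop (Real.pi / 2) tendsto_inv_atTop_nhdsNE fun y =>
      (Real.tendsto_arctan_atTop.mono_right nhdsWithin_le_nhds).comp
        (tendsto_atTop_add_const_right _ (-y) tendsto_id))]
  push_cast
  field_simp
  ring

lemma integrableOn_kernel {δ : ℝ} (hδ : 0 < δ) (x : ℝ) :
    IntegrableOn (fun t : ℝ => 1 / (((t : ℂ) - I) * ((t : ℂ) - x))) {t : ℝ | δ < |t - x|} := by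
  have h1 := (((integrable_inv_one_add_sub_sq 0).const_mul (1 / 2)).add
    ((integrable_inv_one_add_sub_sq x).const_mul (1 / 2 * (1 + (δ ^ 2)⁻¹))))
  refine h1.integrableOn.mono' ?_ ?_
  · refine Measurable.aestronglyMeasurable ?_
    fun_prop
  · refine (ae_restrict_iff' (measurableSet_lt_abs_sub δ x)).mpr (Eventually.of_forall fun t ht => ?_)
    refine (norm_one_div_mul_le _ _).trans ?_
    have h2 : δ < |t - x| := ht
    have h3 : δ ^ 2 ≤ (t - x) ^ 2 := by
      rw [← sq_abs (t - x)]
      exact pow_le_pow_left₀ hδ.le h2.le 2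
    have h4 : (0 : ℝ) < (t - x) ^ 2 := lt_of_lt_of_le (by positivity) h3
    -- Away from the singularity `(t - x)² ≥ δ²`, so the square may be compared with `1 + (t - x)²`.
    have h5 : ((t - x) ^ 2)⁻¹ ≤ (1 + (δ ^ 2)⁻¹) * (1 + (t - x) ^ 2)⁻¹ := by
      rw [← div_eq_mul_inv, le_div_iff₀ (by positivity), mul_add, mul_one, inv_mul_cancel₀ h4.ne',
        add_comm]
      gcongr
    rw [normSq_ofReal_sub_I, ← ofReal_sub, norm_real, Real.norm_eq_abs, sq_abs, Pi.add_apply,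
      sub_zero]
    linarith

/-- The window is symmetric about `x`, so the kernel may be averaged over `t = x ± u`. The poles at
`u = 0` cancel, and what remains is integrable on the whole line. -/
lemma setIntegral_kernel {δ : ℝ} (hδ : 0 < δ) (x : ℝ) :
    ∫ t in {t : ℝ | δ < |t - x|}, 1 / (((t : ℂ) - I) * ((t : ℂ) - x)) =
      ∫ u in {u : ℝ | δ < |u - 0|}, 1 / ((((u - x : ℝ) : ℂ) + I) * (((u + x : ℝ) : ℂ) - I)) := by
  have h1 := (integrable_indicator_iff (measurableSet_lt_abs_sub δ x)).mpr (integrableOn_kernel hδ x)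
  rw [← integral_indicator (measurableSet_lt_abs_sub _ _),
    ← integral_indicator (measurableSet_lt_abs_sub _ _)]
  set K : ℝ → ℂ := {t : ℝ | δ < |t - x|}.indicator fun t => 1 / (((t : ℂ) - I) * ((t : ℂ) - x))
    with hK
  have h2 : Integrable fun u => K (u + x) := h1.comp_add_right x
  have h3 : Integrable fun u => K (-u + x) := h2.comp_neg
  have h4 : ∫ u, K (u + x) = ∫ t, K t := integral_add_right_eq_self K x
  have h5 : ∫ u, K (-u + x) = ∫ t, K t := by
    rw [← h4]
    exact integral_neg_eq_self (fun u => K (u + x)) volume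
  have h6 : ∫ t, K t = ∫ u, 1 / 2 * (K (u + x) + K (-u + x)) := by
    rw [integral_const_mul, integral_add h2 h3, h4, h5]
    ring
  rw [h6]
  congr 1
  funext u
  have h7 : u + x ∈ {t : ℝ | δ < |t - x|} ↔ u ∈ {u : ℝ | δ < |u - 0|} := by simp
  have h8 : -u + x ∈ {t : ℝ | δ < |t - x|} ↔ u ∈ {u : ℝ | δ < |u - 0|} := by simp
  by_cases hu : u ∈ {u : ℝ | δ < |u - 0|}
  · rw [hK, indicator_of_mem (h7.mpr hu), indicator_of_mem (h8.mpr hu), indicator_of_mem hu]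
    have h9 : (u : ℂ) ≠ 0 := by
      rintro h
      rw [ofReal_eq_zero] at h
      rw [h, mem_ofPred_eq, sub_zero, abs_zero] at hu
      linarith
    have h10 := ofReal_add_I_ne_zero (u - x)
    have h11 := ofReal_sub_I_ne_zero (u + x)
    have h12 := ofReal_sub_I_ne_zero (-u + x)
    push_cast at h10 h11 h12 ⊢
    rw [add_sub_cancel_right, add_sub_cancel_right,
      show -(u : ℂ) + x - I = -(u - x + I) by ring]
    field_simp
    ring
  · rw [hK, indicator_of_notMem (mt h7.mp hu), indicator_of_notMem (mt h8.mp hu),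
      indicator_of_notMem hu, add_zero, mul_zero]

lemma tendsto_setIntegral_kernel (x : ℝ) :
    Tendsto (fun δ : ℝ => ∫ t in {t : ℝ | δ < |t - x|}, 1 / (((t : ℂ) - I) * ((t : ℂ) - x)))
      (𝓝[>] 0) (𝓝 (-(Real.pi * I) / ((x : ℂ) - I))) := by
  rw [← integral_one_div_sq_sub_sq]
  refine (tendsto_integral_lt_abs_sub (integrable_one_div_sq_sub_sq x) 0).congr' ?_
  filter_upwards [self_mem_nhdsWithin] with δ hδ
  rw [setIntegral_kernel hδ]

lemma difference_quotient_eq (f : ℝ → ℂ) (x t : ℝ) :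
    -- The density of arc length times the Cauchy kernel of the circle is the corrected kernel of
    -- the line; the factor `1/(t - i)` comes from here.
    ((1 + t ^ 2)⁻¹ : ℝ) * (((f t - f x) * cay x) / ((cay t : ℂ) - cay x)) =
      ((x : ℂ) - I) / (2 * I) * ((f t - f x) * (1 / (((t : ℂ) - I) * ((t : ℂ) - x)))) := by
  by_cases h : t = x
  · rw [h, sub_self, zero_mul, zero_div, zero_mul, mul_zero, mul_zero]
  · have h1 := ofReal_add_I_ne_zero t
    have h2 := ofReal_add_I_ne_zero x
    have h3 := ofReal_sub_I_ne_zero t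
    have h4 := ofReal_sub_I_ne_zero x
    have h5 : (t : ℂ) - x ≠ 0 := sub_ne_zero.mpr (by exact_mod_cast h)
    have h6 : ((1 + t ^ 2)⁻¹ : ℝ) = 1 / (((t : ℂ) - I) * (t + I)) := by
      have h7 : ((t : ℂ) - I) * (t + I) = 1 + (t : ℂ) ^ 2 := by linear_combination -I_sq
      rw [h7, one_div]
      push_cast
      rfl
    rw [cay_sub_cay, h6, coe_cay, cayley]
    field_simp

/-- Split `f t = (f t - f x) + f x`. The first part is absolutely integrable and gives `2 P₊ g`; the
second has the principal value `-π i f(x) / (x - i)`, which gives `-g`. -/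
theorem S0_comp_cay {g : Circle → ℂ} (hg : IsHol g) (x : ℝ) :
    S0 (fun t => g (cay t)) x = 2 * projPlus g (cay x) - g (cay x) := by
  have hx := ofReal_sub_I_ne_zero x
  have hpi : (Real.pi : ℂ) ≠ 0 := by exact_mod_cast Real.pi_ne_zero
  set f : ℝ → ℂ := fun t => g (cay t) with hf
  set ζ := cay x with hζ
  set h : Circle → ℂ := fun τ => ((g τ - g ζ) * ζ) / ((τ : ℂ) - ζ) with hh
  have h1 : ∀ t : ℝ, h (ζ * Circle.exp t) =
      (g (ζ * Circle.exp t) - g ζ) / ((Circle.exp t : ℂ) - 1) := fun t => by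
    have h2 := Circle.coe_ne_zero ζ
    rw [hh]
    simp only
    rw [Circle.coe_mul, show (ζ : ℂ) * Circle.exp t - ζ = ((Circle.exp t : ℂ) - 1) * ζ by ring,
      mul_div_mul_right _ _ h2]
  have h2 : Integrable (fun t => h (ζ * Circle.exp t)) arc := by
    simp only [h1]
    exact integrable_projPlus hg ζ
  have h3 : Integrable (fun t => h (Circle.exp t)) arc := by
    have := integrable_arc_mul_left (h := fun w => h (ζ * w)) h2 ζ⁻¹
    simpa only [mul_inv_cancel_left] using this
  have h4 : projPlus g ζ = (Real.pi : ℂ)⁻¹ * ∫ t : ℝ, ((1 + t ^ 2)⁻¹ : ℝ) * h (cay t) := by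
    rw [← integral_arc_eq_integral_real, ← integral_arc_mul_left h ζ, projPlus]
    simp only [h1]
  have h5 : ∀ t : ℝ, ((1 + t ^ 2)⁻¹ : ℝ) * h (cay t) =
      ((x : ℂ) - I) / (2 * I) * ((f t - f x) * (1 / (((t : ℂ) - I) * ((t : ℂ) - x)))) :=
    fun t => difference_quotient_eq f x t
  have h6 := integrable_real_of_integrable_arc h3
  simp only [h5] at h6 h4
  have h7 : Integrable fun t : ℝ => (f t - f x) * (1 / (((t : ℂ) - I) * ((t : ℂ) - x))) := by
    refine (h6.const_mul ((2 * I) / ((x : ℂ) - I))).congr (Eventually.of_forall fun t => ?_)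
    simp only
    rw [← mul_assoc, div_mul_div_cancel₀ hx, div_self (by simp), one_mul]
  rw [integral_const_mul] at h4
  have h8 := (tendsto_integral_lt_abs_sub h7 x).add ((tendsto_setIntegral_kernel x).const_mul (f x))
  have h9 : Tendsto (fun δ : ℝ => ∫ t in {t : ℝ | δ < |t - x|},
      f t / (((t : ℂ) - I) * ((t : ℂ) - (x : ℂ)))) (𝓝[>] 0)
      (𝓝 ((∫ t, (f t - f x) * (1 / (((t : ℂ) - I) * ((t : ℂ) - x)))) +
        f x * (-(Real.pi * I) / ((x : ℂ) - I)))) := by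
    refine h8.congr' ?_
    filter_upwards [self_mem_nhdsWithin] with δ hδ
    rw [← integral_const_mul, ← integral_add h7.integrableOn
      ((integrableOn_kernel hδ x).const_mul (f x))]
    congr 1
    funext t
    ring
  rw [S0, h9.limUnder_eq, h4]
  change _ = _ - f x
  field_simp
  ring

/-! ### From the disc to the half-planes -/

lemma closure_upper : closure upper = {z : ℂ | 0 ≤ z.im} := Complex.closure_setOfPred_lt_im 0

lemma closure_lower : closure lower = {z : ℂ | z.im ≤ 0} := Complex.closure_setOfPred_im_lt 0

lemma add_I_ne_zero {z : ℂ} (hz : 0 ≤ z.im) : z + I ≠ 0 := fun h => by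
  have := congrArg Complex.im h
  simp at this
  linarith

lemma norm_sq_add_I_sub (z : ℂ) : ‖z + I‖ ^ 2 - ‖z - I‖ ^ 2 = 4 * z.im := by
  rw [Complex.sq_norm, Complex.sq_norm, Complex.normSq_apply, Complex.normSq_apply]
  simp
  ring

lemma norm_div_add_I_le {z : ℂ} (hz : 0 ≤ z.im) : ‖(z - I) / (z + I)‖ ≤ 1 := by
  rw [norm_div, div_le_one (norm_pos_iff.mpr (add_I_ne_zero hz))]
  refine le_of_sq_le_sq ?_ (norm_nonneg _)
  linarith [norm_sq_add_I_sub z]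

lemma norm_div_add_I_lt {z : ℂ} (hz : 0 < z.im) : ‖(z - I) / (z + I)‖ < 1 := by
  rw [norm_div, div_lt_one (norm_pos_iff.mpr (add_I_ne_zero hz.le))]
  refine lt_of_pow_lt_pow_left₀ 2 (norm_nonneg _) ?_
  linarith [norm_sq_add_I_sub z]

lemma tendsto_cayley_cocompact : Tendsto (fun z : ℂ => (z - I) / (z + I)) (cocompact ℂ) (𝓝 1) := by
  have h1 : Tendsto (fun z : ℂ => z + I) (cocompact ℂ) (cocompact ℂ) :=
    (Homeomorph.addRight I).isClosedEmbedding.tendsto_cocompact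
  have h2 := ((tendsto_inv₀_cobounded' (α := ℂ)).comp
    (by rwa [Metric.cobounded_eq_cocompact] : Tendsto (fun z : ℂ => z + I) (cocompact ℂ) _))
  have h3 := ((h2.mono_right nhdsWithin_le_nhds).const_mul (2 * I)).const_sub 1
  rw [mul_zero, sub_zero] at h3
  refine h3.congr' ?_
  have h4 : ∀ᶠ z : ℂ in cocompact ℂ, z ≠ -I := by
    exact (isCompact_singleton (x := -I)).compl_mem_cocompact
  filter_upwards [h4] with z hz
  have h5 : z + I ≠ 0 := fun h => hz (eq_neg_of_add_eq_zero_left h)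
  simp only [Function.comp]
  field_simp
  ring

lemma isContinuation_upper {M : CircMat n} {E : ℂ → Matrix (Fin n) (Fin n) ℂ}
    (hE : ∀ p q, DiffContOnCl ℂ (fun z => E z p q) (ball 0 1)) (hM : ∀ w : Circle, E w = M w) :
    IsContinuation upper (fun x => M (cay x)) (fun z => E ((z - I) / (z + I))) (E 1) where
  analytic p q := by
    refine (hE p q).differentiableOn.comp (t := ball 0 1) (f := fun z : ℂ => (z - I) / (z + I)) ?_
      fun z hz => mem_ball_zero_iff.mpr (norm_div_add_I_lt hz)
    exact DifferentiableOn.div (by fun_prop) (by fun_prop) fun z hz =>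
      add_I_ne_zero (le_of_lt (show 0 < z.im from hz))
  cont p q := by
    rw [closure_upper]
    refine (hE p q).continuousOn_ball.comp (f := fun z : ℂ => (z - I) / (z + I)) ?_
      fun z hz => mem_closedBall_zero_iff.mpr (norm_div_add_I_le hz)
    exact ContinuousOn.div (by fun_prop) (by fun_prop) fun z hz => add_I_ne_zero hz
  at_infty p q := by
    rw [closure_upper]
    refine ((hE p q).continuousOn_ball 1 (by simp)).tendsto.comp (tendsto_nhdsWithin_iff.mpr
      ⟨tendsto_cayley_cocompact.mono_left inf_le_left, ?_⟩)
    exact mem_inf_of_right fun z hz => mem_closedBall_zero_iff.mpr (norm_div_add_I_le hz)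
  eq_real x := by
    rw [← hM, coe_cay, cayley]

lemma IsContinuation.comp_neg {G : MatFun n} {H : ℂ → Matrix (Fin n) (Fin n) ℂ}
    {L : Matrix (Fin n) (Fin n) ℂ} (h : IsContinuation upper G H L) :
    IsContinuation lower (fun x => G (-x)) (fun z => H (-z)) L := by
  have h1 : MapsTo (fun z : ℂ => -z) (closure lower) (closure upper) := fun z hz => by
    rw [closure_lower] at hz
    rw [closure_upper]
    exact (neg_nonneg.mpr hz : 0 ≤ -z.im)
  have h2 : Tendsto (fun z : ℂ => -z) (cocompact ℂ) (cocompact ℂ) :=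
    (Homeomorph.neg ℂ).isClosedEmbedding.tendsto_cocompact
  refine ⟨fun p q => ?_, fun p q => ?_, fun p q => ?_, fun x => ?_⟩
  · exact (h.analytic p q).comp differentiable_neg.differentiableOn
      fun z hz => (neg_pos.mpr hz : 0 < -z.im)
  · exact (h.cont p q).comp continuous_neg.continuousOn h1
  · exact (h.at_infty p q).comp ((h2.mono_left inf_le_left).inf
      (tendsto_principal_principal.mpr h1) |>.mono_left (le_inf le_rfl inf_le_right))
  · rw [← h.eq_real, ofReal_neg]

lemma IsFactor.comp_neg {G : MatFun n} (h : IsFactor upper G) :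
    IsFactor lower fun x => G (-x) := by
  obtain ⟨H, L, h1, h2, h3⟩ := h
  refine ⟨_, L, h1.comp_neg, fun z hz => h2 _ ?_, h3⟩
  rw [closure_lower] at hz
  rw [closure_upper]
  exact (neg_nonneg.mpr hz : 0 ≤ -z.im)

lemma Entrywise.exists_extension {M : CircMat n} (hM : Entrywise IsPlus M) :
    ∃ E : ℂ → Matrix (Fin n) (Fin n) ℂ, (∀ p q, DiffContOnCl ℂ (fun z => E z p q) (ball 0 1)) ∧
      ∀ w : Circle, E w = M w := by
  choose u hu huM using hM
  exact ⟨fun z => Matrix.of fun p q => u p q z, hu, fun w => by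
    ext p q
    exact huM p q w⟩

/-- The identity `V U = 1` passes from the circle to the closed disc, because functions analytic
inside and equal on the boundary coincide. So the extension is invertible everywhere, including the
image `1` of infinity. -/
lemma isFactor_upper {V U : CircMat n} (hV : Entrywise IsPlus V) (hU : Entrywise IsPlus U)
    (h : V * U = 1) : IsFactor upper fun x => V (cay x) := by
  obtain ⟨E, hE, hEV⟩ := hV.exists_extension
  obtain ⟨E', hE', hEU⟩ := hU.exists_extension
  have key : ∀ z ∈ closedBall (0 : ℂ) 1, IsUnit (E z) := fun z hz => by
    refine IsUnit.of_mul_eq_one (E' z) ?_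
    ext p q
    have hd : DiffContOnCl ℂ (fun z => ∑ j, E z p j * E' z j q) (ball 0 1) := by
      have h1 : ∀ s : Finset (Fin n),
          DiffContOnCl ℂ (fun z => ∑ j ∈ s, E z p j * E' z j q) (ball 0 1) := fun s => by
        induction s using Finset.induction_on with
        | empty => simpa using diffContOnCl_const
        | insert i s hi ih =>
          simp only [Finset.sum_insert hi]
          exact (DiffContOnCl.mul_ball (hE p i) (hE' i q)).add ih
      exact h1 _
    have h1 := Complex.eqOn_closure_of_eqOn_frontier isBounded_ball hd
      (diffContOnCl_const (c := (1 : Matrix (Fin n) (Fin n) ℂ) p q)) fun ζ hζ => by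
        rw [frontier_ball _ one_ne_zero, mem_sphere_zero_iff_norm] at hζ
        obtain ⟨w, rfl⟩ : ∃ w : Circle, (w : ℂ) = ζ := ⟨⟨ζ, mem_sphere_zero_iff_norm.mpr hζ⟩, rfl⟩
        have h2 : (V * U) w p q = (1 : Matrix (Fin n) (Fin n) ℂ) p q := by rw [h, Pi.one_apply]
        rw [Pi.mul_apply, Matrix.mul_apply, ← hEV, ← hEU] at h2
        exact h2
    rw [closure_ball _ one_ne_zero] at h1
    rw [Matrix.mul_apply]
    exact h1 hz
  refine ⟨_, _, isContinuation_upper hE hEV, fun z hz => key _ ?_, key 1 (by simp)⟩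
  rw [closure_upper] at hz
  exact mem_closedBall_zero_iff.mpr (norm_div_add_I_le hz)

lemma isFactor_lower {V U : CircMat n} (hV : Entrywise IsMinus V) (hU : Entrywise IsMinus U)
    (h : V * U = 1) : IsFactor lower fun x => V (cay x) := by
  have h1 : IsFactor upper fun x => (fun w => V w⁻¹ : CircMat n) (cay x) :=
    isFactor_upper (U := fun w => U w⁻¹) hV hU (by
      ext w : 1
      exact congrFun h w⁻¹)
  have h2 := h1.comp_neg
  simpa only [cay_neg, inv_inv] using h2

/-! ### The operator norm of the singular integral -/

lemma S0_one (x : ℝ) : S0 (fun _ => 1) x = -1 := by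
  have h := S0_comp_cay (isHol_const 1) x
  rw [h, (projPlus_of_isMinus (isHol_const 1) (isMinus_const 1) _)]
  ring

lemma holderNorm_const (μ : ℝ) (c : ℂ) : holderNorm μ (fun _ => c) = ‖c‖ := by
  simp [holderNorm]

/-- Test on the constant `1`, which `S₀` sends to `-1`. This is the only quantitative information
about `C_μ` that enters. -/
lemma one_le_S0norm (μ : ℝ) : 1 ≤ S0norm μ := by
  refine le_iInf₂ fun C hC => ?_
  have h1 := (hC (fun _ => 1) ⟨0, fun x y => by simp⟩).2
  have h2 : S0 (fun _ => 1) = fun _ => -1 := funext S0_one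
  rw [h2, holderNorm_const, holderNorm_const, norm_neg, norm_one, mul_one] at h1
  exact_mod_cast h1

lemma norm_le_holderNorm {μ : ℝ} (hμ : 0 < μ) {f : ℝ → ℂ} (hf : IsHolderZero μ f) (x : ℝ) :
    ‖f x‖ ≤ holderNorm μ f := by
  -- Boundedness must be checked: a real supremum over an unbounded range is `0` by default.
  have h1 : BddAbove (range fun x => ‖f x‖) := by
    obtain ⟨B, -, hB⟩ := exists_bound_of_continuous (isHol_toCircle hμ hf).continuous
    refine ⟨B, ?_⟩
    rintro _ ⟨y, rfl⟩
    simpa only [toCircle_cay] using hB (cay y)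
  have h2 : 0 ≤ ⨆ p : ℝ × ℝ, ‖f p.1 - f p.2‖ / extDist p.1 p.2 ^ μ :=
    Real.iSup_nonneg fun p => div_nonneg (norm_nonneg _) (Real.rpow_nonneg (norm_nonneg _) _)
  exact (le_ciSup h1 x).trans (le_add_of_nonneg_right h2)

lemma norm_toCircle_le {μ : ℝ} (hμ : 0 < μ) {f : ℝ → ℂ} (hf : IsHolderZero μ f) (w : Circle) :
    ‖toCircle f w‖ ≤ holderNorm μ f := by
  by_cases hw : w = 1
  · rw [hw, toCircle_one, norm_zero]
    exact (norm_nonneg _).trans (norm_le_holderNorm hμ hf 0)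
  · rw [← cay_uncay hw, toCircle_cay]
    exact norm_le_holderNorm hμ hf _

/-- From `(1 + C_μ)² ≥ 4` the product is at most `1/4`. Extended arithmetic covers the degenerate
cases: `1/0 = ∞` imposes no restriction, and `1/∞ = 0` forces `ε = 0`. -/
lemma norm_mul_matHolderNorm_lt_one {ν : Matrix (Fin n) (Fin n) ℝ → ℝ}
    (hν : IsMonotoneMatrixNorm ν) {μ : ℝ} {N : MatFun n} {ε : ℂ}
    (hε : ENNReal.ofReal ‖ε‖ ≤ 1 / convConst ν μ N) : ‖ε‖ * matHolderNorm ν μ N < 1 := by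
  have h0 : 0 ≤ matHolderNorm ν μ N := hν.nonneg _
  have h1 : ENNReal.ofReal (matHolderNorm ν μ N) * 4 ≤ convConst ν μ N := by
    rw [convConst]
    gcongr
    calc (4 : ℝ≥0∞) = (1 + 1) ^ 2 := by norm_num
      _ ≤ _ := by gcongr; exact one_le_S0norm μ
  have h2 : ENNReal.ofReal ‖ε‖ * (ENNReal.ofReal (matHolderNorm ν μ N) * 4) ≤ 1 := by
    refine (mul_le_mul' hε h1).trans ?_
    rw [one_div]
    exact ENNReal.inv_mul_le_one _
  rw [show (4 : ℝ≥0∞) = ENNReal.ofReal 4 by simp, ← ENNReal.ofReal_mul h0,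
    ← ENNReal.ofReal_mul (norm_nonneg _), ENNReal.ofReal_le_one] at h2
  nlinarith [mul_nonneg (norm_nonneg ε) h0]

/-! ### The algorithm on the circle -/

lemma isHol_pow (m : ℕ) : IsHol fun w => (w : ℂ) ^ m := by
  induction m with
  | zero => simpa using isHol_const 1
  | succ m ih => simpa only [pow_succ] using ih.mul isHol_coe

lemma isHol_zpow (m : ℤ) : IsHol fun w => (w : ℂ) ^ m := by
  obtain ⟨k, rfl | rfl⟩ := m.eq_nat_or_neg
  · simpa using isHol_pow k
  · simpa using (isHol_pow k).comp_inv

lemma inv_coe_cay (x : ℝ) : ((x : ℂ) + I) / ((x : ℂ) - I) = (cay x : ℂ)⁻¹ := by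
  rw [coe_cay, cayley, inv_div]

section Algorithm

variable [NeZero n] (κ : Fin n → ℤ) (N : MatFun n)

/-- The matrix function `M₀` on the circle. -/
def startMat : CircMat n := fun w =>
  Matrix.of fun p q => (w : ℂ)⁻¹ ^ (κ 0 - 1) * toCircle (fun x => N x p q) w

/-- The rows in which `Λ₀` is not constant. -/
abbrev topRow (p : Fin n) : Prop := κ p = κ 0

lemma Lam0_eq (x : ℝ) : Lam0 κ x = circDiag (topRow κ) (cay x) := by
  rw [Lam0, circDiag, coe_cay]

lemma inv_Lam0 (x : ℝ) : (Lam0 κ x)⁻¹ = circDiagInv (topRow κ) (cay x) := by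
  rw [Lam0_eq]
  exact Matrix.inv_eq_right_inv (congrFun (circDiag_mul_inv (topRow κ)) (cay x))

/-- Once the right-hand side is split as plus and minus parts, `S₀` acts as `P - Q`, and the
formulas of the algorithm return these parts by uniqueness of the splitting. -/
lemma sol_eq {B : MatFun n} {P Q : CircMat n} (hP : Entrywise IsHol P) (hP0 : Entrywise IsPlusZero P)
    (hQ : Entrywise IsHol Q) (hQ0 : Entrywise IsMinus Q)
    (h : ∀ x, B x = Q (cay x) + P (cay x)) (x : ℝ) :
    solMinus B x = Q (cay x) ∧ solPlus κ B x = circDiagInv (topRow κ) (cay x) * P (cay x) := by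
  have h1 : ∀ p q, S0 (fun t => B t p q) x = P (cay x) p q - Q (cay x) p q := fun p q => by
    have h2 := (hQ p q).add (hP p q)
    have h3 := (projPlus_eq_of_decomposition h2 (hP0 p q) (hQ0 p q)
      (fun w => add_comm _ _) (cay x)).1
    have h4 := S0_comp_cay h2 x
    rw [h3] at h4
    simp only [h, Matrix.add_apply]
    rw [h4]
    ring
  constructor
  · ext p q
    simp only [solMinus, Matrix.of_apply, h1]
    rw [h, Matrix.add_apply]
    ring
  · ext p q
    simp only [solPlus, Matrix.of_apply, h1, circDiagInv, Matrix.diagonal_mul, inv_coe_cay]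
    rw [h, Matrix.add_apply]
    ring

variable {N} {μ : ℝ} (hμ : 0 < μ) (hN : ∀ p q, IsHolderZero μ fun x => N x p q)
include hμ hN

lemma isHol_startMat : Entrywise IsHol (startMat κ N) := fun p q => by
  simp only [startMat, Matrix.of_apply, inv_zpow']
  exact (isHol_zpow _).mul (isHol_toCircle hμ (hN p q))

/-- The scalar power has modulus `1` on the circle, so the integer `s` does not affect the bound. -/
lemma norm_startMat_le (w : Circle) (p q : Fin n) :
    ‖startMat κ N w p q‖ ≤ holderNorm μ fun x => N x p q := by
  rw [startMat, Matrix.of_apply, norm_mul, norm_zpow, norm_inv, Circle.norm_coe, inv_one, one_zpow,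
    one_mul]
  exact norm_toCircle_le hμ (hN p q) w

/-- Strong induction: the formal coefficients satisfy the quadratic recursion, and `sol_eq`
identifies the solutions already computed with those coefficients. -/
lemma rhs_eq (r : ℕ) : ∀ x, rhs κ N r x = minusCoeff (topRow κ) (startMat κ N) r (cay x) +
    plusCoeff (topRow κ) (startMat κ N) r (cay x) := by
  have hM := isHol_startMat κ hμ hN
  induction r using Nat.strong_induction_on with
  | _ r ih =>
    intro x
    have h1 := congrFun (coeff_recursion (topRow κ) hM r) (cay x)
    rw [Pi.add_apply] at h1
    rw [h1]
    cases r with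
    | zero =>
      rw [rhs]
      ext p q
      simp [startMat, toCircle_cay, inv_coe_cay]
    | succ r =>
      rw [rhs, if_neg (Nat.succ_ne_zero r), zero_sub, Pi.neg_apply, Finset.sum_apply,
        Finset.sum_range]
      refine congrArg Neg.neg (Finset.sum_congr rfl fun j _ => ?_)
      have h2 := fun i (hi : i < r + 1) => sol_eq κ (isHol_plusCoeff (topRow κ) hM i)
        (isPlusZero_plusCoeff (topRow κ) hM i) (isHol_minusCoeff (topRow κ) hM i)
        (isMinus_minusCoeff (topRow κ) hM i) (ih i hi) x
      rw [(h2 j.1 j.2).1, (h2 (r - j.1) (by omega)).2, Nat.add_sub_cancel, Pi.mul_apply,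
        Pi.mul_apply]

lemma sol_rhs (r : ℕ) (x : ℝ) :
    solMinus (rhs κ N r) x = minusCoeff (topRow κ) (startMat κ N) r (cay x) ∧
    solPlus κ (rhs κ N r) x =
      (circDiagInv (topRow κ) * plusCoeff (topRow κ) (startMat κ N) r) (cay x) := by
  have hM := isHol_startMat κ hμ hN
  exact sol_eq κ (isHol_plusCoeff (topRow κ) hM r) (isPlusZero_plusCoeff (topRow κ) hM r)
    (isHol_minusCoeff (topRow κ) hM r) (isMinus_minusCoeff (topRow κ) hM r) (rhs_eq κ hμ hN r) x

theorem isBoundedSolution_rhs (r : ℕ) :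
    IsBoundedSolution κ (rhs κ N r) (solPlus κ (rhs κ N r)) (solMinus (rhs κ N r)) := by
  have hM := isHol_startMat κ hμ hN
  have hs := sol_rhs κ hμ hN r
  have hp : solPlus κ (rhs κ N r) = fun x =>
      (circDiagInv (topRow κ) * plusCoeff (topRow κ) (startMat κ N) r) (cay x) :=
    funext fun x => (hs x).2
  have hm : solMinus (rhs κ N r) = fun x => minusCoeff (topRow κ) (startMat κ N) r (cay x) :=
    funext fun x => (hs x).1
  refine ⟨fun x => ?_, ?_, ?_⟩
  · rw [rhs_eq κ hμ hN r x, (hs x).1, (hs x).2, Lam0_eq, add_comm]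
    congr 1
    have h1 := congrFun (mul_assoc (circDiag (topRow κ)) (circDiagInv (topRow κ))
      (plusCoeff (topRow κ) (startMat κ N) r)) (cay x)
    rw [circDiag_mul_inv, one_mul] at h1
    exact h1.symm
  · have h1 : ∀ p q, ∃ u : ℂ → ℂ, DiffContOnCl ℂ u (ball 0 1) ∧ (κ p ≠ κ 0 → u 0 = 0) ∧
        ∀ w : Circle, u w =
          (circDiagInv (topRow κ) * plusCoeff (topRow κ) (startMat κ N) r) w p q := fun p q => by
      -- In the top rows the zero at the centre is used up in dividing by `w`; in the other rows it
      -- survives and gives the normalization at `z = i`.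
      by_cases h : κ p = κ 0
      · obtain ⟨u, hu, huM⟩ := isPlus_circDiagInv_mul (topRow κ)
          (isPlusZero_plusCoeff (topRow κ) hM r) p q
        exact ⟨u, hu, fun h' => absurd h h', huM⟩
      · obtain ⟨u, hu, hu0, huM⟩ := isPlusZero_plusCoeff (topRow κ) hM r p q
        refine ⟨u, hu, fun _ => hu0, fun w => ?_⟩
        rw [huM, Pi.mul_apply, circDiagInv, Matrix.diagonal_mul, if_neg h, one_mul]
    choose u hu hu0 huM using h1
    rw [hp]
    refine ⟨_, _, isContinuation_upper (E := fun z => Matrix.of fun p q => u p q z) hu fun w => ?_,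
      fun p q hpq => ?_⟩
    · ext p q
      exact huM p q w
    · rw [Matrix.of_apply, sub_self, zero_div]
      exact hu0 p q hpq
  · have h1 := isMinus_minusCoeff (topRow κ) hM r
    obtain ⟨E, hE, hEM⟩ := Entrywise.exists_extension
      (M := fun w => minusCoeff (topRow κ) (startMat κ N) r w⁻¹) h1
    have h2 := (isContinuation_upper hE hEM).comp_neg
    simp only [cay_neg, inv_inv] at h2
    rw [hm]
    exact ⟨_, _, h2⟩

end Algorithm

/-! ### Return to the series and the factorization on the line -/

lemma summable_matrix {f : ℕ → Matrix (Fin n) (Fin n) ℂ}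
    (h : ∀ p q, Summable fun r => f r p q) : Summable f :=
  Pi.summable.mpr fun p => Pi.summable.mpr fun q => h p q

lemma tsum_matrix_apply {f : ℕ → Matrix (Fin n) (Fin n) ℂ}
    (h : ∀ p q, Summable fun r => f r p q) (p q : Fin n) : (∑' r, f r) p q = ∑' r, f r p q :=
  (Pi.hasSum.mp (Pi.hasSum.mp (summable_matrix h).hasSum p) q).tsum_eq.symm

/-- Stability enters here: an index different from the largest must be one less, so a common scalar
power leaves only the exponents `1` and `0`. -/
lemma Lam_eq_smul_circDiag [NeZero n] {κ : Fin n → ℤ} (ha : Antitone κ) (hs : ∀ i j, κ i - κ j ≤ 1) (x : ℝ) :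
    Lam κ x = (cay x : ℂ) ^ (κ 0 - 1) • circDiag (topRow κ) (cay x) := by
  rw [Lam, circDiag, ← Matrix.diagonal_smul, ← coe_cay]
  congr 1
  ext j
  have h0 := Circle.coe_ne_zero (cay x)
  rw [Pi.smul_apply, smul_eq_mul]
  split_ifs with h
  · rw [h, ← zpow_add_one₀ h0, sub_add_cancel]
  · have h1 : κ j ≤ κ 0 := ha (Fin.zero_le j)
    have h2 := hs 0 j
    have h3 : κ j = κ 0 - 1 := by
      have : κ j ≠ κ 0 := h
      omega
    rw [h3, mul_one]

section Algorithm

variable [NeZero n] (κ : Fin n → ℤ) {N : MatFun n} {μ : ℝ} (hμ : 0 < μ)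
  (hN : ∀ p q, IsHolderZero μ fun x => N x p q) {ν : Matrix (Fin n) (Fin n) ℝ → ℝ}
  (hν : IsMonotoneMatrixNorm ν) {ε : ℂ} (hε : ‖ε‖ * matHolderNorm ν μ N < 1)
include hμ hN hν hε

lemma series_minus (x : ℝ) : (Summable fun r => termMinus κ ε N r x) ∧
    seriesMinus κ ε N x = evalSeries ε (seriesV (topRow κ) (startMat κ N)) (cay x) := by
  obtain ⟨-, hV, -, -⟩ := absConv_series (topRow κ) hν (isHol_startMat κ hμ hN)
    (norm_startMat_le κ hμ hN) hε
  have h1 := evalSeries_one_add_shiftSeries hV (cay x)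
  have h2 : ∀ r p q, termMinus κ ε N r x p q = ε ^ (r + 1) *
      (minusCoeff (topRow κ) (startMat κ N) r * circDiagInv (topRow κ)) (cay x) p q :=
    fun r p q => by
    rw [termMinus, coeffMinus, Nat.add_sub_cancel, (sol_rhs κ hμ hN r x).1, inv_Lam0,
      Matrix.smul_apply, smul_eq_mul]
    rfl
  have h3 : ∀ p q, Summable fun r => termMinus κ ε N r x p q := fun p q => by
    simp only [h2]
    exact (h1 p q).1
  refine ⟨summable_matrix h3, ?_⟩
  ext p q
  rw [seriesMinus, Matrix.add_apply, tsum_matrix_apply h3]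
  simp only [h2]
  exact ((h1 p q).2).symm

lemma series_plus (x : ℝ) : (Summable fun r => termPlus κ ε N r x) ∧
    seriesPlus κ ε N x = evalSeries ε (seriesQ (topRow κ) (startMat κ N)) (cay x) := by
  obtain ⟨-, -, hQ, -⟩ := absConv_series (topRow κ) hν (isHol_startMat κ hμ hN)
    (norm_startMat_le κ hμ hN) hε
  have h1 := evalSeries_one_add_shiftSeries hQ (cay x)
  have h2 : ∀ r p q, termPlus κ ε N r x p q = ε ^ (r + 1) *
      (circDiagInv (topRow κ) * plusCoeff (topRow κ) (startMat κ N) r) (cay x) p q :=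
    fun r p q => by
    rw [termPlus, coeffPlus, Nat.add_sub_cancel, (sol_rhs κ hμ hN r x).2,
      Matrix.smul_apply, smul_eq_mul]
  have h3 : ∀ p q, Summable fun r => termPlus κ ε N r x p q := fun p q => by
    simp only [h2]
    exact (h1 p q).1
  refine ⟨summable_matrix h3, ?_⟩
  ext p q
  rw [seriesPlus, Matrix.add_apply, tsum_matrix_apply h3]
  simp only [h2]
  exact ((h1 p q).2).symm

theorem isRightFactorization_series {G : MatFun n} (ha : Antitone κ) (hs : ∀ i j, κ i - κ j ≤ 1)
    (hG : ∀ x, G x = Lam κ x + ε • N x) :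
    IsRightFactorization G (seriesMinus κ ε N) κ (seriesPlus κ ε N) := by
  have hM := isHol_startMat κ hμ hN
  have hB := norm_startMat_le κ hμ hN
  have hm : seriesMinus κ ε N = _ := funext fun x => (series_minus κ hμ hN hν hε x).2
  have hp : seriesPlus κ ε N = _ := funext fun x => (series_plus κ hμ hN hν hε x).2
  rw [hm, hp]
  refine ⟨?_, ?_, fun x => ?_⟩
  · obtain ⟨hV, U, hU, hVU⟩ := minus_factor (topRow κ) hν hM hB hε
    exact isFactor_lower hV hU hVU
  · obtain ⟨hQ, Y, hY, hQY⟩ := plus_factor (topRow κ) hν hM hB hε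
    exact isFactor_upper hQ hY hQY
  · have h1 := congrFun (circle_factorization (topRow κ) hν hM hB hε) (cay x)
    simp only [Pi.mul_apply, Pi.add_apply, Pi.smul_apply] at h1
    -- The scalar power commutes with everything, so it can be restored in the circle factorization
    -- on both sides at once.
    have h2 : N x = (cay x : ℂ) ^ (κ 0 - 1) • startMat κ N (cay x) := by
      ext p q
      rw [Matrix.smul_apply, startMat, Matrix.of_apply, toCircle_cay, smul_eq_mul, ← mul_assoc,
        ← mul_zpow, mul_inv_cancel₀ (Circle.coe_ne_zero _), one_zpow, one_mul]
    rw [hG, Lam_eq_smul_circDiag ha hs, Matrix.mul_smul, Matrix.smul_mul, h1, smul_add, smul_comm _ ε,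
      ← h2]

end Algorithm

end WienerHopf

end

open WienerHopf in
theorem theorem1 {n : ℕ} [NeZero n] (hn : 2 ≤ n) (μ : ℝ) (hμ0 : 0 < μ) (hμ1 : μ < 1)
    (G R : ℝ → MatFun n) (F Fm Fp : MatFun n) (κ : Fin n → ℤ)
    (hG : IsSK μ G R F Fm κ Fp)
    (ε : ℝ → ℂ) (N : ℝ → MatFun n) (hN : HasDecomposition μ G Fm κ Fp ε N)
    (ν : Matrix (Fin n) (Fin n) ℝ → ℝ) (hν : IsMonotoneMatrixNorm ν)
    (φ : ℝ) (hε : ENNReal.ofReal ‖ε φ‖ ≤ 1 / convConst ν μ (N φ)) :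
    (∀ r : ℕ, 1 ≤ r → IsBoundedSolution κ (rhs κ (N φ) (r - 1))
      (coeffPlus κ (N φ) r) (coeffMinus κ (N φ) r)) ∧
    (∀ x : ℝ, Summable (fun r => termMinus κ (ε φ) (N φ) r x) ∧
      Summable (fun r => termPlus κ (ε φ) (N φ) r x)) ∧
    IsRightFactorization (G1 (G φ) Fm Fp)
      (seriesMinus κ (ε φ) (N φ)) κ (seriesPlus κ (ε φ) (N φ)) := by
  have h1 := norm_mul_matHolderNorm_lt_one hν hε
  refine ⟨fun r _ => isBoundedSolution_rhs κ hμ0 (hN.holder φ) (r - 1),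
    fun x => ⟨(series_minus κ hμ0 (hN.holder φ) hν h1 x).1,
      (series_plus κ hμ0 (hN.holder φ) hν h1 x).1⟩, ?_⟩
  exact isRightFactorization_series κ hμ0 (hN.holder φ) hν h1 hG.ordered hG.stable (hN.eq φ)
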